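/- **Setting.** Let $\mathcal M=(\mathcal S,\mathcal A,P,R,H,s_1)$ be an episodic tabular MDP with $S=|\mathcal S|$ states, $A=|\mathcal A|$ actions, horizon $H$, transition laws $P_h(\cdot\mid s,a)$, stochastic rewards $R_h(s,a)$ with values in $[0,1]$, and fixed initial state $s_1$. For a deterministic policy $\pi=(\pi_h)_{h\le H}$ let $V_1^\pi(s_1)$ be its expected total reward in one episode, and $V_1^*(s_1)=\max_\pi V_1^\pi(s_1)$. There are $m$ agents, a set $\mathcal B$ of $\alpha m$ Byzantine ones and the set $\mathcal G$ of the $(1-\alpha)m$ good ones. In each of $K$ episodes every good agent samples, independently given the past, a trajectory of $\mathcal M$ under the policy prescribed by the server. All messages of the Byzantine agents are arbitrary: they may depend on everything that has happened so far, on additional randomness, and on each other. **Estimator PWC.** Input: $(x_j,n_j)_{j\le m}$, $\sigma,\alpha,\epsilon,\delta'$, for data in an interval of length $\sigma$. Let $n^{\rm cut}$ be the $(2\alpha m+1)$-th largest $n_j$. If $n^{\rm cut}=0$, return estimate $0$ and error $\sigma$. Otherwise let $\tilde n_j=\min(n_j,n^{\rm cut})$, let $I_j$ be the closed interval with center $x_j$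 and half-width $\frac{\sigma}{\sqrt{\tilde n_j}}\sqrt{2\log\frac{2m}{\delta'}}+\epsilon$ ($I_j=\mathbb R$ if $\tilde n_j=0$), let $U^*$ be a largest $U\subseteq[m]$ with $\bigcap_{j\in U}I_j\ne\emptyset$, and return $$\hat x=\frac{\sum_{j\in U^*}\tilde n_jx_j}{\sum_{j\in U^*}\tilde n_j},\qquad \mathrm{Error}=\frac{2\sigma}{\sqrt{\sum_{j\le m}\tilde n_j}}\sqrt{2\log\tfrac{2}{\delta'}}+\frac{8\alpha m\sqrt{n^{\rm cut}}}{\sum_{j\le m}\tilde n_j}\,\sigma\sqrt{2\log\tfrac{2m}{\delta'}}+6\epsilon .$$ **Algorithm Byzan-UCBVI$(K,\delta,\alpha)$.** Let $\epsilon=\frac1{SAHKm}$ and $\delta'=\frac{\delta}{(SAHKm)^{3S}}$. Let $N_h^j(s,a)$ be the number of visits of agent $j$ to $(s,a)$ at step $h$ so far. Initially all $\mathrm{SyncCount}_j=-1$ and all requests $\mathrm{Sync}_j$ are true. At the start of each episode, for every $j$ with $\mathrm{Sync}_j$ true and $\mathrm{SyncCount}_j\le SAH\log_2K$ the server increases $\mathrm{SyncCount}_j$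 by $1$; if there is such a $j$, a synchronization takes place. In a synchronization the good agents set $N^{\rm old}_{h,j}(s,a)\leftarrow N_h^j(s,a)$, and for $h=H,\dots,1$, starting with $\hat V_{H+1}=0$, the server receives for every $(s,a)$ from each good agent $j$ the number $n_j=N_h^j(s,a)$ and the average $x_j$ of $r+\hat V_{h+1}(s')$ over the data $(s,a,r,s')$ of $j$ at step $h$ ($x_j=0$ if $n_j=0$), and from each Byzantine agent an arbitrary $x_j\in\mathbb R$ and $n_j\in\mathbb N$; it calls PWC with $\sigma=H-h+1$ and $\alpha,\epsilon,\delta'$, obtains an estimate $\hat x_h(s,a)$ and an error $\Gamma_h(s,a)$, and sets $$\hat Q_h(s,a)=\max\{\min\{\hat x_h(s,a)+\Gamma_h(s,a),\,H-h+1\},0\},\quad \hat V_h(s)=\max_a\hat Q_h(s,a),\quad \hat\pi_h(s)\in\arg\max_a\hat Q_h(s,a).$$ Without a synchronization the policy is kept. All good agents play the current policy, called $\hat\pi^k$ in episode $k$. After the episode a good agent $j$ requests a synchronization iff $N_h^j(s,a)\ge 2N^{\rm old}_{h,j}(s,a)$ and $N_h^j(s,a)>0$ for some $(h,s,a)$;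 Byzantine agents request as they like. Ties in both arg max operations are broken by an arbitrary deterministic rule. **Theorem.** There is a universal constant $C>0$ such that for all $\mathcal M$, all $m,K,H\ge1$, all $\alpha\le\frac13\left(1-\frac1m\right)$ with $|\mathcal B|=\alpha m$, all $0<\delta<\frac14$ and all behaviours of the Byzantine agents, with probability at least $1-3\delta$, $$\sum_{k=1}^K\sum_{j\in\mathcal G}\bigl(V_1^*(s_1)-V_1^{\hat\pi^k}(s_1)\bigr)\le C\left((1+\alpha\sqrt m)\,H^2S\sqrt{AmK\log\tfrac{SAHKm}{\delta}}+SAH^2m\log\tfrac{SAHKm}{\delta}\right).$$ Up to logarithmic factors, and up to the second term, whose dependence on $K$ is only logarithmic and which is dominated up to logarithmic factors by the first one as soon as $K\ge Am$, this is $\tilde O\bigl((1+\alpha\sqrt m)H^2S\sqrt{AmK\log(1/\delta)}\bigr)$. -/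

import Mathlib

open MeasureTheory ProbabilityTheory

namespace ByzRL

noncomputable section

/-! ### The Markov decision process -/

/-- A finite-horizon episodic tabular MDP with deterministic initial state. Steps are indexed by
`Fin H`, so the step called `h` in 1-based notation is `h - 1` here. -/
structure MDP (S A : Type*) (H : ℕ) where
  /-- transition probabilities `P_h(· | s, a)` -/
  P : Fin H → S → A → PMF S
  /-- law of the stochastic reward `R_h(s, a)` -/
  R : Fin H → S → A → Measure ℝ
  isProbabilityMeasure_R : ∀ h s a, IsProbabilityMeasure (R h s a)
  reward_mem : ∀ h s a, ∀ᵐ r ∂(R h s a), r ∈ Set.Icc (0 : ℝ) 1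
  /-- initial state -/
  s₁ : S

/-- Deterministic nonstationary policies. -/
abbrev Policy (S A : Type*) (H : ℕ) := Fin H → S → A

/-- One episode of one agent: the states `s_1, …, s_{H+1}`, the actions `a_1, …, a_H` and the
rewards `r_1, …, r_H`. -/
abbrev Traj (S A : Type*) (H : ℕ) := (Fin (H + 1) → S) × (Fin H → A) × (Fin H → ℝ)

section Mdp

variable {S A : Type*} {H : ℕ} [Fintype S] [DecidableEq S] [MeasurableSpace S] [MeasurableSpace A]

/-- The law of an episode when the policy `π` is executed: the state path `σ` starts at `s₁` and has
probability `∏_h P_h(σ_{h+1} | σ_h, π_h(σ_h))`; given the path, the actions are `π_h(σ_h)` and the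
rewards are independent with laws `R_h(σ_h, π_h(σ_h))`. -/
def trajLaw (M : MDP S A H) (π : Policy S A H) : Measure (Traj S A H) :=
  ∑ σ : Fin (H + 1) → S,
    (if σ 0 = M.s₁ then
        ∏ h : Fin H, M.P h (σ h.castSucc) (π h (σ h.castSucc)) (σ h.succ)
      else 0) •
      (Measure.dirac σ).prod
        ((Measure.dirac fun h : Fin H => π h (σ h.castSucc)).prod
          (Measure.pi fun h : Fin H => M.R h (σ h.castSucc) (π h (σ h.castSucc))))

/-- `V_1^π(s_1)`: the expected total reward of an episode under `π`. -/
def value (M : MDP S A H) (π : Policy S A H) : ℝ :=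
  ∫ τ, ∑ h : Fin H, τ.2.2 h ∂(trajLaw M π)

/-- `V_1^*(s_1) = max_π V_1^π(s_1)` (a maximum over a finite set when `S` and `A` are finite). -/
def optValue (M : MDP S A H) : ℝ := ⨆ π : Policy S A H, value M π

end Mdp

/-! ### The robust mean estimator Pert-Weighted-Clique -/

/-- Deterministic tie-breaking rules for the two argmax operations of the algorithm: which of the
largest cliques of agents is used, and which of the greedy actions is taken. -/
structure TieBreak (A : Type*) (m : ℕ) where
  clique : Finset (Finset (Fin m)) → Finset (Fin m)
  clique_mem : ∀ F : Finset (Finset (Fin m)), F.Nonempty → clique F ∈ F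
  action : Finset A → A
  action_mem : ∀ F : Finset A, F.Nonempty → action F ∈ F

section Pwc

variable {m : ℕ}

/-- The `r`-th largest value (with multiplicity, `1 ≤ r ≤ m`) among `n_1, …, n_m`: the largest `v`
such that at least `r` of the numbers are `≥ v`. -/
def kthLargest (n : Fin m → ℕ) (r : ℕ) : ℕ :=
  sSup {v : ℕ | r ≤ (Finset.univ.filter fun j => v ≤ n j).card}

/-- `n^cut`, the `(2αm+1)`-th largest batch size. -/
def nCut (α : ℝ) (n : Fin m → ℕ) : ℕ := kthLargest n (⌊2 * α * m⌋₊ + 1)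

/-- The clipped batch size. -/
def nTilde (α : ℝ) (n : Fin m → ℕ) (j : Fin m) : ℕ := min (n j) (nCut α n)

/-- The confidence interval `I_j`; it is all of `ℝ` for an empty batch. -/
def confInterval (σ α ε δ : ℝ) (x : Fin m → ℝ) (n : Fin m → ℕ) (j : Fin m) : Set ℝ :=
  if nTilde α n j = 0 then Set.univ
  else
    Set.Icc
      (x j - σ / √(nTilde α n j) * √(2 * Real.log (2 * m / δ)) - ε)
      (x j + σ / √(nTilde α n j) * √(2 * Real.log (2 * m / δ)) + ε)

open Classical in
/-- The sets of agents whose confidence intervals have a common point. -/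
def cliques (σ α ε δ : ℝ) (x : Fin m → ℝ) (n : Fin m → ℕ) : Finset (Finset (Fin m)) :=
  Finset.univ.filter fun U => (⋂ j ∈ U, confInterval σ α ε δ x n j).Nonempty

/-- The sets of maximal cardinality among those. -/
def maxCliques (σ α ε δ : ℝ) (x : Fin m → ℝ) (n : Fin m → ℕ) : Finset (Finset (Fin m)) :=
  (cliques σ α ε δ x n).filter fun U => ∀ U' ∈ cliques σ α ε δ x n, U'.card ≤ U.card

/-- Pert-Weighted-Clique, for data with values in an interval of length `σ`: returns the pair
(estimate, error bound) computed from the batch means `x` and the batch sizes `n`. -/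
def pwc {A : Type*} (tie : TieBreak A m) (x : Fin m → ℝ) (n : Fin m → ℕ) (σ α ε δ : ℝ) : ℝ × ℝ :=
  if 0 < nCut α n then
    let U := tie.clique (maxCliques σ α ε δ x n)
    ((∑ j ∈ U, (nTilde α n j : ℝ) * x j) / ∑ j ∈ U, (nTilde α n j : ℝ),
      2 / √(∑ j, (nTilde α n j : ℝ)) * σ * √(2 * Real.log (2 / δ))
        + 8 * α * m * √(nCut α n) / (∑ j, (nTilde α n j : ℝ)) * σ * √(2 * Real.log (2 * m / δ))
        + 5 * ε + ε)
  else (0, σ)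

end Pwc

/-! ### The algorithm Byzan-UCBVI -/

/-- Everything in an execution that the protocol does not determine: the trajectories sampled by the
agents (only those of good agents are used) and the messages of the Byzantine agents (only those of
Byzantine agents are used). Episodes are numbered `0, 1, 2, …`.
`byzSync k j` is the synchronization request of `j` that the server receives at the start of
episode `k`; `byzMean k h s a j` and `byzCount k h s a j` are the numbers `x_j` and `n_j` that `j`
sends for `(h, s, a)` if there is a synchronization at the start of episode `k`. -/
structure Transcript (S A : Type*) (H m : ℕ) where
  traj : ℕ → Fin m → Traj S A H
  byzSync : ℕ → Fin m → Bool
  byzMean : ℕ → Fin H → S → A → Fin m → ℝ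
  byzCount : ℕ → Fin H → S → A → Fin m → ℕ

/-- The variables that are kept between episodes. -/
structure ServerState (S A : Type*) (H m : ℕ) where
  syncCount : Fin m → ℤ
  nOld : Fin m → Fin H → S → A → ℕ
  policy : Policy S A H

section Algorithm

variable {S A : Type*} {H m : ℕ} [Fintype S] [DecidableEq S] [Fintype A] [DecidableEq A]

/-- The episodes before episode `k` in which agent `j` visits `(s, a)` at step `h`. -/
def visits (X : Transcript S A H m) (k : ℕ) (j : Fin m) (h : Fin H) (s : S) (a : A) : Finset ℕ :=
  (Finset.range k).filter fun t =>
    (X.traj t j).1 h.castSucc = s ∧ (X.traj t j).2.1 h = a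

/-- `N_h^j(s, a)` at the start of episode `k`. -/
def count (X : Transcript S A H m) (k : ℕ) (j : Fin m) (h : Fin H) (s : S) (a : A) : ℕ :=
  (visits X k j h s a).card

/-- The average of `r + V(s')` over the data of agent `j` at `(h, s, a)` (with `0 / 0 = 0`). -/
def batchMean (X : Transcript S A H m) (k : ℕ) (j : Fin m) (h : Fin H) (s : S) (a : A)
    (V : S → ℝ) : ℝ :=
  (∑ t ∈ visits X k j h s a, ((X.traj t j).2.2 h + V ((X.traj t j).1 h.succ)))
    / count X k j h s a

/-- `x_j` as received by the server in the synchronization of episode `k`. -/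
def sentMean (B : Finset (Fin m)) (X : Transcript S A H m) (k : ℕ) (h : Fin H) (V : S → ℝ)
    (s : S) (a : A) (j : Fin m) : ℝ :=
  if j ∈ B then X.byzMean k h s a j else batchMean X k j h s a V

/-- `n_j` as received by the server in the synchronization of episode `k`. -/
def sentCount (B : Finset (Fin m)) (X : Transcript S A H m) (k : ℕ) (h : Fin H)
    (s : S) (a : A) (j : Fin m) : ℕ :=
  if j ∈ B then X.byzCount k h s a j else count X k j h s a

variable (S A H m) in
/-- The real number `SAHKm`. -/
def sahkm (K : ℕ) : ℝ := (Fintype.card S : ℝ) * Fintype.card A * H * K * m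

variable (S A H m) in
/-- `ε = 1 / (SAHKm)`. -/
def epsParam (K : ℕ) : ℝ := 1 / sahkm S A H m K

variable (S A H m) in
/-- `δ' = δ / (SAHKm)^{3S}`. -/
def deltaParam (K : ℕ) (δ : ℝ) : ℝ := δ / sahkm S A H m K ^ (3 * Fintype.card S)

/-- `Q̂_h` computed from `V = V̂_{h+1}`. The 1-based expression `H - h + 1` is `H - h` here. -/
def qHat (tie : TieBreak A m) (B : Finset (Fin m)) (K : ℕ) (δ α : ℝ) (X : Transcript S A H m)
    (k : ℕ) (h : Fin H) (V : S → ℝ) (s : S) (a : A) : ℝ :=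
  let est := pwc tie (sentMean B X k h V s a) (sentCount B X k h s a) ((H : ℝ) - h) α
    (epsParam S A H m K) (deltaParam S A H m K δ)
  max (min (est.1 + est.2) ((H : ℝ) - h)) 0

/-- `V̂`, by backward recursion from `V̂_{H+1} = 0` with `V̂_h(s) = max_a Q̂_h(s, a)`. -/
def vHat (tie : TieBreak A m) (B : Finset (Fin m)) (K : ℕ) (δ α : ℝ) (X : Transcript S A H m)
    (k : ℕ) : Fin (H + 1) → S → ℝ :=
  Fin.reverseInduction (motive := fun _ => S → ℝ) (fun _ => 0)
    (fun h V s => ⨆ a, qHat tie B K δ α X k h V s a)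

open Classical in
/-- The greedy policy computed in a synchronization at the start of episode `k`. -/
def greedy (tie : TieBreak A m) (B : Finset (Fin m)) (K : ℕ) (δ α : ℝ) (X : Transcript S A H m)
    (k : ℕ) : Policy S A H := fun h s =>
  tie.action (Finset.univ.filter fun a => ∀ a',
    qHat tie B K δ α X k h (vHat tie B K δ α X k h.succ) s a' ≤
      qHat tie B K δ α X k h (vHat tie B K δ α X k h.succ) s a)

/-- `Sync_j` as received by the server at the start of episode `k`. All flags are initialized as
true. A good agent requests a synchronization iff `N / N^old ≥ 2` for some `(h, s, a)`, where
`0 / 0 = 0` and `n / 0 = ∞` for `n > 0`. -/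
def syncFlag (B : Finset (Fin m)) (X : Transcript S A H m) (k : ℕ) (st : ServerState S A H m)
    (j : Fin m) : Prop :=
  if k = 0 then True
  else if j ∈ B then X.byzSync k j = true
  else ∃ h s a, 0 < count X k j h s a ∧ 2 * st.nOld j h s a ≤ count X k j h s a

/-- The request of `j` is received and `SyncCount_j ≤ S A H log₂ K`. -/
def accepted (B : Finset (Fin m)) (K : ℕ) (X : Transcript S A H m) (k : ℕ)
    (st : ServerState S A H m) (j : Fin m) : Prop :=
  syncFlag B X k st j ∧
    (st.syncCount j : ℝ) ≤ (Fintype.card S : ℝ) * Fintype.card A * H * Real.logb 2 K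

open Classical in
/-- What happens at the start of episode `k`, before the agents sample. -/
def syncPhase (tie : TieBreak A m) (B : Finset (Fin m)) (K : ℕ) (δ α : ℝ)
    (X : Transcript S A H m) (k : ℕ) (st : ServerState S A H m) : ServerState S A H m where
  syncCount := fun j => if accepted B K X k st j then st.syncCount j + 1 else st.syncCount j
  nOld := if ∃ j, accepted B K X k st j then fun j => count X k j else st.nOld
  policy := if ∃ j, accepted B K X k st j then greedy tie B K δ α X k else st.policy

/-- The state before the start of episode `k`. The initial policy is a dummy: it is replaced at the
start of the first episode. -/
def stateBefore (tie : TieBreak A m) (B : Finset (Fin m)) (K : ℕ) (δ α : ℝ)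
    (X : Transcript S A H m) : ℕ → ServerState S A H m
  | 0 => { syncCount := fun _ => -1
           nOld := fun _ _ _ _ => 0
           policy := fun _ _ => tie.action Finset.univ }
  | k + 1 => syncPhase tie B K δ α X k (stateBefore tie B K δ α X k)

/-- `π̂_k`, the policy that all good agents execute in episode `k`. -/
def playedPolicy (tie : TieBreak A m) (B : Finset (Fin m)) (K : ℕ) (δ α : ℝ)
    (X : Transcript S A H m) (k : ℕ) : Policy S A H :=
  (stateBefore tie B K δ α X (k + 1)).policy

/-- The total regret of the good agents over `K` episodes. -/
def regret [MeasurableSpace S] [MeasurableSpace A] (M : MDP S A H) (tie : TieBreak A m)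
    (B : Finset (Fin m)) (K : ℕ) (δ α : ℝ) (X : Transcript S A H m) : ℝ :=
  ∑ k ∈ Finset.range K, ∑ _j ∈ Bᶜ, (optValue M - value M (playedPolicy tie B K δ α X k))

/-- `X` is a random execution of Byzan-UCBVI with Byzantine agents `B` on the MDP `M`.
`ℱ k` is all the information that exists when the agents start to sample in episode `k`; it may
contain more than the past trajectories, so that the Byzantine agents may be randomized, may know
everything that has happened, and may collude. Their messages are arbitrary functions of it. Given
`ℱ k`, the good agents sample independent trajectories under the current policy. -/
structure IsByzantineRun {Ω : Type*} {mΩ : MeasurableSpace Ω} [MeasurableSpace S]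
    [MeasurableSpace A] (μ : Measure Ω) (ℱ : Filtration ℕ mΩ) (M : MDP S A H)
    (tie : TieBreak A m) (B : Finset (Fin m)) (K : ℕ) (δ α : ℝ)
    (X : Ω → Transcript S A H m) : Prop where
  measurable_byzSync : ∀ k, ∀ j ∈ B, Measurable[ℱ k] fun ω => (X ω).byzSync k j
  measurable_byzMean : ∀ k h s a, ∀ j ∈ B, Measurable[ℱ k] fun ω => (X ω).byzMean k h s a j
  measurable_byzCount : ∀ k h s a, ∀ j ∈ B, Measurable[ℱ k] fun ω => (X ω).byzCount k h s a j
  measurable_traj : ∀ k, ∀ j ∉ B, Measurable[ℱ (k + 1)] fun ω => (X ω).traj k j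
  law_traj : ∀ k < K, ∀ E : Set Ω, MeasurableSet[ℱ k] E → ∀ π : Policy S A H,
    ∀ T : Set ({j // j ∉ B} → Traj S A H), MeasurableSet T →
      μ (E ∩ {ω | playedPolicy tie B K δ α (X ω) k = π}
          ∩ {ω | (fun j : {j // j ∉ B} => (X ω).traj k j) ∈ T}) =
        μ (E ∩ {ω | playedPolicy tie B K δ α (X ω) k = π})
          * Measure.pi (fun _ : {j // j ∉ B} => trajLaw M π) T

end Algorithm

end

end ByzRL

open ByzRL

set_option linter.unusedSectionVars false

/-! The regret of an optimistic policy is at most the expected sum of its own estimation errors.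
`performance_difference` telescopes arbitrary candidate value functions along a trajectory. For an
arbitrary policy it shows that `V̂` dominates the optimal value as soon as every `Q̂` dominates the
true one-step backup `MDP.qMean` of the next `V̂`; for the greedy policy it bounds the regret of an
episode by the expected gaps, each at most `min (2 Γ) (H - h)`. No Bellman equation for the optimal
value is needed.

Robustness (`abs_pwc_sub_le`). Let `b = αm`. The intervals of the good agents contain the true mean,
so these agents form a clique and a largest clique misses at most `b` agents. The rank `2b + 1` of
the cut guarantees a good agent in the clique with at least `n^cut` data. All members of the clique
have intervals meeting the one of this agent, which limits what a Byzantine member can do. Relative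
to the summed noise of the first `n^cut` data of each good agent, only `O(b)` agents cause an
additional error: Byzantine members, good agents outside the clique, and the at most `2b` clipped
agents.

Concentration. The next `V̂` depends on the same data and on the Byzantine messages, so the noise is
bounded for all value functions on a grid of mesh `ε`. This union bound explains the power `3S` in
`δ'`. For a fixed function and weights depending only on the index of a visit,
`IsByzantineRun.lintegral_prod_le_one` provides an exponential supermartingale; it uses only that
the fresh good trajectories are independent given `ℱ k` with the law of the current policy.

Counts. All good agents play the same policies, so each of their counts is comparable to the
expected count `Λ` given the policies (`CountBounded`). By `exists_sync_episode` the data behind the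
current policy are out of date by at most a factor two. Once `Λ` exceeds a logarithm, `n^cut` is of
order `Λ` and the total weight at least of order `mΛ`, whence `Γ ≲ (1 + α√m) H √(S L) / √(mΛ) + ε`
with `L = log (SAHKm / δ)`. Summing `p / √Λ` over the episodes gives `√Λ_K`, and Cauchy–Schwarz over
the `HSA` triples gives the first term of the bound. Small `Λ` gives the second term. -/

namespace ByzRL

/-! ### Sums over state paths -/

section PathSum

variable {S : Type*} [Fintype S] [DecidableEq S]

/-- The sum over all paths from `s` of the product of the transition weights, by backward
recursion. -/
noncomputable def pathSum : ∀ {n : ℕ}, (Fin n → S → S → ENNReal) → S → ENNReal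
  | 0, _, _ => 1
  | _ + 1, f, s => ∑ s', f 0 s s' * pathSum (fun i => f i.succ) s'

theorem sum_paths_eq_pathSum {n : ℕ} (f : Fin n → S → S → ENNReal) (s : S) :
    ∑ σ : Fin (n + 1) → S, (if σ 0 = s then ∏ i, f i (σ i.castSucc) (σ i.succ) else 0)
      = pathSum f s := by
  induction n generalizing s with
  | zero =>
    rw [← (Fin.consEquiv fun _ : Fin 1 => S).sum_comp, Fintype.sum_prod_type]
    simp [pathSum, Fin.consEquiv]
  | succ n ih =>
    rw [← (Fin.consEquiv fun _ : Fin (n + 1 + 1) => S).sum_comp, Fintype.sum_prod_type]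
    simp only [Fin.consEquiv, Equiv.coe_fn_mk, Fin.cons_zero, pathSum]
    rw [Finset.sum_comm]
    simp only [Finset.sum_ite_eq', Finset.mem_univ, if_true, Fin.prod_univ_succ (n := n),
      Fin.castSucc_zero, Fin.cons_zero, Fin.cons_succ, ← Fin.succ_castSucc]
    simp_rw [← ih, Finset.mul_sum]
    rw [Finset.sum_comm]
    simp

theorem pathSum_eq_one {n : ℕ} (f : Fin n → S → S → ENNReal) (hf : ∀ i s, ∑ s', f i s s' = 1)
    (s : S) : pathSum f s = 1 := by
  induction n generalizing s with
  | zero => rfl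
  | succ n ih =>
    simp only [pathSum]
    simp_rw [ih (fun i => f i.succ) (fun i s => hf i.succ s), mul_one]
    exact hf 0 s

/-- The steps after `h` carry total weight one from every state and the steps before `h` agree, so
only the row sums at step `h` matter. This replaces conditioning on the state at step `h`. -/
theorem pathSum_mono_step {n : ℕ} (h : Fin n) (f g : Fin n → S → S → ENNReal)
    (hfg : ∀ i ≠ h, f i = g i) (hf : ∀ i ≠ h, ∀ s, ∑ s', f i s s' = 1)
    (hh : ∀ s, ∑ s', f h s s' ≤ ∑ s', g h s s') (s : S) : pathSum f s ≤ pathSum g s := by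
  induction n generalizing s with
  | zero => exact h.elim0
  | succ n ih =>
    simp only [pathSum]
    rcases Fin.eq_zero_or_eq_succ h with rfl | ⟨h', rfl⟩
    · have e : ∀ s', pathSum (fun i => f i.succ) s' = 1 := fun s' =>
        pathSum_eq_one _ (fun i s => hf i.succ (Fin.succ_ne_zero i) s) s'
      have e' : ∀ s', pathSum (fun i => g i.succ) s' = 1 := fun s' =>
        pathSum_eq_one _ (fun i s => by
          rw [← hfg i.succ (Fin.succ_ne_zero i)]; exact hf i.succ (Fin.succ_ne_zero i) s) s'
      simp only [e, e', mul_one]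
      exact hh s
    · rw [hfg 0 (Fin.succ_ne_zero h').symm]
      refine Finset.sum_le_sum fun s' _ => ?_
      gcongr
      exact ih h' _ _ (fun i hi => hfg _ (by simpa using hi)) (fun i hi => hf _ (by simpa using hi))
        hh s'

end PathSum

/-! ### The law of a trajectory and one-step expectations -/

section Mdp

variable {S A : Type*} {H : ℕ} [Fintype S] [DecidableEq S] [MeasurableSpace S]
  [DiscreteMeasurableSpace S] [Finite A] [MeasurableSpace A] [DiscreteMeasurableSpace A]

instance (M : MDP S A H) (h : Fin H) (s : S) (a : A) : IsProbabilityMeasure (M.R h s a) :=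
  M.isProbabilityMeasure_R h s a

theorem pmf_sum_eq_one {S : Type*} [Fintype S] (p : PMF S) : ∑ s, p s = 1 := by
  rw [← tsum_fintype (L := SummationFilter.unconditional S), p.tsum_coe]

/-- The expectation of a nonnegative function of the reward and the next state. -/
noncomputable def MDP.stepLIntegral (M : MDP S A H) (h : Fin H) (s : S) (a : A)
    (g : ℝ → S → ENNReal) : ENNReal :=
  ∑ s', M.P h s a s' * ∫⁻ r, g r s' ∂(M.R h s a)

theorem measurable_stepFun (h : Fin H) (g : S → A → ℝ → S → ENNReal)
    (hg : ∀ s a s', Measurable fun r => g s a r s') :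
    Measurable fun τ : Traj S A H => g (τ.1 h.castSucc) (τ.2.1 h) (τ.2.2 h) (τ.1 h.succ) := by
  have : Measurable fun p : (S × A × S) × ℝ => g p.1.1 p.1.2.1 p.2 p.1.2.2 :=
    measurable_from_prod_countable_right fun q => hg q.1 q.2.1 q.2.2
  exact this.comp (f := fun τ : Traj S A H =>
    ((τ.1 h.castSucc, τ.2.1 h, τ.1 h.succ), τ.2.2 h)) (by fun_prop)

theorem lintegral_trajLaw (M : MDP S A H) (π : Policy S A H) (f : Traj S A H → ENNReal)
    (hf : Measurable f) :
    ∫⁻ τ, f τ ∂(trajLaw M π) = ∑ σ : Fin (H + 1) → S,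
      (if σ 0 = M.s₁ then
        ∏ h : Fin H, M.P h (σ h.castSucc) (π h (σ h.castSucc)) (σ h.succ) else 0) *
      ∫⁻ r, f (σ, fun h => π h (σ h.castSucc), r)
        ∂(Measure.pi fun h : Fin H => M.R h (σ h.castSucc) (π h (σ h.castSucc))) := by
  rw [trajLaw, lintegral_finsetSum_measure]
  refine Finset.sum_congr rfl fun σ _ => ?_
  rw [lintegral_smul_measure, smul_eq_mul, Measure.dirac_prod, lintegral_map hf (by fun_prop),
    Measure.dirac_prod, lintegral_map (by fun_prop) (by fun_prop)]

/-- The rewards of the other steps integrate to one, so the integral is again a path sum, with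
weights changed at step `h` only. -/
theorem lintegral_trajLaw_step (M : MDP S A H) (π : Policy S A H) (h : Fin H)
    (g : S → A → ℝ → S → ENNReal) (hg : ∀ s a s', Measurable fun r => g s a r s') :
    ∫⁻ τ, g (τ.1 h.castSucc) (τ.2.1 h) (τ.2.2 h) (τ.1 h.succ) ∂(trajLaw M π) =
      pathSum (fun i s s' => M.P i s (π i s) s' *
        if i = h then ∫⁻ r, g s (π h s) r s' ∂(M.R h s (π h s)) else 1) M.s₁ := by
  rw [lintegral_trajLaw M π _ (measurable_stepFun h g hg), ← sum_paths_eq_pathSum]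
  refine Finset.sum_congr rfl fun σ _ => ?_
  split_ifs with h0
  · rw [Finset.prod_mul_distrib, Finset.prod_ite_eq' Finset.univ h, if_pos (Finset.mem_univ h)]
    congr 1
    exact (measurePreserving_eval (fun h : Fin H => M.R h (σ h.castSucc) (π h (σ h.castSucc)))
      h).lintegral_comp (hg _ _ _)
  · simp

/-- A form of the tower property: it suffices to compare conditional expectations given the state at
step `h`, and only for the action that `π` plays there. -/
theorem lintegral_trajLaw_mono_step (M : MDP S A H) (π : Policy S A H) (h : Fin H)
    (g g' : S → A → ℝ → S → ENNReal) (hg : ∀ s a s', Measurable fun r => g s a r s')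
    (hg' : ∀ s a s', Measurable fun r => g' s a r s')
    (hle : ∀ s, M.stepLIntegral h s (π h s) (g s (π h s))
      ≤ M.stepLIntegral h s (π h s) (g' s (π h s))) :
    ∫⁻ τ, g (τ.1 h.castSucc) (τ.2.1 h) (τ.2.2 h) (τ.1 h.succ) ∂(trajLaw M π) ≤
      ∫⁻ τ, g' (τ.1 h.castSucc) (τ.2.1 h) (τ.2.2 h) (τ.1 h.succ) ∂(trajLaw M π) := by
  rw [lintegral_trajLaw_step M π h g hg, lintegral_trajLaw_step M π h g' hg']
  refine pathSum_mono_step h _ _ (fun i hi => ?_) (fun i hi s => ?_) (fun s => ?_) _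
  · simp [hi]
  · simpa [hi] using pmf_sum_eq_one _
  · simpa [MDP.stepLIntegral] using hle s

theorem lintegral_trajLaw_congr_step (M : MDP S A H) (π : Policy S A H) (h : Fin H)
    (g g' : S → A → ℝ → S → ENNReal) (hg : ∀ s a s', Measurable fun r => g s a r s')
    (hg' : ∀ s a s', Measurable fun r => g' s a r s')
    (heq : ∀ s, M.stepLIntegral h s (π h s) (g s (π h s))
      = M.stepLIntegral h s (π h s) (g' s (π h s))) :
    ∫⁻ τ, g (τ.1 h.castSucc) (τ.2.1 h) (τ.2.2 h) (τ.1 h.succ) ∂(trajLaw M π) =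
      ∫⁻ τ, g' (τ.1 h.castSucc) (τ.2.1 h) (τ.2.2 h) (τ.1 h.succ) ∂(trajLaw M π) :=
  le_antisymm (lintegral_trajLaw_mono_step M π h g g' hg hg' fun s => (heq s).le)
    (lintegral_trajLaw_mono_step M π h g' g hg' hg fun s => (heq s).ge)

instance (M : MDP S A H) (π : Policy S A H) : IsProbabilityMeasure (trajLaw M π) where
  measure_univ := by
    have := lintegral_trajLaw M π (fun _ => 1) measurable_const
    simp only [lintegral_const, one_mul, measure_univ, mul_one] at this
    rw [this, sum_paths_eq_pathSum (fun h s s' => M.P h s (π h s) s')]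
    exact pathSum_eq_one _ (fun i s => pmf_sum_eq_one _) _

@[simp]
theorem stepLIntegral_const (M : MDP S A H) (h : Fin H) (s : S) (a : A) (c : ENNReal) :
    M.stepLIntegral h s a (fun _ _ => c) = c := by
  simp [MDP.stepLIntegral, ← Finset.sum_mul, pmf_sum_eq_one]

theorem stepLIntegral_eq_lintegral_prod (M : MDP S A H) (h : Fin H) (s : S) (a : A)
    (g : ℝ → S → ENNReal) (hg : ∀ s', Measurable fun r => g r s') :
    M.stepLIntegral h s a g =
      ∫⁻ p, g p.2 p.1 ∂((M.P h s a).toMeasure.prod (M.R h s a)) := by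
  have hm : Measurable fun p : S × ℝ => g p.2 p.1 := measurable_from_prod_countable_right hg
  rw [lintegral_prod _ hm.aemeasurable, lintegral_fintype, MDP.stepLIntegral]
  refine Finset.sum_congr rfl fun s' _ => ?_
  rw [PMF.toMeasure_apply_singleton _ _ (measurableSet_singleton _), mul_comm]

/-- The expected reward plus the expected value of the next state. -/
noncomputable def MDP.qMean (M : MDP S A H) (h : Fin H) (s : S) (a : A) (V : S → ℝ) : ℝ :=
  ∫ r, r ∂(M.R h s a) + ∑ s', (M.P h s a s').toReal * V s'

theorem integral_prod_eq_qMean (M : MDP S A H) (h : Fin H) (s : S) (a : A) (V : S → ℝ) :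
    ∫ p, (p.2 + V p.1) ∂((M.P h s a).toMeasure.prod (M.R h s a)) = M.qMean h s a V := by
  have i1 : Integrable (fun r : ℝ => r) (M.R h s a) :=
    Integrable.of_mem_Icc 0 1 aemeasurable_id (M.reward_mem h s a)
  have i2 : Integrable V (M.P h s a).toMeasure := .of_finite
  rw [integral_add (i1.comp_snd _) (i2.comp_fst _), integral_prod_symm _ (i1.comp_snd _),
    integral_prod _ (i2.comp_fst _), MDP.qMean]
  simp [PMF.integral_eq_sum, measureReal_def]

theorem ae_prod_mem_Icc (M : MDP S A H) (h : Fin H) (s : S) (a : A) (V : S → ℝ) {v : ℝ}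
    (hV : ∀ s, V s ∈ Set.Icc 0 v) :
    ∀ᵐ p ∂((M.P h s a).toMeasure.prod (M.R h s a)), p.2 + V p.1 ∈ Set.Icc 0 (1 + v) := by
  have : ∀ᵐ p ∂((M.P h s a).toMeasure.prod (M.R h s a)), p.2 ∈ Set.Icc (0 : ℝ) 1 :=
    Measure.quasiMeasurePreserving_snd.ae (M.reward_mem h s a)
  filter_upwards [this] with p hp
  have := hV p.1
  simp only [Set.mem_Icc] at *
  constructor <;> linarith

theorem qMean_mem_Icc (M : MDP S A H) (h : Fin H) (s : S) (a : A) (V : S → ℝ) {v : ℝ}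
    (hV : ∀ s, V s ∈ Set.Icc 0 v) : M.qMean h s a V ∈ Set.Icc 0 (1 + v) := by
  have hae := ae_prod_mem_Icc M h s a V hV
  have hi : Integrable (fun p : S × ℝ => p.2 + V p.1)
      ((M.P h s a).toMeasure.prod (M.R h s a)) :=
    Integrable.of_mem_Icc 0 (1 + v) (by
      have : Measurable V := measurable_of_finite V
      fun_prop) hae
  rw [← integral_prod_eq_qMean]
  constructor
  · exact integral_nonneg_of_ae (hae.mono fun p hp => hp.1)
  · have := integral_mono_ae hi (integrable_const (1 + v)) (hae.mono fun p hp => hp.2)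
    simpa using this

/-- Hoeffding's lemma: `r + V s'` lies in an interval of length `1 + v`, hence is sub-Gaussian with
variance proxy `(1 + v)² / 4`. -/
theorem stepLIntegral_exp_le_one (M : MDP S A H) (h : Fin H) (s : S) (a : A) (V : S → ℝ) {v : ℝ}
    (hV : ∀ s, V s ∈ Set.Icc 0 v) (t : ℝ) :
    M.stepLIntegral h s a (fun r s' =>
      ENNReal.ofReal (Real.exp (t * (r + V s' - M.qMean h s a V) - t ^ 2 * (1 + v) ^ 2 / 8))) ≤ 1 := by
  have hVm : Measurable V := measurable_of_finite V
  have hv : 0 ≤ v := (hV s).1.trans (hV s).2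
  rw [stepLIntegral_eq_lintegral_prod _ _ _ _ _ (by fun_prop)]
  have key := hasSubgaussianMGF_of_mem_Icc
    (μ := (M.P h s a).toMeasure.prod (M.R h s a)) (X := fun p => p.2 + V p.1)
    (by fun_prop) (ae_prod_mem_Icc M h s a V hV)
  rw [integral_prod_eq_qMean] at key
  have hi := key.integrable_exp_mul t
  have hle := key.mgf_le t
  rw [mgf] at hle
  rw [← ofReal_integral_eq_lintegral_ofReal]
  · rw [ENNReal.ofReal_le_one]
    simp_rw [Real.exp_sub _ (t ^ 2 * (1 + v) ^ 2 / 8)]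
    rw [integral_div, div_le_one (Real.exp_pos _)]
    refine hle.trans (le_of_eq ?_)
    congr 1
    simp only [NNReal.coe_pow, NNReal.coe_div, coe_nnnorm, sub_zero, Real.norm_eq_abs,
      NNReal.coe_ofNat]
    rw [abs_of_nonneg (by linarith)]
    ring
  · simp_rw [Real.exp_sub _ (t ^ 2 * (1 + v) ^ 2 / 8)]
    exact hi.div_const _
  · exact Filter.Eventually.of_forall fun p => (Real.exp_pos _).le

end Mdp

/-! ### Performance difference and exponential moments of a visit -/

section Value

variable {S A : Type*} {H : ℕ} [Fintype S] [DecidableEq S] [MeasurableSpace S]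
  [DiscreteMeasurableSpace S] [Fintype A] [DecidableEq A] [MeasurableSpace A]
  [DiscreteMeasurableSpace A]

/-- The trajectory visits `(s, a)` at step `h`. -/
def Hit (h : Fin H) (s : S) (a : A) (τ : Traj S A H) : Prop :=
  τ.1 h.castSucc = s ∧ τ.2.1 h = a

instance (h : Fin H) (s : S) (a : A) : DecidablePred (Hit (H := H) h s a) := fun τ =>
  inferInstanceAs (Decidable (τ.1 h.castSucc = s ∧ τ.2.1 h = a))

theorem measurableSet_hit (h : Fin H) (s : S) (a : A) :
    MeasurableSet {τ : Traj S A H | Hit h s a τ} := by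
  have h1 : Measurable fun τ : Traj S A H => τ.1 h.castSucc := by fun_prop
  have h2 : Measurable fun τ : Traj S A H => τ.2.1 h := by fun_prop
  exact (h1 (measurableSet_singleton s)).inter (h2 (measurableSet_singleton a))

/-- The probability that a trajectory under `π` visits `(s, a)` at step `h`. -/
noncomputable def occupancy (M : MDP S A H) (π : Policy S A H) (h : Fin H) (s : S) (a : A) : ℝ :=
  (trajLaw M π).real {τ | Hit h s a τ}

theorem occupancy_nonneg (M : MDP S A H) (π : Policy S A H) (h : Fin H) (s : S) (a : A) :
    0 ≤ occupancy M π h s a := measureReal_nonneg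

theorem occupancy_le_one (M : MDP S A H) (π : Policy S A H) (h : Fin H) (s : S) (a : A) :
    occupancy M π h s a ≤ 1 := measureReal_le_one

theorem ae_initial_state (M : MDP S A H) (π : Policy S A H) :
    ∀ᵐ τ ∂(trajLaw M π), τ.1 0 = M.s₁ := by
  have hm : MeasurableSet {τ : Traj S A H | ¬ τ.1 0 = M.s₁} := by
    have h1 : Measurable fun τ : Traj S A H => τ.1 0 := by fun_prop
    exact (h1 (measurableSet_singleton M.s₁)).compl
  rw [ae_iff, ← lintegral_indicator_one hm, lintegral_trajLaw M π _ (measurable_one.indicator hm)]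
  refine Finset.sum_eq_zero fun σ _ => ?_
  split_ifs with h0 <;> simp [Set.indicator, h0]

theorem ae_action_eq (M : MDP S A H) (π : Policy S A H) (h : Fin H) :
    ∀ᵐ τ ∂(trajLaw M π), τ.2.1 h = π h (τ.1 h.castSucc) := by
  have hm : MeasurableSet {τ : Traj S A H | ¬ τ.2.1 h = π h (τ.1 h.castSucc)} := by
    have h1 : Measurable fun τ : Traj S A H => (τ.1 h.castSucc, τ.2.1 h) := by fun_prop
    exact h1 (MeasurableSet.of_discrete (s := {p : S × A | ¬ p.2 = π h p.1}))
  rw [ae_iff, ← lintegral_indicator_one hm, lintegral_trajLaw M π _ (measurable_one.indicator hm)]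
  refine Finset.sum_eq_zero fun σ _ => ?_
  simp [Set.indicator]

theorem ae_reward_mem (M : MDP S A H) (π : Policy S A H) (h : Fin H) :
    ∀ᵐ τ ∂(trajLaw M π), τ.2.2 h ∈ Set.Icc (0 : ℝ) 1 := by
  have hm : MeasurableSet {τ : Traj S A H | ¬ τ.2.2 h ∈ Set.Icc (0 : ℝ) 1} := by
    have h1 : Measurable fun τ : Traj S A H => τ.2.2 h := by fun_prop
    exact (h1 measurableSet_Icc).compl
  rw [ae_iff, ← lintegral_indicator_one hm]
  refine le_antisymm ?_ bot_le
  have hi : Measurable ((Set.Icc (0 : ℝ) 1)ᶜ.indicator (1 : ℝ → ENNReal)) :=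
    measurable_one.indicator measurableSet_Icc.compl
  refine (lintegral_trajLaw_mono_step M π h
    (fun _ _ r _ => (Set.Icc (0 : ℝ) 1)ᶜ.indicator 1 r) (fun _ _ _ _ => 0)
    (fun _ _ _ => hi) (fun _ _ _ => measurable_const) (fun s => ?_)).trans (by simp)
  have h0 : ∫⁻ r, (Set.Icc (0 : ℝ) 1)ᶜ.indicator (1 : ℝ → ENNReal) r ∂(M.R h s (π h s)) = 0 := by
    rw [lintegral_indicator_one measurableSet_Icc.compl]
    exact M.reward_mem h s (π h s)
  simp [MDP.stepLIntegral, h0]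

theorem integrable_comp_state (M : MDP S A H) (π : Policy S A H) (i : Fin (H + 1)) (V : S → ℝ) :
    Integrable (fun τ => V (τ.1 i)) (trajLaw M π) := by
  have hV : Measurable V := measurable_of_finite V
  have hm : Measurable fun τ : Traj S A H => τ.1 i := by fun_prop
  exact (Integrable.of_finite (μ := (trajLaw M π).map fun τ => τ.1 i) (f := V)).comp_measurable hm

theorem integrable_reward (M : MDP S A H) (π : Policy S A H) (h : Fin H) :
    Integrable (fun τ => τ.2.2 h) (trajLaw M π) :=
  Integrable.of_mem_Icc 0 1 (by fun_prop) (ae_reward_mem M π h)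

theorem integral_reward_add_value (M : MDP S A H) (π : Policy S A H) (h : Fin H) (V : S → ℝ)
    {v : ℝ} (hV : ∀ s, V s ∈ Set.Icc 0 v) :
    ∫ τ, (τ.2.2 h + V (τ.1 h.succ)) ∂(trajLaw M π) =
      ∫ τ, M.qMean h (τ.1 h.castSucc) (π h (τ.1 h.castSucc)) V ∂(trajLaw M π) := by
  have hVm : Measurable V := measurable_of_finite V
  rw [integral_eq_lintegral_of_nonneg_ae, integral_eq_lintegral_of_nonneg_ae]
  · congr 1
    refine lintegral_trajLaw_congr_step M π h (fun _ _ r s' => ENNReal.ofReal (r + V s'))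
      (fun s _ _ _ => ENNReal.ofReal (M.qMean h s (π h s) V)) (by fun_prop) (by fun_prop)
      fun s => ?_
    rw [stepLIntegral_eq_lintegral_prod _ _ _ _ _ (by fun_prop), stepLIntegral_const,
      ← integral_prod_eq_qMean, ofReal_integral_eq_lintegral_ofReal]
    · exact Integrable.of_mem_Icc 0 (1 + v) (by fun_prop) (ae_prod_mem_Icc M h s (π h s) V hV)
    · exact (ae_prod_mem_Icc M h s (π h s) V hV).mono fun p hp => hp.1
  · exact Filter.Eventually.of_forall fun τ => (qMean_mem_Icc M h _ _ V hV).1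
  · exact (integrable_comp_state M π h.castSucc
      fun s => M.qMean h s (π h s) V).aestronglyMeasurable
  · filter_upwards [ae_reward_mem M π h] with τ hτ
    exact add_nonneg hτ.1 (hV _).1
  · exact ((integrable_reward M π h).add (integrable_comp_state M π h.succ V)).aestronglyMeasurable

theorem sum_castSucc_sub_succ {n : ℕ} (f : Fin (n + 1) → ℝ) :
    ∑ i : Fin n, (f i.castSucc - f i.succ) = f 0 - f (Fin.last n) := by
  induction n with
  | zero => simp
  | succ n ih =>
    rw [Fin.sum_univ_castSucc]
    have := ih fun i => f i.castSucc
    simp only [Fin.succ_castSucc] at *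
    rw [this]
    simp

/-- Telescope `V` along the trajectory; `integral_reward_add_value` replaces the reward plus next
value by its conditional mean. Since `V` is arbitrary, the identity serves both for optimism and for
the regret of the greedy policy. -/
theorem performance_difference (M : MDP S A H) (π : Policy S A H) (V : Fin (H + 1) → S → ℝ)
    {v : ℝ} (hV : ∀ i s, V i s ∈ Set.Icc 0 v) (hlast : ∀ s, V (Fin.last H) s = 0) :
    V 0 M.s₁ - value M π = ∑ h : Fin H, ∫ τ, (V h.castSucc (τ.1 h.castSucc)
      - M.qMean h (τ.1 h.castSucc) (π h (τ.1 h.castSucc)) (V h.succ)) ∂(trajLaw M π) := by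
  have h0 : V 0 M.s₁ = ∫ τ, V 0 (τ.1 0) ∂(trajLaw M π) := by
    rw [integral_congr_ae (g := fun _ => V 0 M.s₁)]
    · simp
    · filter_upwards [ae_initial_state M π] with τ hτ
      rw [hτ]
  have h1 : ∫ τ, V 0 (τ.1 0) ∂(trajLaw M π) = ∑ h : Fin H,
      ((∫ τ, V h.castSucc (τ.1 h.castSucc) ∂(trajLaw M π))
        - ∫ τ, V h.succ (τ.1 h.succ) ∂(trajLaw M π)) := by
    rw [sum_castSucc_sub_succ fun i => ∫ τ, V i (τ.1 i) ∂(trajLaw M π)]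
    simp [hlast]
  rw [h0, h1, value, integral_finsetSum _ fun h _ => integrable_reward M π h,
    ← Finset.sum_sub_distrib]
  refine Finset.sum_congr rfl fun h _ => ?_
  rw [integral_sub (integrable_comp_state M π _ _)
      (integrable_comp_state M π _ fun s => M.qMean h s (π h s) (V h.succ)),
    ← integral_reward_add_value M π h (V h.succ) (hV _),
    integral_add (integrable_reward M π h) (integrable_comp_state M π _ _)]
  ring

theorem value_le_of_optimistic (M : MDP S A H) (π : Policy S A H) (V : Fin (H + 1) → S → ℝ)
    {v : ℝ} (hV : ∀ i s, V i s ∈ Set.Icc 0 v) (hlast : ∀ s, V (Fin.last H) s = 0)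
    (hopt : ∀ h s a, M.qMean h s a (V h.succ) ≤ V h.castSucc s) : value M π ≤ V 0 M.s₁ := by
  rw [← sub_nonneg, performance_difference M π V hV hlast]
  exact Finset.sum_nonneg fun h _ => integral_nonneg fun τ => sub_nonneg.2 (hopt _ _ _)

theorem integral_eq_sum_occupancy (M : MDP S A H) (π : Policy S A H) (h : Fin H) (β : S → A → ℝ) :
    ∫ τ, β (τ.1 h.castSucc) (π h (τ.1 h.castSucc)) ∂(trajLaw M π) =
      ∑ s, ∑ a, occupancy M π h s a * β s a := by
  rw [integral_congr_ae (g := fun τ => ∑ s, ∑ a,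
    {τ : Traj S A H | Hit h s a τ}.indicator (fun _ => β s a) τ)]
  · rw [integral_finsetSum _ fun s _ => integrable_finsetSum _ fun a _ =>
      (integrable_const _).indicator (measurableSet_hit h s a)]
    refine Finset.sum_congr rfl fun s _ => ?_
    rw [integral_finsetSum _ fun a _ => (integrable_const _).indicator (measurableSet_hit h s a)]
    refine Finset.sum_congr rfl fun a _ => ?_
    rw [integral_indicator_const _ (measurableSet_hit h s a), smul_eq_mul, occupancy]
  · filter_upwards [ae_action_eq M π h] with τ hτ
    rw [← hτ]
    have e : ∀ s a, {τ : Traj S A H | Hit h s a τ}.indicator (fun _ => β s a) τ =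
        if τ.1 h.castSucc = s then if τ.2.1 h = a then β s a else 0 else 0 := by
      intro s a
      by_cases h1 : τ.1 h.castSucc = s <;> by_cases h2 : τ.2.1 h = a <;> simp [Hit, h1, h2]
    simp [e]

theorem sub_value_le_sum_occupancy (M : MDP S A H) (π : Policy S A H) (V : Fin (H + 1) → S → ℝ)
    {v : ℝ} (hV : ∀ i s, V i s ∈ Set.Icc 0 v) (hlast : ∀ s, V (Fin.last H) s = 0)
    (β : Fin H → S → A → ℝ)
    (hβ : ∀ h s, V h.castSucc s - M.qMean h s (π h s) (V h.succ) ≤ β h s (π h s)) :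
    V 0 M.s₁ - value M π ≤ ∑ h, ∑ s, ∑ a, occupancy M π h s a * β h s a := by
  rw [performance_difference M π V hV hlast]
  refine Finset.sum_le_sum fun h _ => ?_
  rw [← integral_eq_sum_occupancy]
  refine integral_mono ?_ ?_ fun τ => hβ h _
  · exact (integrable_comp_state M π _ _).sub
      (integrable_comp_state M π _ fun s => M.qMean h s (π h s) (V h.succ))
  · exact integrable_comp_state M π _ fun s => β h s (π h s)

theorem sum_occupancy_eq_one (M : MDP S A H) (π : Policy S A H) (h : Fin H) :
    ∑ s, ∑ a, occupancy M π h s a = 1 := by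
  have := integral_eq_sum_occupancy M π h fun _ _ => 1
  simpa using this.symm

/-- Without a visit the exponent is zero, so no conditioning on the visit is needed, and factors of
different episodes can be multiplied although the visits are random. -/
theorem lintegral_trajLaw_exp_noise_le_one (M : MDP S A H) (π : Policy S A H) (h : Fin H) (s : S)
    (a : A) (V : S → ℝ) {v : ℝ} (hV : ∀ s, V s ∈ Set.Icc 0 v) (t : ℝ) :
    ∫⁻ τ, ENNReal.ofReal (Real.exp (if Hit h s a τ then
      t * (τ.2.2 h + V (τ.1 h.succ) - M.qMean h s a V) - t ^ 2 * (1 + v) ^ 2 / 8 else 0))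
      ∂(trajLaw M π) ≤ 1 := by
  have hVm : Measurable V := measurable_of_finite V
  refine (lintegral_trajLaw_mono_step M π h
    (fun s₀ a₀ r s' => ENNReal.ofReal (Real.exp (if s₀ = s ∧ a₀ = a then
      t * (r + V s' - M.qMean h s a V) - t ^ 2 * (1 + v) ^ 2 / 8 else 0)))
    (fun _ _ _ _ => 1) (fun s₀ a₀ s' => ?_) (by fun_prop) (fun s₀ => ?_)).trans (by simp)
  · split_ifs <;> fun_prop
  · rw [stepLIntegral_const]
    split_ifs with hs
    · obtain ⟨rfl, rfl⟩ := hs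
      exact stepLIntegral_exp_le_one M h s₀ _ V hV t
    · simp

/-- The Bernoulli moment generating function: `1 + (exp t - 1) p ≤ exp ((exp t - 1) p)`. -/
theorem lintegral_trajLaw_exp_hit_le_one (M : MDP S A H) (π : Policy S A H) (h : Fin H) (s : S)
    (a : A) (t : ℝ) :
    ∫⁻ τ, ENNReal.ofReal (Real.exp ((if Hit h s a τ then t else 0)
      - (Real.exp t - 1) * occupancy M π h s a)) ∂(trajLaw M π) ≤ 1 := by
  set p := occupancy M π h s a with hp
  have e : ∀ τ : Traj S A H, Real.exp ((if Hit h s a τ then t else 0) - (Real.exp t - 1) * p) =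
      Real.exp (-((Real.exp t - 1) * p)) *
        (1 + {τ : Traj S A H | Hit h s a τ}.indicator (fun _ => Real.exp t - 1) τ) := by
    intro τ
    rw [sub_eq_add_neg, Real.exp_add, mul_comm]
    congr 1
    by_cases hh : Hit h s a τ <;> simp [hh]
  simp_rw [e]
  have hi : Integrable (fun τ => 1 + {τ : Traj S A H | Hit h s a τ}.indicator
      (fun _ => Real.exp t - 1) τ) (trajLaw M π) :=
    (integrable_const _).add ((integrable_const _).indicator (measurableSet_hit h s a))
  rw [← ofReal_integral_eq_lintegral_ofReal (hi.const_mul _)]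
  · rw [integral_const_mul, integral_add (integrable_const _)
      ((integrable_const _).indicator (measurableSet_hit h s a)),
      integral_indicator_const _ (measurableSet_hit h s a)]
    rw [ENNReal.ofReal_le_one, Real.exp_neg, inv_mul_le_one₀ (Real.exp_pos _)]
    have := Real.add_one_le_exp ((Real.exp t - 1) * p)
    simp only [integral_const, probReal_univ, smul_eq_mul, mul_one]
    change 1 + p * _ ≤ _
    linarith
  · refine Filter.Eventually.of_forall fun τ => ?_
    exact (Real.exp_pos _).le.trans_eq (e τ)

end Value

/-! ### Measurability of the estimator and of the policy -/

section Discrete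

/-- The random set has finitely many values, so `g` may be any function; this handles the arbitrary
tie-breaking rules. -/
theorem measurable_comp_filter {Ω ι β : Type*} [MeasurableSpace Ω] [Fintype ι] [MeasurableSpace β]
    (P : Ω → ι → Prop) [∀ ω, DecidablePred (P ω)] (hP : ∀ i, MeasurableSet {ω | P ω i})
    (g : Finset ι → β) : Measurable fun ω => g (Finset.univ.filter (P ω)) := by
  let _ : MeasurableSpace (Finset ι) := ⊤
  refine (measurable_from_top : Measurable g).comp
    (g := g) (f := fun ω => Finset.univ.filter (P ω)) (measurable_to_countable' fun F => ?_)
  have : (fun ω => Finset.univ.filter (P ω)) ⁻¹' {F} = ⋂ i, {ω | P ω i ↔ i ∈ F} := by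
    ext ω
    simp [Finset.ext_iff]
  rw [this]
  refine MeasurableSet.iInter fun i => ?_
  by_cases hi : i ∈ F
  · simp only [hi, iff_true]
    exact hP i
  · simp only [hi, iff_false]
    exact (hP i).compl

theorem measurable_eval_discrete {Ω S β : Type*} [MeasurableSpace Ω] [MeasurableSpace S]
    [Countable S] [MeasurableSingletonClass S] [MeasurableSpace β] (V : Ω → S → β)
    (hV : ∀ s, Measurable fun ω => V ω s) (f : Ω → S) (hf : Measurable f) :
    Measurable fun ω => V ω (f ω) :=
  (measurable_from_prod_countable_right (f := fun p : S × Ω => V p.2 p.1) hV).comp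
    (hf.prodMk measurable_id)

end Discrete

section Pwc

variable {m : ℕ}

/-- Helly's theorem on the line: the largest left endpoint is a common point. The clique condition
becomes finitely many inequalities between the data, which makes the chosen clique measurable. -/
theorem nonempty_iInter_confInterval_iff (σ α ε δ : ℝ) (x : Fin m → ℝ) (n : Fin m → ℕ)
    (U : Finset (Fin m)) :
    (⋂ j ∈ U, confInterval σ α ε δ x n j).Nonempty ↔
      ∀ i ∈ U, ∀ j ∈ U, nTilde α n i ≠ 0 → nTilde α n j ≠ 0 →
        x i - σ / √(nTilde α n i) * √(2 * Real.log (2 * m / δ)) - ε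
          ≤ x j + σ / √(nTilde α n j) * √(2 * Real.log (2 * m / δ)) + ε := by
  constructor
  · rintro ⟨z, hz⟩ i hi j hj hi0 hj0
    have h1 := Set.mem_iInter₂.1 hz i hi
    have h2 := Set.mem_iInter₂.1 hz j hj
    rw [confInterval, if_neg hi0] at h1
    rw [confInterval, if_neg hj0] at h2
    exact h1.1.trans h2.2
  · intro hU
    by_cases hne : (U.filter fun j => nTilde α n j ≠ 0).Nonempty
    · refine ⟨(U.filter fun j => nTilde α n j ≠ 0).sup' hne fun i =>
        x i - σ / √(nTilde α n i) * √(2 * Real.log (2 * m / δ)) - ε, Set.mem_iInter₂.2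
        fun j hj => ?_⟩
      by_cases hj0 : nTilde α n j = 0
      · simp [confInterval, hj0]
      · rw [confInterval, if_neg hj0]
        refine ⟨Finset.le_sup' (f := fun i => x i - σ / √(nTilde α n i) *
          √(2 * Real.log (2 * m / δ)) - ε) (Finset.mem_filter.2 ⟨hj, hj0⟩),
          Finset.sup'_le _ _ fun i hi => ?_⟩
        rw [Finset.mem_filter] at hi
        exact hU i hi.1 j hj hi.2 hj0
    · refine ⟨0, Set.mem_iInter₂.2 fun j hj => ?_⟩
      have : nTilde α n j = 0 := by
        by_contra h0
        exact hne ⟨j, Finset.mem_filter.2 ⟨hj, h0⟩⟩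
      simp [confInterval, this]

theorem measurable_pwc {Ω A : Type*} [MeasurableSpace Ω] (tie : TieBreak A m)
    (x : Ω → Fin m → ℝ) (n : Ω → Fin m → ℕ) (hx : ∀ j, Measurable fun ω => x ω j)
    (hn : ∀ j, Measurable fun ω => n ω j) (σ α ε δ : ℝ) :
    Measurable fun ω => pwc tie (x ω) (n ω) σ α ε δ := by
  classical
  have hn' : Measurable n := measurable_pi_iff.2 hn
  have hcut : Measurable fun ω => nCut α (n ω) :=
    (Measurable.of_discrete (f := fun n : Fin m → ℕ => nCut α n)).comp hn'
  have htil : ∀ j, Measurable fun ω => nTilde α (n ω) j := fun j =>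
    (Measurable.of_discrete (f := fun n : Fin m → ℕ => nTilde α n j)).comp hn'
  have htil' : ∀ j, Measurable fun ω => (nTilde α (n ω) j : ℝ) := fun j =>
    measurable_from_top.comp (htil j)
  have hcut' : Measurable fun ω => (nCut α (n ω) : ℝ) := measurable_from_top.comp hcut
  have hU : ∀ j, MeasurableSet {ω | j ∈ tie.clique (maxCliques σ α ε δ (x ω) (n ω))} := by
    intro j
    have hm := measurable_comp_filter (β := Prop)
      (fun ω U => (⋂ j ∈ U, confInterval σ α ε δ (x ω) (n ω) j).Nonempty) (fun U => ?_)
      fun F => j ∈ tie.clique (F.filter fun U => ∀ U' ∈ F, U'.card ≤ U.card)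
    · exact measurableSet_setOfPred.2 hm
    · simp_rw [nonempty_iInter_confInterval_iff]
      simp only [Set.ofPred_forall]
      refine MeasurableSet.iInter fun i => MeasurableSet.iInter fun _ =>
        MeasurableSet.iInter fun j => MeasurableSet.iInter fun _ => ?_
      have h1 : ∀ i, MeasurableSet {ω | nTilde α (n ω) i = 0} := fun i =>
        htil i (measurableSet_singleton 0)
      simp only [imp_iff_not_or, not_not, ne_eq]
      refine (h1 i).union ((h1 j).union ?_)
      change MeasurableSet {ω | (_ : ℝ) ≤ _}
      refine measurableSet_le ?_ ?_
      · have := hx i; have := htil' i; fun_prop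
      · have := hx j; have := htil' j; fun_prop
  have hsum : ∀ f : Ω → Fin m → ℝ, (∀ j, Measurable fun ω => f ω j) →
      Measurable fun ω => ∑ j ∈ tie.clique (maxCliques σ α ε δ (x ω) (n ω)), f ω j := by
    intro f hf
    have e : ∀ ω, ∑ j ∈ tie.clique (maxCliques σ α ε δ (x ω) (n ω)), f ω j =
        ∑ j, if j ∈ tie.clique (maxCliques σ α ε δ (x ω) (n ω)) then f ω j else 0 := by
      intro ω; simp
    simp_rw [e]
    exact Finset.measurable_sum _ fun j _ => Measurable.ite (hU j) (hf j) measurable_const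
  unfold pwc
  refine Measurable.ite (hcut (measurableSet_Ioi (a := 0))) ?_ measurable_const
  refine Measurable.prodMk ?_ ?_
  · exact (hsum _ fun j => (htil' j).mul (hx j)).div (hsum _ htil')
  · have : Measurable fun ω => ∑ j, (nTilde α (n ω) j : ℝ) :=
      Finset.measurable_sum _ fun j _ => htil' j
    fun_prop

end Pwc

section Basic

variable {S A : Type*} {H m : ℕ} [Fintype S] [DecidableEq S] [Fintype A] [DecidableEq A]

theorem count_eq_sum (X : Transcript S A H m) (k : ℕ) (j : Fin m) (h : Fin H) (s : S) (a : A) :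
    count X k j h s a = ∑ t ∈ Finset.range k, if Hit h s a (X.traj t j) then 1 else 0 :=
  Finset.card_filter _ _

theorem batchMean_eq_sum (X : Transcript S A H m) (k : ℕ) (j : Fin m) (h : Fin H) (s : S) (a : A)
    (V : S → ℝ) :
    batchMean X k j h s a V = (∑ t ∈ Finset.range k, if Hit h s a (X.traj t j) then
      (X.traj t j).2.2 h + V ((X.traj t j).1 h.succ) else 0) / count X k j h s a := by
  rw [batchMean, visits, Finset.sum_filter]
  rfl

theorem vHat_last (tie : TieBreak A m) (B : Finset (Fin m)) (K : ℕ) (δ α : ℝ)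
    (X : Transcript S A H m) (k : ℕ) (s : S) : vHat tie B K δ α X k (Fin.last H) s = 0 := by
  simp [vHat]

theorem vHat_castSucc (tie : TieBreak A m) (B : Finset (Fin m)) (K : ℕ) (δ α : ℝ)
    (X : Transcript S A H m) (k : ℕ) (h : Fin H) (s : S) :
    vHat tie B K δ α X k h.castSucc s =
      ⨆ a, qHat tie B K δ α X k h (vHat tie B K δ α X k h.succ) s a := by
  simp [vHat]

end Basic

section Policy

variable {S A : Type*} {H m : ℕ} [Fintype S] [DecidableEq S] [MeasurableSpace S]
  [DiscreteMeasurableSpace S] [Fintype A] [DecidableEq A] [MeasurableSpace A]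
  [DiscreteMeasurableSpace A]

/-- All that the server can use at the start of episode `k` is measurable. -/
structure MeasurableUpTo {Ω : Type*} [MeasurableSpace Ω] (B : Finset (Fin m))
    (X : Ω → Transcript S A H m) (k : ℕ) : Prop where
  byzSync : ∀ t ≤ k, ∀ j ∈ B, Measurable fun ω => (X ω).byzSync t j
  byzMean : ∀ t ≤ k, ∀ h s a, ∀ j ∈ B, Measurable fun ω => (X ω).byzMean t h s a j
  byzCount : ∀ t ≤ k, ∀ h s a, ∀ j ∈ B, Measurable fun ω => (X ω).byzCount t h s a j
  traj : ∀ t < k, ∀ j ∉ B, Measurable fun ω => (X ω).traj t j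

variable {Ω : Type*} [MeasurableSpace Ω] {B : Finset (Fin m)} {X : Ω → Transcript S A H m} {k : ℕ}

theorem MeasurableUpTo.mono (hX : MeasurableUpTo B X k) {t : ℕ} (ht : t ≤ k) :
    MeasurableUpTo B X t where
  byzSync i hi := hX.byzSync i (hi.trans ht)
  byzMean i hi := hX.byzMean i (hi.trans ht)
  byzCount i hi := hX.byzCount i (hi.trans ht)
  traj i hi := hX.traj i (hi.trans_le ht)

theorem MeasurableUpTo.hit (hX : MeasurableUpTo B X k) {t : ℕ} (ht : t < k) {j : Fin m}
    (hj : j ∉ B) (h : Fin H) (s : S) (a : A) :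
    MeasurableSet {ω | Hit h s a ((X ω).traj t j)} :=
  hX.traj t ht j hj (measurableSet_hit h s a)

theorem MeasurableUpTo.count (hX : MeasurableUpTo B X k) {j : Fin m}
    (hj : j ∉ B) (h : Fin H) (s : S) (a : A) : Measurable fun ω => count (X ω) k j h s a := by
  simp_rw [count_eq_sum]
  exact Finset.measurable_sum _ fun t ht => Measurable.ite
    (hX.hit (Finset.mem_range.1 ht) hj h s a) measurable_const measurable_const

theorem MeasurableUpTo.batchMean (hX : MeasurableUpTo B X k) {j : Fin m}
    (hj : j ∉ B) (h : Fin H) (s : S) (a : A) (V : Ω → S → ℝ) (hV : ∀ s, Measurable fun ω => V ω s) :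
    Measurable fun ω => batchMean (X ω) k j h s a (V ω) := by
  simp_rw [batchMean_eq_sum]
  refine Measurable.div ?_ (measurable_from_top.comp (hX.count hj h s a))
  refine Finset.measurable_sum _ fun t ht => ?_
  rw [Finset.mem_range] at ht
  have h1 := hX.traj t ht j hj
  refine Measurable.ite (hX.hit ht hj h s a) (Measurable.add ?_ ?_) measurable_const
  · fun_prop
  · exact measurable_eval_discrete V hV _ (by fun_prop)

theorem MeasurableUpTo.qHat (hX : MeasurableUpTo B X k) (tie : TieBreak A m) (K : ℕ) (δ α : ℝ)
    (h : Fin H) (V : Ω → S → ℝ) (hV : ∀ s, Measurable fun ω => V ω s) (s : S) (a : A) :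
    Measurable fun ω => qHat tie B K δ α (X ω) k h (V ω) s a := by
  have hp := measurable_pwc tie (fun ω => sentMean B (X ω) k h (V ω) s a)
    (fun ω => sentCount B (X ω) k h s a) (fun j => ?_) (fun j => ?_) ((H : ℝ) - h) α
    (epsParam S A H m K) (deltaParam S A H m K δ)
  · unfold ByzRL.qHat
    fun_prop
  · by_cases hj : j ∈ B
    · simpa [sentMean, hj] using hX.byzMean k le_rfl h s a j hj
    · simpa [sentMean, hj] using hX.batchMean hj h s a V hV
  · by_cases hj : j ∈ B
    · simpa [sentCount, hj] using hX.byzCount k le_rfl h s a j hj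
    · simpa [sentCount, hj] using hX.count hj h s a

theorem MeasurableUpTo.vHat (hX : MeasurableUpTo B X k) (tie : TieBreak A m) (K : ℕ) (δ α : ℝ)
    (i : Fin (H + 1)) (s : S) : Measurable fun ω => vHat tie B K δ α (X ω) k i s := by
  induction i using Fin.reverseInduction generalizing s with
  | last => simp_rw [vHat_last]; exact measurable_const
  | cast h ih =>
    simp_rw [vHat_castSucc]
    exact Measurable.iSup fun a => hX.qHat tie K δ α h _ ih s a

theorem MeasurableUpTo.greedy (hX : MeasurableUpTo B X k) (tie : TieBreak A m) (K : ℕ) (δ α : ℝ)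
    (h : Fin H) (s : S) : Measurable fun ω => greedy tie B K δ α (X ω) k h s := by
  classical
  have hq : ∀ a, Measurable fun ω =>
      ByzRL.qHat tie B K δ α (X ω) k h (ByzRL.vHat tie B K δ α (X ω) k h.succ) s a :=
    fun a => hX.qHat tie K δ α h _ (hX.vHat tie K δ α h.succ) s a
  have := measurable_comp_filter (fun ω a => ∀ a',
    ByzRL.qHat tie B K δ α (X ω) k h (ByzRL.vHat tie B K δ α (X ω) k h.succ) s a' ≤
      ByzRL.qHat tie B K δ α (X ω) k h (ByzRL.vHat tie B K δ α (X ω) k h.succ) s a)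
    (fun a => by
      simp only [Set.ofPred_forall]
      exact MeasurableSet.iInter fun a' => measurableSet_le (hq a') (hq a)) tie.action
  convert this using 1
  funext ω
  unfold ByzRL.greedy
  congr!

/-- Nothing is assumed about the trajectories of Byzantine agents, hence the restriction on `nOld`;
the recursion for the other variables never reads their `nOld`. -/
theorem measurable_state (tie : TieBreak A m) (K : ℕ) (δ α : ℝ) (hX : MeasurableUpTo B X k) :
    ∀ t ≤ k + 1,
      (∀ j, Measurable fun ω => (stateBefore tie B K δ α (X ω) t).syncCount j) ∧
      (∀ j ∉ B, ∀ h s a, Measurable fun ω => (stateBefore tie B K δ α (X ω) t).nOld j h s a) ∧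
      (∀ h s, Measurable fun ω => (stateBefore tie B K δ α (X ω) t).policy h s) := by
  intro t
  induction t with
  | zero => exact fun _ => ⟨fun j => measurable_const, fun j _ h s a => measurable_const,
      fun h s => measurable_const⟩
  | succ t ih =>
    intro ht
    obtain ⟨h1, h2, h3⟩ := ih (by omega)
    have hXt := hX.mono (show t ≤ k by omega)
    have hacc : ∀ j, MeasurableSet
        {ω | accepted B K (X ω) t (stateBefore tie B K δ α (X ω) t) j} := by
      intro j
      unfold accepted
      refine MeasurableSet.inter (s₁ := {ω | syncFlag B (X ω) t
        (stateBefore tie B K δ α (X ω) t) j}) ?_ ?_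
      · unfold syncFlag
        by_cases ht0 : t = 0
        · simp [ht0]
        by_cases hj : j ∈ B
        · simp only [ht0, hj, if_false, if_true]
          exact hXt.byzSync t le_rfl j hj (measurableSet_singleton true)
        · simp only [ht0, hj, if_false, Set.ofPred_exists]
          refine MeasurableSet.iUnion fun h => MeasurableSet.iUnion fun s =>
            MeasurableSet.iUnion fun a => ?_
          have hc := hXt.count hj h s a
          have ho := h2 j hj h s a
          exact (measurableSet_lt measurable_const hc).inter
            (measurableSet_le (ho.const_mul 2) hc)
      · have hm : Measurable fun ω => (((stateBefore tie B K δ α (X ω) t).syncCount j : ℤ) : ℝ) :=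
          measurable_from_top.comp (h1 j)
        change MeasurableSet {ω | (_ : ℝ) ≤ _}
        exact measurableSet_le hm measurable_const
    have hex : MeasurableSet
        {ω | ∃ j, accepted B K (X ω) t (stateBefore tie B K δ α (X ω) t) j} := by
      simp only [Set.ofPred_exists]
      exact MeasurableSet.iUnion hacc
    simp only [stateBefore, syncPhase]
    refine ⟨fun j => Measurable.ite (hacc j) ((h1 j).add_const 1) (h1 j), fun j hj h s a => ?_,
      fun h s => ?_⟩
    · simp only [ite_apply]
      exact Measurable.ite hex (hXt.count hj h s a) (h2 j hj h s a)
    · simp only [ite_apply]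
      exact Measurable.ite hex (hXt.greedy tie K δ α h s) (h3 h s)

theorem MeasurableUpTo.playedPolicy (hX : MeasurableUpTo B X k) (tie : TieBreak A m) (K : ℕ)
    (δ α : ℝ) : Measurable fun ω => playedPolicy tie B K δ α (X ω) k :=
  measurable_pi_iff.2 fun h => measurable_pi_iff.2 fun s =>
    (measurable_state tie K δ α hX (k + 1) le_rfl).2.2 h s

end Policy

/-! ### Exponential supermartingales along a run -/

theorem setLIntegral_mul_comp_of_law {Ω Y : Type*} {m₀ : MeasurableSpace Ω}
    {mΩ : MeasurableSpace Ω} [MeasurableSpace Y] (hm : m₀ ≤ mΩ) (μ : Measure Ω) (A : Set Ω)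
    (ν : Measure Y) (y : Ω → Y) (hy : Measurable y)
    (hlaw : ∀ E, MeasurableSet[m₀] E → ∀ T, MeasurableSet T →
      μ (E ∩ A ∩ y ⁻¹' T) = μ (E ∩ A) * ν T)
    (F : Ω → ENNReal) (hF : Measurable[m₀] F) (ψ : Y → ENNReal) (hψ : Measurable ψ) :
    ∫⁻ ω in A, F ω * ψ (y ω) ∂μ = (∫⁻ ω in A, F ω ∂μ) * ∫⁻ z, ψ z ∂ν := by
  have h1 : ∀ E, MeasurableSet[m₀] E →
      ∫⁻ ω in E ∩ A, ψ (y ω) ∂μ = μ (E ∩ A) * ∫⁻ z, ψ z ∂ν := by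
    intro E hE
    have : (μ.restrict (E ∩ A)).map y = μ (E ∩ A) • ν := by
      ext T hT
      rw [Measure.map_apply hy hT, Measure.restrict_apply (hy hT), Set.inter_comm, hlaw E hE T hT,
        Measure.smul_apply, smul_eq_mul]
    rw [← lintegral_map hψ hy, this, lintegral_smul_measure, smul_eq_mul]
  -- On `m₀`, the measure with density `ψ ∘ y` is a constant multiple of the original one;
  -- integrating the `m₀`-measurable `F` against both gives the factorization.
  have h2 : ((μ.restrict A).withDensity fun ω => ψ (y ω)).trim hm =
      (∫⁻ z, ψ z ∂ν) • (μ.restrict A).trim hm := by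
    refine @Measure.ext _ m₀ _ _ fun E hE => ?_
    rw [trim_measurableSet_eq hm hE, Measure.smul_apply, trim_measurableSet_eq hm hE,
      withDensity_apply _ (hm _ hE), Measure.restrict_restrict (hm _ hE), h1 E hE,
      Measure.restrict_apply (hm _ hE), smul_eq_mul, mul_comm]
  have h3 := congrArg (fun ρ => @lintegral _ m₀ ρ F) h2
  simp only [lintegral_smul_measure] at h3
  rw [lintegral_trim hm hF, lintegral_trim hm hF,
    lintegral_withDensity_eq_lintegral_mul (f := fun ω => ψ (y ω)) _ (hψ.comp hy) (hF.mono hm le_rfl)] at h3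
  rw [mul_comm, ← smul_eq_mul, ← h3]
  exact lintegral_congr fun ω => mul_comm _ _

theorem lintegral_pi_prod {ι : Type*} [Fintype ι] {E : ι → Type*} [∀ i, MeasurableSpace (E i)]
    (μ : ∀ i, Measure (E i)) [∀ i, IsProbabilityMeasure (μ i)] (f : ∀ i, E i → ENNReal)
    (hf : ∀ i, Measurable (f i)) :
    ∫⁻ x, ∏ i, f i (x i) ∂(Measure.pi μ) = ∏ i, ∫⁻ x, f i x ∂(μ i) := by
  have hind : iIndepFun (fun i x => f i (x i)) (Measure.pi μ) :=
    iIndepFun_pi fun i => (hf i).aemeasurable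
  rw [lintegral_prod_eq_prod_lintegral_of_indepFun Finset.univ _ hind
    fun i => (hf i).comp (measurable_pi_apply i)]
  exact Finset.prod_congr rfl fun i _ => (measurePreserving_eval μ i).lintegral_comp (hf i)

section Run

variable {S A : Type*} {H m : ℕ} [Fintype S] [DecidableEq S] [MeasurableSpace S]
  [DiscreteMeasurableSpace S] [Fintype A] [DecidableEq A] [MeasurableSpace A]
  [DiscreteMeasurableSpace A]
  {Ω : Type*} {mΩ : MeasurableSpace Ω} {μ : Measure Ω} {ℱ : Filtration ℕ mΩ} {M : MDP S A H}
  {tie : TieBreak A m} {B : Finset (Fin m)} {K : ℕ} {δ α : ℝ} {X : Ω → Transcript S A H m}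

theorem IsByzantineRun.measurableUpTo (hX : IsByzantineRun μ ℱ M tie B K δ α X) (k : ℕ) :
    @MeasurableUpTo S A H m _ _ Ω (ℱ k) B X k :=
  @MeasurableUpTo.mk S A H m _ _ Ω (ℱ k) B X k
    (fun t ht j hj => (hX.measurable_byzSync t j hj).mono (ℱ.mono ht) le_rfl)
    (fun t ht h s a j hj => (hX.measurable_byzMean t h s a j hj).mono (ℱ.mono ht) le_rfl)
    (fun t ht h s a j hj => (hX.measurable_byzCount t h s a j hj).mono (ℱ.mono ht) le_rfl)
    (fun t ht j hj => (hX.measurable_traj t j hj).mono (ℱ.mono ht) le_rfl)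

theorem IsByzantineRun.measurable_state (hX : IsByzantineRun μ ℱ M tie B K δ α X) (h : Fin H)
    (s : S) (a : A) (k : ℕ) :
    Measurable[ℱ k] fun ω => (playedPolicy tie B K δ α (X ω) k,
      fun j : {j // j ∉ B} => count (X ω) k j h s a) := by
  refine Measurable.prodMk ?_ ?_
  · exact @MeasurableUpTo.playedPolicy S A H m _ _ _ _ _ _ _ _ Ω (ℱ k) B X k (hX.measurableUpTo k)
      tie K δ α
  · exact @measurable_pi_iff Ω _ _ (ℱ k) _ _ |>.2 fun j =>
      @MeasurableUpTo.count S A H m _ _ _ _ _ _ _ _ Ω (ℱ k) B X k (hX.measurableUpTo k) j j.2 h s a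

theorem IsByzantineRun.measurable_factor (hX : IsByzantineRun μ ℱ M tie B K δ α X) (h : Fin H)
    (s : S) (a : A)
    (φ : Policy S A H → ({j // j ∉ B} → ℕ) → {j // j ∉ B} → Traj S A H → ENNReal)
    (hφ : ∀ π n j, Measurable (φ π n j)) (k : ℕ) :
    Measurable[ℱ (k + 1)] fun ω => ∏ j, φ (playedPolicy tie B K δ α (X ω) k)
      (fun j => count (X ω) k j h s a) j ((X ω).traj k j) := by
  refine Finset.measurable_prod _ fun j _ => ?_
  have h1 : Measurable fun p : (Policy S A H × ({j // j ∉ B} → ℕ)) × Traj S A H =>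
      φ p.1.1 p.1.2 j p.2 := measurable_from_prod_countable_right fun q => hφ q.1 q.2 j
  have h2 := (hX.measurable_state h s a k).mono (ℱ.mono k.le_succ) le_rfl
  exact h1.comp (h2.prodMk (hX.measurable_traj k j j.2))

theorem IsByzantineRun.measurable_process (hX : IsByzantineRun μ ℱ M tie B K δ α X) (h : Fin H)
    (s : S) (a : A)
    (φ : Policy S A H → ({j // j ∉ B} → ℕ) → {j // j ∉ B} → Traj S A H → ENNReal)
    (hφ : ∀ π n j, Measurable (φ π n j)) (k : ℕ) :
    Measurable[ℱ k] fun ω => ∏ t ∈ Finset.range k, ∏ j, φ (playedPolicy tie B K δ α (X ω) t)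
      (fun j => count (X ω) t j h s a) j ((X ω).traj t j) :=
  Finset.measurable_prod _ fun t ht => (hX.measurable_factor h s a φ hφ t).mono
    (ℱ.mono (Finset.mem_range.1 ht)) le_rfl

/-- The expectation does not grow from one episode to the next. The factors may depend on the
current policy and counts, which are known in `ℱ k`; this permits weights depending on the index of
a visit. -/
theorem IsByzantineRun.lintegral_prod_le_one [IsProbabilityMeasure μ]
    (hX : IsByzantineRun μ ℱ M tie B K δ α X) (h : Fin H) (s : S) (a : A)
    (φ : Policy S A H → ({j // j ∉ B} → ℕ) → {j // j ∉ B} → Traj S A H → ENNReal)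
    (hφ : ∀ π n j, Measurable (φ π n j))
    (hle : ∀ π n j, ∫⁻ τ, φ π n j τ ∂(trajLaw M π) ≤ 1) {k : ℕ} (hk : k ≤ K) :
    ∫⁻ ω, ∏ t ∈ Finset.range k, ∏ j, φ (playedPolicy tie B K δ α (X ω) t)
      (fun j => count (X ω) t j h s a) j ((X ω).traj t j) ∂μ ≤ 1 := by
  induction k with
  | zero => simp
  | succ k ih =>
    refine le_trans ?_ (ih (by omega))
    simp_rw [Finset.prod_range_succ]
    set F : Ω → ENNReal := fun ω => ∏ t ∈ Finset.range k, ∏ j,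
      φ (playedPolicy tie B K δ α (X ω) t) (fun j => count (X ω) t j h s a) j ((X ω).traj t j)
      with hF
    have hFm : Measurable[ℱ k] F := hX.measurable_process h s a φ hφ k
    -- `d` has countably many values. On each level set the new factor is a fixed function of the
    -- fresh trajectories, whose law given `ℱ k` is a product measure.
    set d : Ω → Policy S A H × ({j // j ∉ B} → ℕ) := fun ω =>
      (playedPolicy tie B K δ α (X ω) k, fun j => count (X ω) k j h s a) with hd
    have hdm : Measurable[ℱ k] d := hX.measurable_state h s a k
    have hmeas : ∀ q, MeasurableSet[ℱ k] (d ⁻¹' {q}) := fun q => hdm (measurableSet_singleton q)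
    have hdisj : Pairwise (Function.onFun Disjoint fun q => d ⁻¹' {q}) := fun q q' hq =>
      Disjoint.preimage _ (Set.disjoint_singleton.2 hq)
    have hun : (⋃ q, d ⁻¹' {q}) = Set.univ := by
      ext ω; simp
    rw [← setLIntegral_univ, ← setLIntegral_univ F, ← hun,
      lintegral_iUnion (fun q => ℱ.le k _ (hmeas q)) hdisj,
      lintegral_iUnion (fun q => ℱ.le k _ (hmeas q)) hdisj]
    refine ENNReal.tsum_le_tsum fun q => ?_
    have hpol : MeasurableSet[ℱ k] {ω | playedPolicy tie B K δ α (X ω) k = q.1} :=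
      (measurable_fst.comp hdm) (measurableSet_singleton q.1)
    calc ∫⁻ ω in d ⁻¹' {q}, F ω * ∏ j, φ (playedPolicy tie B K δ α (X ω) k)
            (fun j => count (X ω) k j h s a) j ((X ω).traj k j) ∂μ
        = ∫⁻ ω in d ⁻¹' {q}, F ω * (fun τ : {j // j ∉ B} → Traj S A H => ∏ j, φ q.1 q.2 j (τ j))
            (fun j => (X ω).traj k j) ∂μ := by
          refine setLIntegral_congr_fun (ℱ.le k _ (hmeas q)) fun ω hω => ?_
          have : d ω = q := hω
          simp only [← this, hd]
      _ = (∫⁻ ω in d ⁻¹' {q}, F ω ∂μ) * ∫⁻ τ, ∏ j, φ q.1 q.2 j (τ j)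
            ∂(Measure.pi fun _ : {j // j ∉ B} => trajLaw M q.1) := by
          refine setLIntegral_mul_comp_of_law (ℱ.le k) μ _
            (Measure.pi fun _ : {j // j ∉ B} => trajLaw M q.1) (fun ω j => (X ω).traj k j) ?_ ?_
            F hFm (fun τ : {j // j ∉ B} → Traj S A H => ∏ j, φ q.1 q.2 j (τ j)) ?_
          · exact measurable_pi_iff.2 fun j =>
              (hX.measurable_traj k j j.2).mono (ℱ.le (k + 1)) le_rfl
          · intro E hE T hT
            have := hX.law_traj k (by omega) (E ∩ d ⁻¹' {q}) (hE.inter (hmeas q)) q.1 T hT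
            have hsub : E ∩ d ⁻¹' {q} ∩ {ω | playedPolicy tie B K δ α (X ω) k = q.1} =
                E ∩ d ⁻¹' {q} := by
              refine Set.inter_eq_left.2 fun ω hω => ?_
              have : d ω = q := hω.2
              simp [← this, hd]
            rw [hsub] at this
            exact this
          · exact Finset.measurable_prod _ fun j _ => (hφ _ _ j).comp (measurable_pi_apply j)
      _ ≤ (∫⁻ ω in d ⁻¹' {q}, F ω ∂μ) * 1 := by
          gcongr
          rw [lintegral_pi_prod _ _ fun j => hφ q.1 q.2 j]
          exact Finset.prod_le_one' fun j _ => hle _ _ _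
      _ = _ := mul_one _

end Run

/-! ### Weighted noise and its concentration -/

section Noise

variable {S A : Type*} {H m : ℕ} [Fintype S] [DecidableEq S] [Fintype A] [DecidableEq A]
  {B : Finset (Fin m)}

/-- The deviation of `r + V(s')` from its mean if `(s, a)` is visited at step `h`. -/
noncomputable def noise (M : MDP S A H) (h : Fin H) (s : S) (a : A) (V : S → ℝ)
    (τ : Traj S A H) : ℝ :=
  if Hit h s a τ then τ.2.2 h + V (τ.1 h.succ) - M.qMean h s a V else 0

/-- The noise of the good agents before episode `k`, the `i`-th visit of agent `j` having weight
`w j i`. -/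
noncomputable def weightedNoise (M : MDP S A H) (h : Fin H) (s : S) (a : A) (V : S → ℝ)
    (w : {j // j ∉ B} → ℕ → ℝ) (X : Transcript S A H m) (k : ℕ) : ℝ :=
  ∑ t ∈ Finset.range k, ∑ j : {j // j ∉ B}, w j (count X t j h s a) * noise M h s a V (X.traj t j)

theorem count_succ (X : Transcript S A H m) (k : ℕ) (j : Fin m) (h : Fin H) (s : S) (a : A) :
    count X (k + 1) j h s a = count X k j h s a + if Hit h s a (X.traj k j) then 1 else 0 := by
  rw [count_eq_sum, count_eq_sum, Finset.sum_range_succ]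

theorem count_mono (X : Transcript S A H m) (j : Fin m) (h : Fin H) (s : S) (a : A) :
    Monotone fun k => count X k j h s a :=
  monotone_nat_of_le_succ fun k => by simp [count_succ]

theorem count_le (X : Transcript S A H m) (k : ℕ) (j : Fin m) (h : Fin H) (s : S) (a : A) :
    count X k j h s a ≤ k := by
  simpa [count, visits] using Finset.card_filter_le (Finset.range k) _

/-- The visits before episode `k` carry the indices `0, 1, …` once each. This turns the quadratic
variation of the weighted noise into a sum over visit indices. -/
theorem sum_hit_eq_sum_range_count (X : Transcript S A H m) (k : ℕ) (j : Fin m) (h : Fin H) (s : S)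
    (a : A) (f : ℕ → ℝ) :
    ∑ t ∈ Finset.range k, (if Hit h s a (X.traj t j) then f (count X t j h s a) else 0) =
      ∑ i ∈ Finset.range (count X k j h s a), f i := by
  induction k with
  | zero => simp [count, visits]
  | succ k ih =>
    rw [Finset.sum_range_succ, ih, count_succ]
    split_ifs <;> simp [Finset.sum_range_succ]

end Noise

section Concentration

variable {S A : Type*} {H m : ℕ} [Fintype S] [DecidableEq S] [MeasurableSpace S]
  [DiscreteMeasurableSpace S] [Fintype A] [DecidableEq A] [MeasurableSpace A]
  [DiscreteMeasurableSpace A]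
  {Ω : Type*} {mΩ : MeasurableSpace Ω} {μ : Measure Ω} {ℱ : Filtration ℕ mΩ} {M : MDP S A H}
  {tie : TieBreak A m} {B : Finset (Fin m)} {K : ℕ} {δ α : ℝ} {X : Ω → Transcript S A H m}

theorem IsByzantineRun.measure_lt_le_exp_neg [IsProbabilityMeasure μ]
    (hX : IsByzantineRun μ ℱ M tie B K δ α X) (h : Fin H) (s : S) (a : A)
    (φ : Policy S A H → ({j // j ∉ B} → ℕ) → {j // j ∉ B} → Traj S A H → ℝ)
    (hφ : ∀ π n j, Measurable (φ π n j))
    (hle : ∀ π n j, ∫⁻ τ, ENNReal.ofReal (Real.exp (φ π n j τ)) ∂(trajLaw M π) ≤ 1)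
    {k : ℕ} (hk : k ≤ K) (y : ℝ) :
    μ {ω | y ≤ ∑ t ∈ Finset.range k, ∑ j, φ (playedPolicy tie B K δ α (X ω) t)
      (fun j => count (X ω) t j h s a) j ((X ω).traj t j)} ≤ ENNReal.ofReal (Real.exp (-y)) := by
  have hm : ∀ π n j, Measurable fun τ => ENNReal.ofReal (Real.exp (φ π n j τ)) := fun π n j => by
    have := hφ π n j
    fun_prop
  have h1 := hX.lintegral_prod_le_one h s a _ hm hle hk
  have h2 := (hX.measurable_process h s a _ hm k).mono (ℱ.le k) le_rfl
  have h3 := meas_ge_le_lintegral_div h2.aemeasurable (ε := ENNReal.ofReal (Real.exp y))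
    (by simp [Real.exp_pos]) ENNReal.ofReal_ne_top (μ := μ)
  refine le_trans (measure_mono fun ω hω => ?_) (h3.trans ?_)
  · simp only [Set.mem_ofPred_eq] at hω ⊢
    simp_rw [← ENNReal.ofReal_prod_of_nonneg fun _ _ => (Real.exp_pos _).le, ← Real.exp_sum]
    rw [← ENNReal.ofReal_prod_of_nonneg fun _ _ => (Real.exp_pos _).le, ← Real.exp_sum]
    exact ENNReal.ofReal_le_ofReal (Real.exp_le_exp.2 hω)
  · rw [Real.exp_neg, ENNReal.ofReal_inv_of_pos (Real.exp_pos _), ← one_div]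
    gcongr

/-- Hoeffding's inequality for a random number of terms. The sum of the squared weights depends on
the random counts, so its bound is part of the event. -/
theorem IsByzantineRun.measure_lt_weightedNoise_le [IsProbabilityMeasure μ]
    (hX : IsByzantineRun μ ℱ M tie B K δ α X) (h : Fin H) (s : S) (a : A) (V : S → ℝ) {v : ℝ}
    (hV : ∀ s, V s ∈ Set.Icc 0 v) (w : {j // j ∉ B} → ℕ → ℝ) {k : ℕ} (hk : k ≤ K) {q y : ℝ}
    (hq : 0 < q) (hy : 0 ≤ y) :
    μ {ω | ∑ j : {j // j ∉ B}, ∑ i ∈ Finset.range (count (X ω) k j h s a), w j i ^ 2 ≤ q ∧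
      (1 + v) * y * √q < weightedNoise M h s a V w (X ω) k}
      ≤ ENNReal.ofReal (Real.exp (-(2 * y ^ 2))) := by
  have hv : 0 ≤ v := (hV s).1.trans (hV s).2
  have hVm : Measurable V := measurable_of_finite V
  -- This `l` maximizes `l (1 + v) y √q - l² (1 + v)² q / 8`; the maximum is `2 y²`.
  set l : ℝ := 4 * y / ((1 + v) * √q) with hl
  have hsq : 0 < √q := Real.sqrt_pos.2 hq
  refine le_trans (measure_mono fun ω hω => ?_) (hX.measure_lt_le_exp_neg h s a
    (fun _ n j τ => if Hit h s a τ then (l * w j (n j)) *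
      (τ.2.2 h + V (τ.1 h.succ) - M.qMean h s a V) - (l * w j (n j)) ^ 2 * (1 + v) ^ 2 / 8 else 0)
    (fun _ n j => Measurable.ite (measurableSet_hit h s a) (by fun_prop) measurable_const)
    (fun π n j => lintegral_trajLaw_exp_noise_le_one M π h s a V hV _) hk _)
  obtain ⟨h1, h2⟩ := hω
  have e : ∑ t ∈ Finset.range k, ∑ j : {j // j ∉ B}, (if Hit h s a ((X ω).traj t j) then
      (l * w j (count (X ω) t j h s a)) * (((X ω).traj t j).2.2 h + V (((X ω).traj t j).1 h.succ)
        - M.qMean h s a V) - (l * w j (count (X ω) t j h s a)) ^ 2 * (1 + v) ^ 2 / 8 else 0)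
      = l * weightedNoise M h s a V w (X ω) k - l ^ 2 * (1 + v) ^ 2 / 8 *
        ∑ j : {j // j ∉ B}, ∑ i ∈ Finset.range (count (X ω) k j h s a), w j i ^ 2 := by
    simp_rw [← sum_hit_eq_sum_range_count]
    rw [Finset.sum_comm (s := Finset.univ), weightedNoise, Finset.mul_sum, Finset.mul_sum,
      ← Finset.sum_sub_distrib]
    refine Finset.sum_congr rfl fun t _ => ?_
    rw [Finset.mul_sum, Finset.mul_sum, ← Finset.sum_sub_distrib]
    refine Finset.sum_congr rfl fun j _ => ?_
    rw [noise]
    split_ifs <;> ring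
  rw [Set.mem_ofPred_eq, e]
  have hl0 : 0 ≤ l := by positivity
  have e1 : l * ((1 + v) * y * √q) = 4 * y ^ 2 := by
    rw [hl]; field_simp
  have e2 : l ^ 2 * (1 + v) ^ 2 / 8 * q = 2 * y ^ 2 := by
    have : q = √q ^ 2 := (Real.sq_sqrt hq.le).symm
    rw [hl]
    nth_rewrite 2 [this]
    field_simp
    ring
  have h3 := mul_le_mul_of_nonneg_left h2.le hl0
  have h4 := mul_le_mul_of_nonneg_left h1 (by positivity : 0 ≤ l ^ 2 * (1 + v) ^ 2 / 8)
  linarith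

theorem weightedNoise_neg (M : MDP S A H) (h : Fin H) (s : S) (a : A) (V : S → ℝ)
    (w : {j // j ∉ B} → ℕ → ℝ) (X : Transcript S A H m) (k : ℕ) :
    weightedNoise M h s a V (fun j i => -w j i) X k = -weightedNoise M h s a V w X k := by
  simp [weightedNoise]

theorem IsByzantineRun.measure_lt_abs_weightedNoise_le [IsProbabilityMeasure μ]
    (hX : IsByzantineRun μ ℱ M tie B K δ α X) (h : Fin H) (s : S) (a : A) (V : S → ℝ) {v : ℝ}
    (hV : ∀ s, V s ∈ Set.Icc 0 v) (w : {j // j ∉ B} → ℕ → ℝ) {k : ℕ} (hk : k ≤ K) {q y : ℝ}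
    (hq : 0 < q) (hy : 0 ≤ y) :
    μ {ω | ∑ j : {j // j ∉ B}, ∑ i ∈ Finset.range (count (X ω) k j h s a), w j i ^ 2 ≤ q ∧
      (1 + v) * y * √q < |weightedNoise M h s a V w (X ω) k|}
      ≤ ENNReal.ofReal (2 * Real.exp (-(2 * y ^ 2))) := by
  have h1 := hX.measure_lt_weightedNoise_le h s a V hV w hk hq hy
  have h2 := hX.measure_lt_weightedNoise_le h s a V hV (fun j i => -w j i) hk hq hy
  simp only [weightedNoise_neg, neg_sq] at h2
  rw [two_mul, ENNReal.ofReal_add (Real.exp_pos _).le (Real.exp_pos _).le]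
  refine le_trans (measure_mono fun ω hω => ?_) ((measure_union_le _ _).trans (add_le_add h1 h2))
  rcases lt_abs.1 hω.2 with h | h
  · exact Or.inl ⟨hω.1, h⟩
  · exact Or.inr ⟨hω.1, h⟩

/-- The expected number of visits of an agent before episode `k`, given the policies. -/
noncomputable def expectedCount (M : MDP S A H) (tie : TieBreak A m) (B : Finset (Fin m)) (K : ℕ)
    (δ α : ℝ) (X : Transcript S A H m) (k : ℕ) (h : Fin H) (s : S) (a : A) : ℝ :=
  ∑ t ∈ Finset.range k, occupancy M (playedPolicy tie B K δ α X t) h s a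

theorem IsByzantineRun.measure_le_count_le [IsProbabilityMeasure μ]
    (hX : IsByzantineRun μ ℱ M tie B K δ α X) (h : Fin H) (s : S) (a : A) {j : Fin m} (hj : j ∉ B)
    {k : ℕ} (hk : k ≤ K) (t y : ℝ) :
    μ {ω | y ≤ t * count (X ω) k j h s a
      - (Real.exp t - 1) * expectedCount M tie B K δ α (X ω) k h s a}
      ≤ ENNReal.ofReal (Real.exp (-y)) := by
  refine le_trans (measure_mono fun ω hω => ?_) (hX.measure_lt_le_exp_neg h s a
    (fun π _ i τ => if i = ⟨j, hj⟩ then (if Hit h s a τ then t else 0)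
      - (Real.exp t - 1) * occupancy M π h s a else 0) (fun π n i => ?_) (fun π n i => ?_) hk y)
  · refine le_of_le_of_eq (Set.mem_ofPred_eq ▸ hω : y ≤ _) ?_
    simp only [Finset.sum_ite_eq', Finset.mem_univ, if_true]
    rw [Finset.sum_sub_distrib, ← Finset.mul_sum, expectedCount, count_eq_sum]
    push_cast
    rw [Finset.mul_sum]
    simp
  · split_ifs
    · exact (Measurable.ite (measurableSet_hit h s a) measurable_const measurable_const).sub_const _
    · exact measurable_const
  · by_cases hi : i = ⟨j, hj⟩
    · simp only [hi, if_true]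
      exact lintegral_trajLaw_exp_hit_le_one M π h s a t
    · simp [hi]

end Concentration

/-! ### Order statistics of the batch sizes -/

section KthLargest

variable {m : ℕ} (n : Fin m → ℕ) {r : ℕ}

theorem bddAbove_kthLargest_set (hr : 1 ≤ r) :
    BddAbove {v : ℕ | r ≤ (Finset.univ.filter fun j => v ≤ n j).card} := by
  refine ⟨∑ j, n j, fun v hv => ?_⟩
  obtain ⟨j, hj⟩ := Finset.card_pos.1 (lt_of_lt_of_le hr hv)
  exact (Finset.mem_filter.1 hj).2.trans
    (Finset.single_le_sum (fun i _ => Nat.zero_le (n i)) (Finset.mem_univ j))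

theorem le_card_kthLargest_le (hr : 1 ≤ r) (hrm : r ≤ m) :
    r ≤ (Finset.univ.filter fun j => kthLargest n r ≤ n j).card :=
  Nat.sSup_mem (s := {v : ℕ | r ≤ (Finset.univ.filter fun j => v ≤ n j).card})
    ⟨0, by simpa using hrm⟩ (bddAbove_kthLargest_set n hr)

theorem le_kthLargest (hr : 1 ≤ r) {v : ℕ}
    (hv : r ≤ (Finset.univ.filter fun j => v ≤ n j).card) : v ≤ kthLargest n r :=
  le_csSup (bddAbove_kthLargest_set n hr) hv

theorem card_kthLargest_lt (hr : 1 ≤ r) :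
    (Finset.univ.filter fun j => kthLargest n r < n j).card < r := by
  by_contra hcon
  have := le_kthLargest n hr (v := kthLargest n r + 1) (not_lt.1 hcon)
  omega

end KthLargest

/-! ### Error bound of the robust estimator -/

section PwcError

variable {m : ℕ} {B : Finset (Fin m)} {α : ℝ}

theorem three_mul_card_lt (hm : 1 ≤ m) (hB : (B.card : ℝ) = α * m)
    (hα : α ≤ 1 / 3 * (1 - 1 / (m : ℝ))) : 3 * B.card + 1 ≤ m := by
  have hm' : (0 : ℝ) < m := by exact_mod_cast hm
  have h1 : α * m ≤ 1 / 3 * (1 - 1 / (m : ℝ)) * m := mul_le_mul_of_nonneg_right hα hm'.le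
  have h2 : 1 / 3 * (1 - 1 / (m : ℝ)) * m = (m - 1) / 3 := by field_simp
  rw [h2, ← hB] at h1
  have : (3 * B.card + 1 : ℝ) ≤ m := by linarith
  exact_mod_cast this

theorem nCut_eq (hB : (B.card : ℝ) = α * m) (n : Fin m → ℕ) :
    nCut α n = kthLargest n (2 * B.card + 1) := by
  have : 2 * α * m = ((2 * B.card : ℕ) : ℝ) := by push_cast; rw [hB]; ring
  rw [nCut, this, Nat.floor_natCast]

theorem le_card_nCut_le (hm : 1 ≤ m) (hB : (B.card : ℝ) = α * m)
    (hα : α ≤ 1 / 3 * (1 - 1 / (m : ℝ))) (n : Fin m → ℕ) :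
    2 * B.card + 1 ≤ (Finset.univ.filter fun j => nCut α n ≤ n j).card := by
  have := three_mul_card_lt hm hB hα
  rw [nCut_eq hB]
  exact le_card_kthLargest_le n (by omega) (by omega)

theorem card_nCut_lt (hB : (B.card : ℝ) = α * m) (n : Fin m → ℕ) :
    (Finset.univ.filter fun j => nCut α n < n j).card ≤ 2 * B.card := by
  rw [nCut_eq hB]
  exact Nat.lt_succ_iff.1 (card_kthLargest_lt n (by omega))

/-- At least `2b + 1` agents, with `b` the number of Byzantine ones, report `n^cut` data or more;
`b` Byzantine agents and `b` others cannot exhaust them. In the application `F` is the complement of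
the chosen clique. -/
theorem exists_good_nCut_le (hm : 1 ≤ m) (hB : (B.card : ℝ) = α * m)
    (hα : α ≤ 1 / 3 * (1 - 1 / (m : ℝ))) (n : Fin m → ℕ) (F : Finset (Fin m))
    (hF : F.card ≤ B.card) : ∃ j, j ∉ B ∧ j ∉ F ∧ nCut α n ≤ n j := by
  by_contra! hcon
  have h1 := le_card_nCut_le hm hB hα n
  have h2 : (Finset.univ.filter fun j => nCut α n ≤ n j) ⊆ B ∪ F := by
    intro j hj
    by_contra hj'
    rw [Finset.mem_union, not_or] at hj'
    exact absurd (Finset.mem_filter.1 hj).2 (not_le.2 (hcon j hj'.1 hj'.2))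
  have h3 := (Finset.card_le_card h2).trans (Finset.card_union_le B F)
  omega

theorem nCut_le_of_good_le (hm : 1 ≤ m) (hB : (B.card : ℝ) = α * m)
    (hα : α ≤ 1 / 3 * (1 - 1 / (m : ℝ))) (n : Fin m → ℕ) {v : ℕ} (hv : ∀ j ∉ B, n j ≤ v) :
    nCut α n ≤ v := by
  obtain ⟨j, hj, -, hle⟩ := exists_good_nCut_le hm hB hα n ∅ (by simp)
  exact hle.trans (hv j hj)

/-- Since `3b + 1 ≤ m`, at least `2b + 1` agents are good. Together with `nCut_le_of_good_le`, this
keeps the cut between the smallest and the largest good batch size, whatever the Byzantine agents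
report. -/
theorem le_nCut_of_le_good (hm : 1 ≤ m) (hB : (B.card : ℝ) = α * m)
    (hα : α ≤ 1 / 3 * (1 - 1 / (m : ℝ))) (n : Fin m → ℕ) {v : ℕ} (hv : ∀ j ∉ B, v ≤ n j) :
    v ≤ nCut α n := by
  have h3 := three_mul_card_lt hm hB hα
  rw [nCut_eq hB]
  refine le_kthLargest n (by omega) ?_
  have h1 : Bᶜ ⊆ Finset.univ.filter fun j => v ≤ n j := fun j hj =>
    Finset.mem_filter.2 ⟨Finset.mem_univ j, hv j (Finset.mem_compl.1 hj)⟩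
  have h2 := Finset.card_le_card h1
  rw [Finset.card_compl, Fintype.card_fin] at h2
  omega

theorem maxCliques_nonempty (σ α ε δ : ℝ) (x : Fin m → ℝ) (n : Fin m → ℕ) :
    (maxCliques σ α ε δ x n).Nonempty := by
  have hne : (cliques σ α ε δ x n).Nonempty := by
    classical
    exact ⟨∅, by simp [cliques]⟩
  obtain ⟨U, hU, hmax⟩ := Finset.exists_max_image _ Finset.card hne
  exact ⟨U, by rw [maxCliques, Finset.mem_filter]; exact ⟨hU, hmax⟩⟩

theorem mem_cliques_iff {σ α ε δ : ℝ} {x : Fin m → ℝ} {n : Fin m → ℕ} {U : Finset (Fin m)} :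
    U ∈ cliques σ α ε δ x n ↔ (⋂ j ∈ U, confInterval σ α ε δ x n j).Nonempty := by
  classical
  simp [cliques]

theorem mul_div_sqrt_le {a b c : ℝ} (ha : 0 ≤ a) (hab : a ≤ b) (hac : a ≤ c) :
    a / √b ≤ √c := by
  rcases ha.eq_or_lt with rfl | ha
  · simp
  have hb : 0 < √b := Real.sqrt_pos.2 (ha.trans_le hab)
  rw [div_le_iff₀ hb]
  calc a = √a * √a := (Real.mul_self_sqrt ha.le).symm
    _ ≤ √c * √b := by gcongr

theorem abs_sub_le_of_mem_confInterval {σ ε δ : ℝ} {x : Fin m → ℝ} {n : Fin m → ℕ} {j : Fin m}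
    {z : ℝ} (hz : z ∈ confInterval σ α ε δ x n j) (hj : nTilde α n j ≠ 0) :
    |x j - z| ≤ σ / √(nTilde α n j) * √(2 * Real.log (2 * m / δ)) + ε := by
  rw [confInterval, if_neg hj] at hz
  rw [abs_le]
  constructor <;> linarith [hz.1, hz.2]

/-- The final arithmetic of `abs_pwc_sub_le`: `v` is the weight of the clique and `V` the total
weight; `V ≤ 2 v` doubles the first two constants. -/
theorem div_le_pwc_error {P v V ε σ u w a c : ℝ} (hv : 0 < v) (hV : 0 < V) (hVv : V ≤ 2 * v)
    (hε : 0 ≤ ε) (hu : 0 ≤ σ * u) (ha : 0 ≤ a * (σ * w * √c))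
    (hP : P ≤ σ * u * √V + 4 * (a * (σ * w * √c)) + 5 * v * ε) :
    P / v ≤ 2 / √V * σ * u + 8 * a * √c / V * σ * w + 5 * ε + ε := by
  have hnum : 0 ≤ σ * u * √V + 4 * (a * (σ * w * √c)) := by positivity
  have h1 : √V / V = 1 / √V := Real.sqrt_div_self'
  calc P / v ≤ (σ * u * √V + 4 * (a * (σ * w * √c)) + 5 * v * ε) / v := by gcongr
    _ = (σ * u * √V + 4 * (a * (σ * w * √c))) / v + 5 * ε := by
        field_simp
    _ ≤ (σ * u * √V + 4 * (a * (σ * w * √c))) / (V / 2) + 5 * ε := by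
        gcongr
        linarith
    _ = 2 * σ * u * (√V / V) + 8 * a * √c / V * σ * w + 5 * ε := by ring
    _ = 2 / √V * σ * u + 8 * a * √c / V * σ * w + 5 * ε := by rw [h1]; ring
    _ ≤ _ := by linarith

/-- The error bound of Pert-Weighted-Clique, when the data of the good agents behave well. The
number `N j` is the deviation of the sum of the data in the clipped batch of agent `j`. -/
theorem abs_pwc_sub_le {A : Type*} (tie : TieBreak A m) (hm : 1 ≤ m)
    (hB : (B.card : ℝ) = α * m) (hα : α ≤ 1 / 3 * (1 - 1 / (m : ℝ))) {σ ε δ : ℝ} (hσ : 0 ≤ σ)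
    (hε : 0 ≤ ε) (x : Fin m → ℝ) (n : Fin m → ℕ) (x₀ : ℝ) (N : Fin m → ℝ) (hcut : 0 < nCut α n)
    (hdev : ∀ j ∉ B, 0 < n j →
      |x j - x₀| ≤ σ * √(2 * Real.log (2 * m / δ)) / 2 / √(n j) + ε)
    (hunclipped : ∀ j ∉ B, n j ≤ nCut α n → |n j * (x j - x₀) - N j| ≤ n j * ε)
    (hclipped : ∀ j ∉ B, nCut α n < n j → |nCut α n * (x j - x₀) - N j| ≤
      σ * √(2 * Real.log (2 * m / δ)) / 2 * √(nCut α n) + nCut α n * ε)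
    (hsum : |∑ j ∈ Bᶜ, N j| ≤ σ * √(2 * Real.log (2 / δ)) * √(∑ j, (nTilde α n j : ℝ))) :
    |(pwc tie x n σ α ε δ).1 - x₀| ≤ (pwc tie x n σ α ε δ).2 := by
  set w := √(2 * Real.log (2 * m / δ)) with hw
  set u := √(2 * Real.log (2 / δ)) with hu
  set c := nCut α n with hc
  set b := B.card with hb
  have hw0 : 0 ≤ w := Real.sqrt_nonneg _
  have hcR : (0 : ℝ) < c := by exact_mod_cast hcut
  have hntc : ∀ j, (nTilde α n j : ℝ) ≤ c := fun j => by exact_mod_cast min_le_right _ _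
  have hntn : ∀ j, (nTilde α n j : ℝ) ≤ n j := fun j => by exact_mod_cast min_le_left _ _
  have hnt0 : ∀ j, (0 : ℝ) ≤ nTilde α n j := fun j => Nat.cast_nonneg _
  rw [pwc, if_pos hcut]
  set U := tie.clique (maxCliques σ α ε δ x n) with hU
  have hUm : U ∈ maxCliques σ α ε δ x n := tie.clique_mem _ (maxCliques_nonempty _ _ _ _ _ _)
  rw [maxCliques, Finset.mem_filter] at hUm
  obtain ⟨hUc, hUmax⟩ := hUm
  have hσw : 0 ≤ σ * w := mul_nonneg hσ hw0
  -- the good agents form a clique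
  have hgood : Bᶜ ∈ cliques σ α ε δ x n := by
    rw [mem_cliques_iff]
    refine ⟨x₀, Set.mem_iInter₂.2 fun j hj => ?_⟩
    rw [Finset.mem_compl] at hj
    rw [confInterval]
    split_ifs with h0
    · trivial
    · have hn : 0 < n j := by
        by_contra hn
        exact h0 (by simp [nTilde, Nat.eq_zero_of_not_pos hn])
      have h1 := hdev j hj hn
      have hntp : (0 : ℝ) < nTilde α n j := by exact_mod_cast Nat.pos_of_ne_zero h0
      -- The intervals are twice as wide as the deviation bound requires, and clipping only widens
      -- them.
      have h2 : σ * w / 2 / √(n j) ≤ σ / √(nTilde α n j) * w := by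
        calc σ * w / 2 / √(n j) ≤ σ * w / √(nTilde α n j) := by
              gcongr
              · linarith
              · exact min_le_left _ _
          _ = _ := by ring
      rw [abs_le] at h1
      constructor <;> linarith [h1.1, h1.2]
  have hUcard : Uᶜ.card ≤ b := by
    have h1 := hUmax _ hgood
    have h2 := Finset.card_add_card_compl B
    have h3 := Finset.card_add_card_compl U
    omega
  -- The reference agent: good, in the clique, with clipped batch size exactly `c`. Its error of
  -- order `σ w / √c` transfers to all members of the clique.
  obtain ⟨i, hiB, hiU, hin⟩ := exists_good_nCut_le hm hB hα n Uᶜ hUcard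
  rw [Finset.mem_compl, not_not] at hiU
  -- deviations weighted with the clipped batch sizes
  have hgd : ∀ j ∉ B, |(nTilde α n j : ℝ) * (x j - x₀)| ≤ σ * w * √c / 2 + nTilde α n j * ε := by
    intro j hj
    rw [abs_mul, abs_of_nonneg (hnt0 j)]
    rcases Nat.eq_zero_or_pos (n j) with h0 | h0
    · have : nTilde α n j = 0 := by simp [nTilde, h0]
      rw [this]
      simp only [Nat.cast_zero, zero_mul, add_zero]
      positivity
    · calc (nTilde α n j : ℝ) * |x j - x₀|
          ≤ nTilde α n j * (σ * w / 2 / √(n j) + ε) := by gcongr; exact hdev j hj h0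
        _ = σ * w / 2 * (nTilde α n j / √(n j)) + nTilde α n j * ε := by ring
        _ ≤ σ * w / 2 * √c + nTilde α n j * ε := by
            gcongr
            exact mul_div_sqrt_le (hnt0 j) (hntn j) (hntc j)
        _ = _ := by ring
  -- Here `5/2 = 1 + 1 + 1/2`: the half-widths of the intervals of `j` and of `i`, and the deviation
  -- of the good agent `i` from `x₀`.
  have hbad : ∀ j ∈ U, |(nTilde α n j : ℝ) * (x j - x₀)| ≤
      5 / 2 * (σ * w * √c) + 3 * (nTilde α n j * ε) := by
    intro j hj
    rw [abs_mul, abs_of_nonneg (hnt0 j)]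
    by_cases h0 : nTilde α n j = 0
    · rw [h0]
      simp only [Nat.cast_zero, zero_mul, mul_zero, add_zero]
      positivity
    obtain ⟨z, hz⟩ := mem_cliques_iff.1 hUc
    have hzj := abs_sub_le_of_mem_confInterval (Set.mem_iInter₂.1 hz j hj) h0
    have hic : nTilde α n i = c := min_eq_right hin
    have hzi := abs_sub_le_of_mem_confInterval (Set.mem_iInter₂.1 hz i hiU) (by omega)
    have hi := hdev i hiB (by omega)
    rw [hic] at hzi
    have h1 : σ * w / 2 / √(n i) ≤ σ * w / 2 / √c := by
      gcongr
    have h2 : |x j - x₀| ≤ |x j - z| + (|x i - z| + |x i - x₀|) := by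
      have e : x j - x₀ = (x j - z) + (-(x i - z) + (x i - x₀)) := by ring
      rw [e]
      refine (abs_add_le _ _).trans (add_le_add le_rfl ((abs_add_le _ _).trans ?_))
      rw [abs_neg]
    calc (nTilde α n j : ℝ) * |x j - x₀|
        ≤ nTilde α n j * ((σ / √(nTilde α n j) * w + ε) + ((σ / √c * w + ε)
          + (σ * w / 2 / √c + ε))) := by
          gcongr
          linarith
      _ = σ * w * (nTilde α n j / √(nTilde α n j)) + 3 / 2 * (σ * w) * (nTilde α n j / √c)
          + 3 * (nTilde α n j * ε) := by ring
      _ ≤ σ * w * √c + 3 / 2 * (σ * w) * √c + 3 * (nTilde α n j * ε) := by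
          gcongr
          · exact mul_div_sqrt_le (hnt0 j) le_rfl (hntc j)
          · exact mul_div_sqrt_le (hnt0 j) (hntc j) (hntc j)
      _ = _ := by ring
  -- An unclipped agent contributes its noise up to the discretization error. Only for a clipped one
  -- does the rescaled mean of all data differ from the sum of the first `c`.
  have hclip : ∀ j ∉ B, |(nTilde α n j : ℝ) * (x j - x₀) - N j| ≤
      (if c < n j then σ * w * √c / 2 else 0) + nTilde α n j * ε := by
    intro j hj
    split_ifs with hcn
    · have : nTilde α n j = c := min_eq_right hcn.le
      rw [this]
      exact (hclipped j hj hcn).trans (le_of_eq (by ring))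
    · have : nTilde α n j = n j := min_eq_left (not_lt.1 hcn)
      rw [this, zero_add]
      exact hunclipped j hj (not_lt.1 hcn)
  -- total weights
  set W := ∑ j, (nTilde α n j : ℝ) with hW
  set WU := ∑ j ∈ U, (nTilde α n j : ℝ) with hWU
  set E := ∑ j ∈ Uᶜ, (nTilde α n j : ℝ) with hE
  have hWsplit : W = WU + E := (Finset.sum_add_sum_compl U _).symm
  have hEle : E ≤ b * c := by
    calc E ≤ ∑ j ∈ Uᶜ, (c : ℝ) := Finset.sum_le_sum fun j _ => hntc j
      _ = Uᶜ.card * c := by rw [Finset.sum_const, nsmul_eq_mul]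
      _ ≤ b * c := by gcongr
  -- At least `2b + 1` agents have clipped size `c` and at most `b` of them are outside the clique.
  -- So the clique outweighs its complement, which weighs at most `b c`.
  have hWUge : (b + 1) * (c : ℝ) ≤ WU := by
    have h1 : 2 * b + 1 ≤ (Finset.univ.filter fun j => c ≤ n j).card :=
      le_card_nCut_le hm hB hα n
    have h2 : (Finset.univ.filter fun j => c ≤ n j) ⊆
        (U.filter fun j => c ≤ n j) ∪ Uᶜ := by
      intro j hj
      by_cases hjU : j ∈ U
      · exact Finset.mem_union_left _ (Finset.mem_filter.2 ⟨hjU, (Finset.mem_filter.1 hj).2⟩)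
      · exact Finset.mem_union_right _ (Finset.mem_compl.2 hjU)
    have h3 := (Finset.card_le_card h2).trans (Finset.card_union_le _ _)
    have h4 : b + 1 ≤ (U.filter fun j => c ≤ n j).card := by omega
    calc (b + 1) * (c : ℝ) ≤ (U.filter fun j => c ≤ n j).card * c := by
          gcongr
          exact_mod_cast h4
      _ = ∑ j ∈ U.filter fun j => c ≤ n j, (c : ℝ) := by rw [Finset.sum_const, nsmul_eq_mul]
      _ = ∑ j ∈ U.filter fun j => c ≤ n j, (nTilde α n j : ℝ) := by
          refine Finset.sum_congr rfl fun j hj => ?_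
          have : nTilde α n j = c := min_eq_right (Finset.mem_filter.1 hj).2
          rw [this]
      _ ≤ WU := Finset.sum_le_sum_of_subset_of_nonneg (Finset.filter_subset _ _)
          fun j _ _ => hnt0 j
  have hbc : (0 : ℝ) ≤ b * c := by positivity
  have hWUpos : 0 < WU := by linarith
  have hE0 : 0 ≤ E := Finset.sum_nonneg fun j _ => hnt0 j
  have hWpos : 0 < W := by linarith
  have hW2 : W ≤ 2 * WU := by linarith
  -- decomposition of the weighted error
  have hmain : |∑ j ∈ U, (nTilde α n j : ℝ) * (x j - x₀)| ≤
      |∑ j ∈ Bᶜ, N j| + 4 * b * (σ * w * √c) + 5 * WU * ε := by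
    set f : Fin m → ℝ := fun j => (nTilde α n j : ℝ) * (x j - x₀) with hf
    -- The clique sum is the noise of all good agents, plus the clipping corrections, minus the good
    -- agents outside the clique, plus the Byzantine members.
    have e1 : ∑ j ∈ U, f j = ∑ j ∈ Bᶜ, N j + ∑ j ∈ Bᶜ, (f j - N j)
        - ∑ j ∈ Uᶜ \ B, f j + ∑ j ∈ U ∩ B, f j := by
      have a1 : ∑ j ∈ Bᶜ, f j = ∑ j ∈ U \ B, f j + ∑ j ∈ Uᶜ \ B, f j := by
        rw [← Finset.sum_union]
        · congr 1
          ext j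
          simp only [Finset.mem_compl, Finset.mem_union, Finset.mem_sdiff]
          tauto
        · rw [Finset.disjoint_left]
          intro j h1 h2
          simp only [Finset.mem_sdiff, Finset.mem_compl] at h1 h2
          exact h2.1 h1.1
      have a2 := Finset.sum_inter_add_sum_sdiff U B f
      rw [Finset.sum_sub_distrib, a1]
      linarith
    -- At most `2b` clipped agents cost `1/2` each; with `b · 1/2` from `k2` and `b · 5/2` from `k3`
    -- this makes `4 b`.
    have k1 : |∑ j ∈ Bᶜ, (f j - N j)| ≤ b * (σ * w * √c) + ε * (∑ j ∈ Bᶜ, (nTilde α n j : ℝ)) := by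
      refine (Finset.abs_sum_le_sum_abs _ _).trans ((Finset.sum_le_sum fun j hj =>
        hclip j (Finset.mem_compl.1 hj)).trans ?_)
      rw [Finset.sum_add_distrib, ← Finset.sum_mul, mul_comm ε, ← Finset.sum_filter,
        Finset.sum_const, nsmul_eq_mul]
      refine add_le_add ?_ le_rfl
      have h1 := card_nCut_lt hB n
      have h2 : (Bᶜ.filter fun j => c < n j).card ≤ 2 * b :=
        (Finset.card_le_card (Finset.filter_subset_filter _ (Finset.subset_univ _))).trans h1
      have h3 : ((Bᶜ.filter fun j => c < n j).card : ℝ) ≤ 2 * b := by exact_mod_cast h2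
      have h4 : 0 ≤ σ * w * √c / 2 := by positivity
      nlinarith [mul_le_mul_of_nonneg_right h3 h4]
    have k2 : |∑ j ∈ Uᶜ \ B, f j| ≤ b * (σ * w * √c / 2)
        + ε * ∑ j ∈ Uᶜ \ B, (nTilde α n j : ℝ) := by
      refine (Finset.abs_sum_le_sum_abs _ _).trans ((Finset.sum_le_sum fun j hj =>
        hgd j (Finset.mem_sdiff.1 hj).2).trans ?_)
      rw [Finset.sum_add_distrib, ← Finset.sum_mul, mul_comm ε, Finset.sum_const, nsmul_eq_mul]
      gcongr
      exact (Finset.card_le_card Finset.sdiff_subset).trans hUcard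
    have k3 : |∑ j ∈ U ∩ B, f j| ≤ b * (5 / 2 * (σ * w * √c))
        + 3 * (ε * ∑ j ∈ U ∩ B, (nTilde α n j : ℝ)) := by
      refine (Finset.abs_sum_le_sum_abs _ _).trans ((Finset.sum_le_sum fun j hj =>
        hbad j (Finset.mem_inter.1 hj).1).trans ?_)
      rw [Finset.sum_add_distrib, Finset.sum_const, nsmul_eq_mul, ← Finset.mul_sum,
        ← Finset.sum_mul, mul_comm ε]
      refine add_le_add (mul_le_mul_of_nonneg_right ?_ (by positivity)) le_rfl
      exact_mod_cast Finset.card_le_card (Finset.inter_subset_right (s₁ := U) (s₂ := B))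
    have k4 : (∑ j ∈ Bᶜ, (nTilde α n j : ℝ)) + ∑ j ∈ Uᶜ \ B, (nTilde α n j : ℝ)
        + 3 * ∑ j ∈ U ∩ B, (nTilde α n j : ℝ) ≤ 5 * WU := by
      have a1 : ∑ j ∈ Bᶜ, (nTilde α n j : ℝ) ≤ ∑ j ∈ U \ B, (nTilde α n j : ℝ) + E := by
        rw [hE, ← Finset.sum_union]
        · refine Finset.sum_le_sum_of_subset_of_nonneg (fun j hj => ?_) fun j _ _ => hnt0 j
          simp only [Finset.mem_compl, Finset.mem_union, Finset.mem_sdiff] at *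
          tauto
        · rw [Finset.disjoint_left]
          intro j h1 h2
          exact (Finset.mem_compl.1 h2) (Finset.mem_sdiff.1 h1).1
      have a2 := Finset.sum_inter_add_sum_sdiff U B fun j => (nTilde α n j : ℝ)
      have a3 : ∑ j ∈ Uᶜ \ B, (nTilde α n j : ℝ) ≤ E :=
        Finset.sum_le_sum_of_subset_of_nonneg Finset.sdiff_subset fun j _ _ => hnt0 j
      have a4 : 0 ≤ ∑ j ∈ U \ B, (nTilde α n j : ℝ) := Finset.sum_nonneg fun j _ => hnt0 j
      linarith
    rw [e1]
    have k5 := mul_le_mul_of_nonneg_left k4 hε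
    refine ((abs_add_le _ _).trans (add_le_add ((abs_sub _ _).trans
      (add_le_add (abs_add_le _ _) le_rfl)) le_rfl)).trans ?_
    linarith
  have hest : (∑ j ∈ U, (nTilde α n j : ℝ) * x j) / WU - x₀ =
      (∑ j ∈ U, (nTilde α n j : ℝ) * (x j - x₀)) / WU := by
    simp_rw [mul_sub]
    rw [Finset.sum_sub_distrib, ← Finset.sum_mul, ← hWU]
    field_simp
  simp only
  rw [hest, abs_div, abs_of_pos hWUpos]
  rw [show 8 * α * (m : ℝ) = 8 * b by rw [hB]; ring]
  refine div_le_pwc_error hWUpos hWpos hW2 hε (by positivity) (by positivity) ?_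
  linarith

end PwcError

/-! ### Discretization of the value functions -/

section Grid

variable (S A : Type*) (H m : ℕ) [Fintype S] [Fintype A]

/-- `SAHKm` as a natural number. -/
def gridSize (K : ℕ) : ℕ := Fintype.card S * Fintype.card A * H * K * m

theorem sahkm_eq_gridSize (K : ℕ) : sahkm S A H m K = gridSize S A H m K := by
  simp [sahkm, gridSize]

theorem epsParam_nonneg (K : ℕ) : 0 ≤ epsParam S A H m K := by
  rw [epsParam, sahkm_eq_gridSize]; positivity

variable {S A H m}

/-- The value functions with values in a grid of mesh `ε`, at the step after `h`. -/
noncomputable def gridValue (A : Type*) [Fintype A] (m K : ℕ) (h : Fin H)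
    (v : S → Fin (H * gridSize S A H m K)) (s : S) : ℝ :=
  min ((v s : ℕ) * epsParam S A H m K) ((H : ℝ) - 1 - h)

theorem cast_sub_one_sub_nonneg (h : Fin H) : (0 : ℝ) ≤ (H : ℝ) - 1 - h := by
  have : (h : ℕ) + 1 ≤ H := h.2
  have : ((h : ℕ) : ℝ) + 1 ≤ H := by exact_mod_cast this
  linarith

theorem gridValue_mem_Icc (K : ℕ) (h : Fin H) (v : S → Fin (H * gridSize S A H m K)) (s : S) :
    gridValue A m K h v s ∈ Set.Icc (0 : ℝ) ((H : ℝ) - 1 - h) :=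
  ⟨le_min (mul_nonneg (Nat.cast_nonneg _) (epsParam_nonneg S A H m K)) (cast_sub_one_sub_nonneg h),
    min_le_right _ _⟩

/-- Round down to a multiple of `ε`. With one-sided rounding the changes of the next value and of
its mean both lie in `[0, ε]`, so the noise changes by at most `ε` per visit instead of `2 ε`. -/
theorem exists_gridValue_near {K : ℕ} (hD : 0 < gridSize S A H m K) (h : Fin H) (V : S → ℝ)
    (hV : ∀ s, V s ∈ Set.Icc (0 : ℝ) ((H : ℝ) - 1 - h)) :
    ∃ v : S → Fin (H * gridSize S A H m K), ∀ s,
      gridValue A m K h v s ≤ V s ∧ V s ≤ gridValue A m K h v s + epsParam S A H m K := by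
  set D := gridSize S A H m K with hDdef
  have hD' : (0 : ℝ) < D := by exact_mod_cast hD
  have hε : epsParam S A H m K = 1 / D := by rw [epsParam, sahkm_eq_gridSize]
  have hlt : ∀ s, ⌊V s * D⌋₊ < H * D := by
    intro s
    rw [Nat.floor_lt (mul_nonneg (hV s).1 hD'.le)]
    push_cast
    have : (0 : ℝ) ≤ (h : ℕ) := Nat.cast_nonneg _
    have := (hV s).2
    gcongr
    linarith
  refine ⟨fun s => ⟨⌊V s * D⌋₊, hlt s⟩, fun s => ?_⟩
  have h1 : (⌊V s * D⌋₊ : ℝ) * (1 / D) ≤ V s := by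
    rw [mul_one_div, div_le_iff₀ hD']
    exact Nat.floor_le (mul_nonneg (hV s).1 hD'.le)
  have h2 : V s ≤ (⌊V s * D⌋₊ : ℝ) * (1 / D) + 1 / D := by
    have := (Nat.lt_floor_add_one (V s * D)).le
    calc V s = V s * D * (1 / D) := by field_simp
      _ ≤ (⌊V s * D⌋₊ + 1) * (1 / D) := by gcongr
      _ = _ := by ring
  have h3 : gridValue A m K h (fun s => ⟨⌊V s * D⌋₊, hlt s⟩) s = (⌊V s * D⌋₊ : ℝ) * (1 / D) := by
    rw [gridValue, hε]
    exact min_eq_left (h1.trans (hV s).2)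
  rw [h3, hε]
  exact ⟨h1, h2⟩

end Grid

/-! ### From bounded noise to valid error bounds -/

section NoiseBounded

variable {S A : Type*} {H m : ℕ} [Fintype S] [DecidableEq S] [Fintype A] [DecidableEq A]
  {B : Finset (Fin m)}

/-- Weight `f i` for the `i`-th visit of agent `j`, and weight `0` for the other agents. -/
def singleWeight (j : {j // j ∉ B}) (f : ℕ → ℝ) (j' : {j // j ∉ B}) (i : ℕ) : ℝ :=
  if j' = j then f i else 0

/-- The noise of the good agents is bounded as in Hoeffding's inequality, for every grid value
function: for the first `n` data of an agent, for the difference between the rescaled sum of the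
first `n` and the sum of the first `c` data of an agent, and for the sum over all agents of the
first `c` data. -/
structure NoiseBounded (M : MDP S A H) (B : Finset (Fin m)) (K : ℕ) (δ : ℝ)
    (X : Transcript S A H m) : Prop where
  single : ∀ (h : Fin H) (s : S) (a : A) (v : S → Fin (H * gridSize S A H m K))
    (j : {j // j ∉ B}), ∀ n ∈ Finset.Icc 1 K,
    |weightedNoise M h s a (gridValue A m K h v)
      (singleWeight j fun i => if i < n then 1 else 0) X K| ≤
      ((H : ℝ) - h) * (√(2 * Real.log (2 * m / deltaParam S A H m K δ)) / 2) * √n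
  clipped : ∀ (h : Fin H) (s : S) (a : A) (v : S → Fin (H * gridSize S A H m K))
    (j : {j // j ∉ B}), ∀ n ∈ Finset.Icc 1 K, ∀ c ∈ Finset.Icc 1 K, c ≤ n →
    |weightedNoise M h s a (gridValue A m K h v)
      (singleWeight j fun i => if i < n then (c : ℝ) / n - (if i < c then 1 else 0) else 0) X K| ≤
      ((H : ℝ) - h) * (√(2 * Real.log (2 * m / deltaParam S A H m K δ)) / 2) * √c
  total : ∀ (h : Fin H) (s : S) (a : A) (v : S → Fin (H * gridSize S A H m K)),
    ∀ k ∈ Finset.range K, ∀ c ∈ Finset.Icc 1 K, ∀ q ∈ Finset.Icc 1 (m * K),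
    ∑ j : {j // j ∉ B}, min (count X k j h s a) c = q →
    |weightedNoise M h s a (gridValue A m K h v)
      (fun (_ : {j // j ∉ B}) i => if i < c then 1 else 0) X k| ≤
      ((H : ℝ) - h) * √(2 * Real.log (2 / deltaParam S A H m K δ)) * √q

theorem weightedNoise_singleWeight (M : MDP S A H) (h : Fin H) (s : S) (a : A) (V : S → ℝ)
    (j : {j // j ∉ B}) (f : ℕ → ℝ) (X : Transcript S A H m) (k : ℕ) :
    weightedNoise M h s a V (singleWeight j f) X k =
      ∑ t ∈ Finset.range k, f (count X t j h s a) * noise M h s a V (X.traj t j) := by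
  refine Finset.sum_congr rfl fun t _ => ?_
  rw [Finset.sum_eq_single j]
  · simp [singleWeight]
  · intro i _ hi
    simp [singleWeight, hi]
  · simp

theorem noise_eq_zero {M : MDP S A H} {h : Fin H} {s : S} {a : A} {V : S → ℝ} {τ : Traj S A H}
    (hτ : ¬ Hit h s a τ) : noise M h s a V τ = 0 := if_neg hτ

theorem count_lt_count {X : Transcript S A H m} {t k : ℕ} (htk : t < k) {j : Fin m} {h : Fin H}
    {s : S} {a : A} (hh : Hit h s a (X.traj t j)) : count X t j h s a < count X k j h s a := by
  have h1 := count_succ X t j h s a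
  have h2 : count X (t + 1) j h s a ≤ count X k j h s a := count_mono X j h s a htk
  rw [if_pos hh] at h1
  omega

/-- Cutting the weights off at the count turns the noise before episode `k` into a sum up to `K`.
The union bound for single agents thus runs over the value of the count and not also over the time.
-/
theorem weightedNoise_stopped (M : MDP S A H) (h : Fin H) (s : S) (a : A) (V : S → ℝ)
    (j : {j // j ∉ B}) (f : ℕ → ℝ) (X : Transcript S A H m) {k K : ℕ} (hk : k ≤ K) :
    weightedNoise M h s a V (singleWeight j fun i => if i < count X k j h s a then f i else 0) X K =
      ∑ t ∈ Finset.range k, f (count X t j h s a) * noise M h s a V (X.traj t j) := by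
  rw [weightedNoise_singleWeight, ← Finset.sum_subset (Finset.range_subset_range.2 hk)]
  · refine Finset.sum_congr rfl fun t ht => ?_
    by_cases hh : Hit h s a (X.traj t j)
    · rw [if_pos (count_lt_count (Finset.mem_range.1 ht) hh)]
    · rw [noise_eq_zero hh, mul_zero, mul_zero]
  · intro t _ ht
    have h1 : k ≤ t := by simpa using ht
    have h2 : count X k j h s a ≤ count X t j h s a := count_mono X j h s a h1
    rw [if_neg (not_lt.2 h2), zero_mul]

theorem count_mul_batchMean_sub (M : MDP S A H) (h : Fin H) (s : S) (a : A) (V : S → ℝ)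
    (X : Transcript S A H m) (k : ℕ) (j : Fin m) :
    (count X k j h s a : ℝ) * (batchMean X k j h s a V - M.qMean h s a V) =
      ∑ t ∈ Finset.range k, noise M h s a V (X.traj t j) := by
  have h1 : (count X k j h s a : ℝ) * batchMean X k j h s a V =
      ∑ t ∈ Finset.range k, if Hit h s a (X.traj t j) then
        (X.traj t j).2.2 h + V ((X.traj t j).1 h.succ) else 0 := by
    rcases Nat.eq_zero_or_pos (count X k j h s a) with h0 | h0
    · rw [h0, Nat.cast_zero, zero_mul, eq_comm]
      rw [count_eq_sum, Finset.sum_eq_zero_iff] at h0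
      refine Finset.sum_eq_zero fun t ht => ?_
      have := h0 t ht
      simp only [ite_eq_right_iff, one_ne_zero, imp_false] at this
      rw [if_neg this]
    · rw [batchMean_eq_sum, mul_div_cancel₀]
      exact_mod_cast h0.ne'
  rw [mul_sub, h1, count_eq_sum]
  push_cast
  rw [Finset.sum_mul, ← Finset.sum_sub_distrib]
  refine Finset.sum_congr rfl fun t _ => ?_
  rw [noise]
  split_ifs <;> simp

theorem abs_sum_noise_sub_le (M : MDP S A H) (h : Fin H) (s : S) (a : A) (V V' : S → ℝ) {ε : ℝ}
    (hV : ∀ s, V' s ≤ V s ∧ V s ≤ V' s + ε) (X : Transcript S A H m) (k : ℕ) (j : Fin m) :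
    |∑ t ∈ Finset.range k, noise M h s a V (X.traj t j)
      - ∑ t ∈ Finset.range k, noise M h s a V' (X.traj t j)| ≤ count X k j h s a * ε := by
  rw [← Finset.sum_sub_distrib, count_eq_sum]
  push_cast
  rw [Finset.sum_mul]
  refine (Finset.abs_sum_le_sum_abs _ _).trans (Finset.sum_le_sum fun t _ => ?_)
  rw [noise, noise]
  split_ifs with hh
  · have h1 : M.qMean h s a V' ≤ M.qMean h s a V := by
      rw [MDP.qMean, MDP.qMean]
      gcongr with s'
      exact (hV s').1
    have h2 : M.qMean h s a V ≤ M.qMean h s a V' + ε := by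
      have : M.qMean h s a V' + ε = ∫ r, r ∂(M.R h s a) +
          ∑ s', (M.P h s a s').toReal * (V' s' + ε) := by
        simp_rw [mul_add]
        rw [Finset.sum_add_distrib, ← Finset.sum_mul, ← ENNReal.toReal_sum
          fun s' _ => PMF.apply_ne_top _ _, pmf_sum_eq_one, MDP.qMean]
        simp
        ring
      rw [this, MDP.qMean]
      gcongr with s'
      exact (hV s').2
    have h3 := hV ((X.traj t j).1 h.succ)
    rw [one_mul, abs_le]
    constructor <;> linarith
  · simp

/-- `V` may depend on all data and messages: it is replaced by a nearby grid function, for which the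
noise is bounded uniformly, at the price of `ε` per datum. -/
theorem abs_estimate_sub_le {M : MDP S A H} {K : ℕ} {δ α : ℝ} {X : Transcript S A H m}
    (hX : NoiseBounded M B K δ X) (tie : TieBreak A m) (hm : 1 ≤ m) (hB : (B.card : ℝ) = α * m)
    (hα : α ≤ 1 / 3 * (1 - 1 / (m : ℝ))) (hD : 0 < gridSize S A H m K) {k : ℕ} (hk : k < K)
    (h : Fin H) (s : S) (a : A) (V : S → ℝ)
    (hV : ∀ s, V s ∈ Set.Icc (0 : ℝ) ((H : ℝ) - 1 - h))
    (hcut : 0 < nCut α (sentCount B X k h s a)) :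
    |(pwc tie (sentMean B X k h V s a) (sentCount B X k h s a) ((H : ℝ) - h) α
      (epsParam S A H m K) (deltaParam S A H m K δ)).1 - M.qMean h s a V| ≤
    (pwc tie (sentMean B X k h V s a) (sentCount B X k h s a) ((H : ℝ) - h) α
      (epsParam S A H m K) (deltaParam S A H m K δ)).2 := by
  obtain ⟨v, hv⟩ := exists_gridValue_near hD h V hV
  set σ : ℝ := (H : ℝ) - h with hσ
  have hσ0 : 0 ≤ σ := by have := cast_sub_one_sub_nonneg h; linarith
  set ε := epsParam S A H m K with hε
  set w := √(2 * Real.log (2 * m / deltaParam S A H m K δ)) with hw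
  set c := nCut α (sentCount B X k h s a) with hc
  set G := gridValue A m K h v with hG
  have hn : ∀ j ∉ B, sentCount B X k h s a j = count X k j h s a := fun j hj => by
    simp [sentCount, hj]
  have hx : ∀ j ∉ B, sentMean B X k h V s a j = batchMean X k j h s a V := fun j hj => by
    simp [sentMean, hj]
  have hcK : c ≤ K := nCut_le_of_good_le hm hB hα _ fun j hj => by
    rw [hn j hj]
    exact (count_le X k j h s a).trans hk.le
  have hsum : ∀ j : Fin m, |(count X k j h s a : ℝ) * (batchMean X k j h s a V - M.qMean h s a V)
      - ∑ t ∈ Finset.range k, noise M h s a G (X.traj t j)| ≤ count X k j h s a * ε := fun j => by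
    rw [count_mul_batchMean_sub]
    exact abs_sum_noise_sub_le M h s a V G hv X k j
  -- `N j` is the noise of the first `c` data at the grid function. The cut `c` may be influenced by
  -- the Byzantine reports, but it is one of the values `1, …, K` covered by `NoiseBounded`.
  refine abs_pwc_sub_le tie hm hB hα hσ0 (epsParam_nonneg S A H m K) _ _ _
    (fun j => ∑ t ∈ Finset.range k, (if count X t j h s a < c then 1 else 0) *
      noise M h s a G (X.traj t j)) hcut ?_ ?_ ?_ ?_
  · intro j hj h0
    rw [hn j hj] at h0 ⊢
    rw [hx j hj]
    have hnK : count X k j h s a ≤ K := (count_le X k j h s a).trans hk.le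
    have h1 := hX.single h s a v ⟨j, hj⟩ _ (Finset.mem_Icc.2 ⟨h0, hnK⟩)
    rw [weightedNoise_stopped M h s a G ⟨j, hj⟩ (fun _ => 1) X hk.le] at h1
    simp only [one_mul] at h1
    have h2 := hsum j
    have hnp : (0 : ℝ) < count X k j h s a := by exact_mod_cast h0
    set n : ℝ := (count X k j h s a : ℝ) with hndef
    have h3 : |n * (batchMean X k j h s a V - M.qMean h s a V)| ≤ σ * (w / 2) * √n + n * ε := by
      have := abs_add_le (n * (batchMean X k j h s a V - M.qMean h s a V)
        - ∑ t ∈ Finset.range k, noise M h s a G (X.traj t j))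
        (∑ t ∈ Finset.range k, noise M h s a G (X.traj t j))
      rw [sub_add_cancel] at this
      linarith
    rw [abs_mul, abs_of_pos hnp] at h3
    have h4 : σ * (w / 2) * √n + n * ε = n * (σ * w / 2 / √n + ε) := by
      have : n = √n * √n := (Real.mul_self_sqrt hnp.le).symm
      have hs : √n ≠ 0 := (Real.sqrt_pos.2 hnp).ne'
      rw [mul_add]
      congr 1
      nth_rewrite 2 [this]
      field_simp
    rw [h4] at h3
    exact le_of_mul_le_mul_left h3 hnp
  · intro j hj hle
    rw [hn j hj] at hle ⊢
    rw [hx j hj]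
    have e : ∑ t ∈ Finset.range k, (if count X t j h s a < c then (1 : ℝ) else 0) *
        noise M h s a G (X.traj t j) = ∑ t ∈ Finset.range k, noise M h s a G (X.traj t j) := by
      refine Finset.sum_congr rfl fun t ht => ?_
      by_cases hh : Hit h s a (X.traj t j)
      · rw [if_pos ((count_lt_count (Finset.mem_range.1 ht) hh).trans_le hle), one_mul]
      · rw [noise_eq_zero hh, mul_zero]
    rw [e]
    exact hsum j
  · intro j hj hlt
    rw [hn j hj] at hlt
    rw [hx j hj]
    have hnK : count X k j h s a ≤ K := (count_le X k j h s a).trans hk.le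
    have h1 := hX.clipped h s a v ⟨j, hj⟩ _ (Finset.mem_Icc.2 ⟨by omega, hnK⟩) c
      (Finset.mem_Icc.2 ⟨hcut, hcK⟩) hlt.le
    rw [weightedNoise_stopped M h s a G ⟨j, hj⟩
      (fun i => (c : ℝ) / count X k j h s a - (if i < c then 1 else 0)) X hk.le] at h1
    simp only [sub_mul] at h1
    rw [Finset.sum_sub_distrib, ← Finset.mul_sum] at h1
    have h2 := hsum j
    have hnp : (0 : ℝ) < count X k j h s a := by exact_mod_cast (by omega)
    have hc0 : (0 : ℝ) ≤ c := Nat.cast_nonneg _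
    set n : ℝ := (count X k j h s a : ℝ) with hndef
    set Y := ∑ t ∈ Finset.range k, noise M h s a G (X.traj t j) with hY
    set y := batchMean X k j h s a V - M.qMean h s a V with hy
    have h3 : |c * y - c / n * Y| ≤ c * ε := by
      have : c * y - c / n * Y = c / n * (n * y - Y) := by field_simp
      rw [this, abs_mul, abs_of_nonneg (by positivity)]
      calc c / n * |n * y - Y| ≤ c / n * (n * ε) := by gcongr
        _ = c * ε := by field_simp
    have h4 := abs_add_le (c * y - c / n * Y) (c / n * Y - ∑ t ∈ Finset.range k,
      (if count X t j h s a < c then (1 : ℝ) else 0) * noise M h s a G (X.traj t j))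
    rw [sub_add_sub_cancel] at h4
    refine h4.trans ((add_le_add h3 h1).trans (le_of_eq ?_))
    ring
  · have e : ∑ j ∈ Bᶜ, ∑ t ∈ Finset.range k, (if count X t j h s a < c then (1 : ℝ) else 0) *
        noise M h s a G (X.traj t j) = weightedNoise M h s a G
          (fun (_ : {j // j ∉ B}) i => if i < c then 1 else 0) X k := by
      rw [Finset.sum_comm, weightedNoise]
      refine Finset.sum_congr rfl fun t _ => ?_
      exact Finset.sum_subtype Bᶜ (fun j => by simp)
        (fun j => (if count X t j h s a < c then (1 : ℝ) else 0) * noise M h s a G (X.traj t j))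
    rw [e]
    set q := ∑ j : {j // j ∉ B}, min (count X k j h s a) c with hq
    -- The noise is controlled by the weight `q` of the good agents; the server only knows the
    -- larger total weight.
    have hqle : q ≤ ∑ j, nTilde α (sentCount B X k h s a) j := by
      have : q = ∑ j ∈ Bᶜ, nTilde α (sentCount B X k h s a) j := by
        rw [Finset.sum_subtype Bᶜ (p := fun j => j ∉ B) (fun j => by simp)]
        refine Finset.sum_congr rfl fun j _ => ?_
        rw [nTilde, hn j j.2]
      rw [this]
      exact Finset.sum_le_sum_of_subset (Finset.subset_univ _)
    have hq1 : 1 ≤ q := by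
      obtain ⟨j, hj, -, hle⟩ := exists_good_nCut_le hm hB hα (sentCount B X k h s a) ∅ (by simp)
      rw [hn j hj] at hle
      have h1 : min (count X k j h s a) c ≤ q :=
        Finset.single_le_sum (f := fun j : {j // j ∉ B} => min (count X k j h s a) c)
          (fun _ _ => Nat.zero_le _) (Finset.mem_univ ⟨j, hj⟩)
      rw [min_eq_right hle] at h1
      omega
    have hq2 : q ≤ m * K := by
      calc q ≤ ∑ j : {j // j ∉ B}, K := Finset.sum_le_sum fun j _ => (min_le_right _ _).trans hcK
        _ = Fintype.card {j // j ∉ B} * K := by simp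
        _ ≤ m * K := by
          gcongr
          exact (Fintype.card_subtype_le _).trans (by simp)
    refine (hX.total h s a v k (Finset.mem_range.2 hk) c (Finset.mem_Icc.2 ⟨hcut, hcK⟩) q
      (Finset.mem_Icc.2 ⟨hq1, hq2⟩) rfl).trans ?_
    gcongr
    exact_mod_cast hqle

end NoiseBounded

/-! ### Union bounds for the good events -/

theorem measure_iUnion_le_ofReal {Ω ι : Type*} [MeasurableSpace Ω] {μ : Measure Ω} [Fintype ι]
    (E : ι → Set Ω) {p r : ℝ} (hE : ∀ i, μ (E i) ≤ ENNReal.ofReal p)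
    (hr : Fintype.card ι * p ≤ r) : μ (⋃ i, E i) ≤ ENNReal.ofReal r := by
  calc μ (⋃ i, E i) ≤ ∑ i, μ (E i) := measure_iUnion_fintype_le μ E
    _ ≤ ∑ _i : ι, ENNReal.ofReal p := Finset.sum_le_sum fun i _ => hE i
    _ = ENNReal.ofReal (Fintype.card ι * p) := by
      rw [Finset.sum_const, nsmul_eq_mul, ENNReal.ofReal_mul (Nat.cast_nonneg _),
        ENNReal.ofReal_natCast, Finset.card_univ]
    _ ≤ ENNReal.ofReal r := ENNReal.ofReal_le_ofReal hr

theorem sum_range_sq_stopped_le (f : ℕ → ℝ) (N n : ℕ) :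
    ∑ i ∈ Finset.range N, (if i < n then f i else 0) ^ 2 ≤ ∑ i ∈ Finset.range n, f i ^ 2 := by
  have e : ∀ i, (if i < n then f i else 0) ^ 2 = if i < n then f i ^ 2 else 0 := fun i => by
    split_ifs <;> simp
  simp_rw [e]
  rw [← Finset.sum_filter]
  refine Finset.sum_le_sum_of_subset_of_nonneg (fun i hi => ?_) fun i _ _ => sq_nonneg _
  exact Finset.mem_range.2 (Finset.mem_filter.1 hi).2

theorem sum_range_indicator_lt {n c : ℕ} :
    ∑ i ∈ Finset.range n, (if i < c then (1 : ℝ) else 0) = (min n c : ℕ) := by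
  rw [← Finset.sum_filter, Finset.sum_const, nsmul_eq_mul, mul_one]
  have : (Finset.range n).filter (fun i => i < c) = Finset.range (min n c) := by
    ext i; simp
  rw [this, Finset.card_range]

/-- The sum equals `c - c² / n`, so passing from the rescaled sum of `n` data to the first `c` data
has a deviation of order `√c`, uniformly in `n`. -/
theorem sum_range_sq_clip_le {n c : ℕ} (hn : 0 < n) (hcn : c ≤ n) :
    ∑ i ∈ Finset.range n, ((c : ℝ) / n - (if i < c then (1 : ℝ) else 0)) ^ 2 ≤ (c : ℝ) := by
  have e : ∀ i : ℕ, ((c : ℝ) / n - (if i < c then (1 : ℝ) else 0)) ^ 2 =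
      ((c : ℝ) / n) ^ 2 + (1 - 2 * (c / n)) * (if i < c then 1 else 0) := fun i => by
    split_ifs <;> ring
  simp_rw [e]
  rw [Finset.sum_add_distrib, ← Finset.mul_sum, sum_range_indicator_lt, min_eq_right hcn,
    Finset.sum_const, Finset.card_range, nsmul_eq_mul]
  have hn' : (0 : ℝ) < n := by exact_mod_cast hn
  have : (n : ℝ) * (c / n) ^ 2 + (1 - 2 * (c / n)) * c = c - c ^ 2 / n := by field_simp; ring
  rw [this]
  have : (0 : ℝ) ≤ c ^ 2 / n := by positivity
  linarith

theorem two_mul_exp_neg_sqrt_log {x : ℝ} (hx : 1 ≤ x) :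
    2 * Real.exp (-(2 * (√(2 * Real.log x) / 2) ^ 2)) = 2 / x := by
  have h0 : 0 ≤ 2 * Real.log x := by have := Real.log_nonneg hx; linarith
  rw [div_pow, Real.sq_sqrt h0, show -(2 * (2 * Real.log x / 2 ^ 2)) = -Real.log x by ring,
    Real.exp_neg, Real.exp_log (by linarith)]
  rfl

theorem two_mul_exp_neg_sqrt_log_pow {x : ℝ} (hx : 1 ≤ x) :
    2 * Real.exp (-(2 * √(2 * Real.log x) ^ 2)) = 2 / x ^ 4 := by
  have h0 : 0 ≤ 2 * Real.log x := by have := Real.log_nonneg hx; linarith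
  rw [Real.sq_sqrt h0, show -(2 * (2 * Real.log x)) = -((4 : ℕ) * Real.log x) by push_cast; ring,
    ← Real.log_pow, Real.exp_neg, Real.exp_log (by positivity)]
  rfl

section Parameters

variable {S A : Type*} [Fintype S] [Fintype A] {H m K : ℕ} {δ : ℝ}

/-- The parameters are not degenerate. -/
structure Regular (S A : Type*) [Fintype S] [Fintype A] (H m K : ℕ) (δ : ℝ) : Prop where
  card_S : 1 ≤ Fintype.card S
  card_A : 2 ≤ Fintype.card A
  H_pos : 1 ≤ H
  m_pos : 1 ≤ m
  K_pos : 1 ≤ K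
  δ_pos : 0 < δ
  δ_lt : δ < 1 / 4

theorem Regular.gridSize_pos (hR : Regular S A H m K δ) : 1 ≤ gridSize S A H m K := by
  have h1 := hR.card_S
  have h2 : 1 ≤ Fintype.card A := le_trans (by norm_num) hR.card_A
  have h3 := hR.H_pos
  have h4 := hR.m_pos
  have h5 := hR.K_pos
  exact Nat.succ_le_of_lt (by unfold gridSize; positivity)

theorem Regular.deltaParam_eq (S A : Type*) [Fintype S] [Fintype A] (H m K : ℕ) (δ : ℝ) :
    deltaParam S A H m K δ = δ / (gridSize S A H m K : ℝ) ^ (3 * Fintype.card S) := by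
  rw [deltaParam, sahkm_eq_gridSize]

theorem Regular.deltaParam_pos (hR : Regular S A H m K δ) : 0 < deltaParam S A H m K δ := by
  rw [Regular.deltaParam_eq]
  have : (0 : ℝ) < gridSize S A H m K := by exact_mod_cast hR.gridSize_pos
  have := hR.δ_pos
  positivity

theorem Regular.deltaParam_le (hR : Regular S A H m K δ) : deltaParam S A H m K δ ≤ δ := by
  rw [Regular.deltaParam_eq]
  have : (1 : ℝ) ≤ gridSize S A H m K := by exact_mod_cast hR.gridSize_pos
  exact div_le_self hR.δ_pos.le (one_le_pow₀ this)

/-- The left side counts triples `(h, s, a)`, grid functions and, by `K + K² ≤ 2 K²`, the thresholds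
`n` and `(n, c)`. Agents are not counted, since an event for one agent has probability at most `δ' /
m`. Two actions absorb the factor `2`. -/
theorem Regular.card_le_gridSize_pow (hR : Regular S A H m K δ) :
    Fintype.card S * Fintype.card A * H * (H * gridSize S A H m K) ^ Fintype.card S * (2 * K ^ 2)
      ≤ gridSize S A H m K ^ (3 * Fintype.card S) := by
  have h1 := hR.card_S
  have h2 := hR.card_A
  have h3 := hR.H_pos
  have h4 := hR.m_pos
  have h5 := hR.K_pos
  set s := Fintype.card S with hs
  set a := Fintype.card A with ha
  set D := gridSize S A H m K with hD
  set y := s * a * H * (2 * K ^ 2) with hy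
  have hy1 : 1 ≤ y := Nat.succ_le_of_lt (by positivity)
  have hD2 : H * y ≤ D ^ 2 := by
    have e : D ^ 2 = H * (s * a * H * K ^ 2) * (s * a * m ^ 2) := by
      rw [hD, gridSize]; ring
    have e' : H * y = H * (s * a * H * K ^ 2) * 2 := by rw [hy]; ring
    rw [e, e']
    refine Nat.mul_le_mul_left _ ?_
    calc 2 = 1 * 2 * 1 ^ 2 := by norm_num
      _ ≤ s * a * m ^ 2 := by gcongr
  calc s * a * H * (H * D) ^ s * (2 * K ^ 2) = y * (H * D) ^ s := by rw [hy]; ring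
    _ ≤ y ^ s * (H * D) ^ s := by
        gcongr
        exact Nat.le_self_pow (by omega) y
    _ = (H * y) ^ s * D ^ s := by rw [mul_pow, mul_pow]; ring
    _ ≤ (D ^ 2) ^ s * D ^ s := by gcongr
    _ = D ^ (3 * s) := by rw [← pow_mul, ← pow_add]; congr 1; ring

theorem card_good_le (B : Finset (Fin m)) : Fintype.card {j // j ∉ B} ≤ m :=
  (Fintype.card_subtype_le _).trans (by simp)

theorem Regular.one_le_two_mul_div (hR : Regular S A H m K δ) :
    1 ≤ 2 * (m : ℝ) / deltaParam S A H m K δ := by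
  rw [le_div_iff₀ hR.deltaParam_pos]
  have h1 := hR.deltaParam_le
  have h2 := hR.δ_lt
  have h3 : (1 : ℝ) ≤ m := by exact_mod_cast hR.m_pos
  linarith

theorem Regular.one_le_two_div (hR : Regular S A H m K δ) :
    1 ≤ 2 / deltaParam S A H m K δ := by
  rw [le_div_iff₀ hR.deltaParam_pos]
  have h1 := hR.deltaParam_le
  have h2 := hR.δ_lt
  linarith

end Parameters

section Probability

variable {S A : Type*} {H m : ℕ} [Fintype S] [DecidableEq S] [MeasurableSpace S]
  [DiscreteMeasurableSpace S] [Fintype A] [DecidableEq A] [MeasurableSpace A]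
  [DiscreteMeasurableSpace A]
  {Ω : Type*} {mΩ : MeasurableSpace Ω} {μ : Measure Ω} {ℱ : Filtration ℕ mΩ} {M : MDP S A H}
  {tie : TieBreak A m} {B : Finset (Fin m)} {K : ℕ} {δ α : ℝ} {X : Ω → Transcript S A H m}

theorem one_add_eq (h : Fin H) : (H : ℝ) - h = 1 + ((H : ℝ) - 1 - h) := by ring

theorem IsByzantineRun.measure_single_le [IsProbabilityMeasure μ]
    (hX : IsByzantineRun μ ℱ M tie B K δ α X) (hR : Regular S A H m K δ) (h : Fin H) (s : S) (a : A)
    (v : S → Fin (H * gridSize S A H m K)) (j : {j // j ∉ B}) (f : ℕ → ℝ) {q : ℕ} (hq : 0 < q)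
    (hf : ∀ N, ∑ i ∈ Finset.range N, f i ^ 2 ≤ q) :
    μ {ω | ((H : ℝ) - h) * (√(2 * Real.log (2 * m / deltaParam S A H m K δ)) / 2) * √q <
      |weightedNoise M h s a (gridValue A m K h v) (singleWeight j f) (X ω) K|} ≤
    ENNReal.ofReal (deltaParam S A H m K δ / m) := by
  have h1 := hX.measure_lt_abs_weightedNoise_le h s a (gridValue A m K h v)
    (gridValue_mem_Icc K h v) (singleWeight j f) le_rfl (q := q) (by exact_mod_cast hq)
    (y := √(2 * Real.log (2 * m / deltaParam S A H m K δ)) / 2) (by positivity)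
  -- For `x = 2 m / δ'` the tail `2 exp (-2 y²)` equals `2 / x = δ' / m`.
  rw [two_mul_exp_neg_sqrt_log hR.one_le_two_mul_div, ← one_add_eq] at h1
  refine le_trans (measure_mono fun ω hω => ?_) (h1.trans (le_of_eq ?_))
  · refine ⟨?_, hω⟩
    rw [Finset.sum_eq_single j]
    · simpa [singleWeight] using hf _
    · intro i _ hi
      simp [singleWeight, hi]
    · simp
  · congr 1
    field_simp

/-- The absence of the factor `1/2` of the single-agent bounds makes the tail of order `δ'⁴`. The
bound `δ'²` pays for the larger union, which also runs over `k`, `c` and `q`. -/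
theorem IsByzantineRun.measure_total_le [IsProbabilityMeasure μ]
    (hX : IsByzantineRun μ ℱ M tie B K δ α X) (hR : Regular S A H m K δ) (h : Fin H) (s : S) (a : A)
    (v : S → Fin (H * gridSize S A H m K)) {k : ℕ} (hk : k ≤ K) (c : ℕ) {q : ℕ} (hq : 0 < q) :
    μ {ω | ∑ j : {j // j ∉ B}, min (count (X ω) k j h s a) c = q ∧
      ((H : ℝ) - h) * √(2 * Real.log (2 / deltaParam S A H m K δ)) * √q <
      |weightedNoise M h s a (gridValue A m K h v)
        (fun (_ : {j // j ∉ B}) i => if i < c then 1 else 0) (X ω) k|} ≤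
    ENNReal.ofReal (deltaParam S A H m K δ ^ 2) := by
  have h1 := hX.measure_lt_abs_weightedNoise_le h s a (gridValue A m K h v)
    (gridValue_mem_Icc K h v) (fun (_ : {j // j ∉ B}) i => if i < c then 1 else 0) hk (q := q)
    (by exact_mod_cast hq) (y := √(2 * Real.log (2 / deltaParam S A H m K δ))) (by positivity)
  rw [two_mul_exp_neg_sqrt_log_pow hR.one_le_two_div, ← one_add_eq] at h1
  refine le_trans (measure_mono fun ω hω => ?_) (h1.trans (ENNReal.ofReal_le_ofReal ?_))
  · refine ⟨?_, hω.2⟩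
    have e : ∀ i : ℕ, (if i < c then (1 : ℝ) else 0) ^ 2 = if i < c then 1 else 0 := fun i => by
      split_ifs <;> simp
    simp_rw [e, sum_range_indicator_lt]
    exact_mod_cast hω.1.le
  · have h2 := hR.deltaParam_pos
    have h3 := hR.deltaParam_le
    have h4 := hR.δ_lt
    set d := deltaParam S A H m K δ
    have e : 2 / (2 / d) ^ 4 = d ^ 2 * d ^ 2 / 8 := by field_simp; norm_num
    rw [e]
    have h5 : d ^ 2 ≤ 1 := by nlinarith
    nlinarith [sq_nonneg d]

theorem IsByzantineRun.measure_not_noiseBounded_le [IsProbabilityMeasure μ]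
    (hX : IsByzantineRun μ ℱ M tie B K δ α X) (hR : Regular S A H m K δ) :
    μ {ω | ¬ NoiseBounded M B K δ (X ω)} ≤ ENNReal.ofReal (2 * δ) := by
  have hd0 := hR.deltaParam_pos
  have hmR : (0 : ℝ) < m := by exact_mod_cast hR.m_pos
  have hD1 := hR.gridSize_pos
  have hDR : (1 : ℝ) ≤ gridSize S A H m K := by exact_mod_cast hD1
  set D := gridSize S A H m K with hD
  set d := deltaParam S A H m K δ with hd
  have hdeq : d = δ / (D : ℝ) ^ (3 * Fintype.card S) := Regular.deltaParam_eq S A H m K δ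
  let I := Fin H × S × A × (S → Fin (H * D)) × {j // j ∉ B} ×
    (Finset.Icc 1 K ⊕ (Finset.Icc 1 K × Finset.Icc 1 K))
  let E : I → Set Ω := fun i => match i with
    | (h, s, a, v, j, Sum.inl n) =>
      {ω | ((H : ℝ) - h) * (√(2 * Real.log (2 * m / d)) / 2) * √(n : ℕ) <
        |weightedNoise M h s a (gridValue A m K h v)
          (singleWeight j fun i => if i < n then 1 else 0) (X ω) K|}
    | (h, s, a, v, j, Sum.inr (n, c)) =>
      {ω | (c : ℕ) ≤ n ∧ ((H : ℝ) - h) * (√(2 * Real.log (2 * m / d)) / 2) * √(c : ℕ) <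
        |weightedNoise M h s a (gridValue A m K h v) (singleWeight j fun i => if i < (n : ℕ) then
          ((c : ℕ) : ℝ) / (n : ℕ) - (if i < (c : ℕ) then 1 else 0) else 0) (X ω) K|}
  let J := Fin H × S × A × (S → Fin (H * D)) × Fin K × Finset.Icc 1 K × Finset.Icc 1 (m * K)
  let F : J → Set Ω := fun i => match i with
    | (h, s, a, v, k, c, q) =>
      {ω | ∑ j : {j // j ∉ B}, min (count (X ω) k j h s a) c = q ∧
        ((H : ℝ) - h) * √(2 * Real.log (2 / d)) * √(q : ℕ) <
        |weightedNoise M h s a (gridValue A m K h v)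
          (fun (_ : {j // j ∉ B}) i => if i < (c : ℕ) then 1 else 0) (X ω) k|}
  have hE : ∀ i, μ (E i) ≤ ENNReal.ofReal (d / m) := by
    rintro ⟨h, s, a, v, j, n | ⟨n, c⟩⟩
    · have hn := Finset.mem_Icc.1 n.2
      refine hX.measure_single_le hR h s a v j _ (by omega) fun N => ?_
      refine (sum_range_sq_stopped_le (fun _ => 1) N n).trans (by simp)
    · have hn := Finset.mem_Icc.1 n.2
      have hc := Finset.mem_Icc.1 c.2
      by_cases hcn : (c : ℕ) ≤ n
      · refine le_trans (measure_mono fun ω hω => hω.2)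
          (hX.measure_single_le hR h s a v j _ (by omega) fun N => ?_)
        exact (sum_range_sq_stopped_le _ N n).trans (sum_range_sq_clip_le (by omega) hcn)
      · exact (measure_mono fun ω hω => absurd hω.1 hcn).trans (measure_empty.trans_le zero_le)
  have hF : ∀ i, μ (F i) ≤ ENNReal.ofReal (d ^ 2) := by
    rintro ⟨h, s, a, v, k, c, q⟩
    have hq := Finset.mem_Icc.1 q.2
    exact hX.measure_total_le hR h s a v k.2.le c (by omega)
  have hcardI : Fintype.card I * (d / m) ≤ δ := by
    have h1 : Fintype.card I ≤ m * (Fintype.card S * Fintype.card A * H *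
        (H * D) ^ Fintype.card S * (2 * K ^ 2)) := by
      have hg := card_good_le B
      have hK := hR.K_pos
      simp only [I, Fintype.card_prod, Fintype.card_sum, Fintype.card_fin, Fintype.card_fun,
        Fintype.card_coe, Nat.card_Icc, Nat.add_sub_cancel]
      calc H * (Fintype.card S * (Fintype.card A * ((H * D) ^ Fintype.card S *
            (Fintype.card {j // j ∉ B} * (K + K * K)))))
          ≤ H * (Fintype.card S * (Fintype.card A * ((H * D) ^ Fintype.card S *
            (m * (K * K + K * K))))) := by
            gcongr
            exact Nat.le_mul_of_pos_left K (by omega)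
        _ = _ := by ring
    have h2 := h1.trans (Nat.mul_le_mul_left m hR.card_le_gridSize_pow)
    have h3 : (Fintype.card I : ℝ) ≤ m * (D : ℝ) ^ (3 * Fintype.card S) := by exact_mod_cast h2
    calc Fintype.card I * (d / m) ≤ m * (D : ℝ) ^ (3 * Fintype.card S) * (d / m) := by gcongr
      _ = δ := by rw [hdeq]; field_simp
  have hcardJ : Fintype.card J * d ^ 2 ≤ δ := by
    have hS := hR.card_S
    have hA := hR.card_A
    have hH := hR.H_pos
    have hK := hR.K_pos
    have hm := hR.m_pos
    have h1 : Fintype.card J ≤ D ^ (6 * Fintype.card S) := by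
      simp only [J, Fintype.card_prod, Fintype.card_fin, Fintype.card_fun,
        Fintype.card_coe, Nat.card_Icc, Nat.add_sub_cancel]
      have b1 : H ≤ D := by
        rw [hD, gridSize]
        calc H = 1 * 1 * H * 1 * 1 := by ring
          _ ≤ Fintype.card S * Fintype.card A * H * K * m := by gcongr; omega
      have b2 : K ≤ D := by
        rw [hD, gridSize]
        calc K = 1 * 1 * 1 * K * 1 := by ring
          _ ≤ Fintype.card S * Fintype.card A * H * K * m := by gcongr; omega
      calc H * (Fintype.card S * (Fintype.card A * ((H * D) ^ Fintype.card S *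
            (K * (K * (m * K)))))) = D * ((H * D) ^ Fintype.card S) * K * K := by
            rw [hD, gridSize]; ring
        _ ≤ D * ((D * D) ^ Fintype.card S) * D * D := by gcongr
        _ = D ^ (2 * Fintype.card S + 3) := by rw [← pow_two, ← pow_mul]; ring
        _ ≤ D ^ (6 * Fintype.card S) := Nat.pow_le_pow_right hD1 (by omega)
    have h2 : (Fintype.card J : ℝ) ≤ (D : ℝ) ^ (6 * Fintype.card S) := by exact_mod_cast h1
    have h3 := hR.δ_pos
    have h4 := hR.δ_lt
    calc Fintype.card J * d ^ 2 ≤ (D : ℝ) ^ (6 * Fintype.card S) * d ^ 2 := by gcongr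
      _ = δ ^ 2 := by
        rw [hdeq, div_pow, ← pow_mul, show 3 * Fintype.card S * 2 = 6 * Fintype.card S by ring]
        field_simp
      _ ≤ δ := by nlinarith
  have h1 := measure_iUnion_le_ofReal E hE hcardI
  have h2 := measure_iUnion_le_ofReal F hF hcardJ
  rw [two_mul, ENNReal.ofReal_add hR.δ_pos.le hR.δ_pos.le]
  refine le_trans (measure_mono fun ω hω => ?_) ((measure_union_le _ _).trans (add_le_add h1 h2))
  by_contra hcon
  rw [Set.mem_union, not_or, Set.mem_iUnion, Set.mem_iUnion, not_exists, not_exists] at hcon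
  refine hω ⟨fun h s a v j n hn => not_lt.1 (hcon.1 (h, s, a, v, j, Sum.inl ⟨n, hn⟩)),
    fun h s a v j n hn c hc hcn => not_lt.1 fun hlt =>
      hcon.1 (h, s, a, v, j, Sum.inr (⟨n, hn⟩, ⟨c, hc⟩)) ⟨hcn, hlt⟩,
    fun h s a v k hk c hc q hq he => not_lt.1 fun hlt =>
      hcon.2 (h, s, a, v, ⟨k, Finset.mem_range.1 hk⟩, ⟨c, hc⟩, ⟨q, hq⟩) ⟨he, hlt⟩⟩

/-- The counts of all good agents are comparable to their expectation given the policies. -/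
def CountBounded (M : MDP S A H) (tie : TieBreak A m) (B : Finset (Fin m)) (K : ℕ) (δ α : ℝ)
    (X : Transcript S A H m) : Prop :=
  ∀ k < K, ∀ j ∉ B, ∀ h s a,
    (count X k j h s a : ℝ) ≤
        2 * expectedCount M tie B K δ α X k h s a + Real.log (2 * gridSize S A H m K / δ) ∧
      expectedCount M tie B K δ α X k h s a / 2 - Real.log (2 * gridSize S A H m K / δ) ≤
        count X k j h s a

theorem expectedCount_nonneg (X : Transcript S A H m) (k : ℕ) (h : Fin H) (s : S) (a : A) :
    0 ≤ expectedCount M tie B K δ α X k h s a :=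
  Finset.sum_nonneg fun _ _ => occupancy_nonneg _ _ _ _ _

theorem IsByzantineRun.measure_not_countBounded_le [IsProbabilityMeasure μ]
    (hX : IsByzantineRun μ ℱ M tie B K δ α X) (hR : Regular S A H m K δ) :
    μ {ω | ¬ CountBounded M tie B K δ α (X ω)} ≤ ENNReal.ofReal δ := by
  have hD1 := hR.gridSize_pos
  have hDR : (0 : ℝ) < gridSize S A H m K := by exact_mod_cast hD1
  have hδ := hR.δ_pos
  set D := gridSize S A H m K with hD
  let I := Fin K × {j // j ∉ B} × Fin H × S × A × Bool
  let E : I → Set Ω := fun i => match i with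
    | (k, j, h, s, a, b) => {ω | Real.log (2 * D / δ) ≤ (if b then 1 else -1) *
        count (X ω) k j h s a - (Real.exp (if b then 1 else -1) - 1) *
        expectedCount M tie B K δ α (X ω) k h s a}
  have hE : ∀ i, μ (E i) ≤ ENNReal.ofReal (δ / (2 * D)) := by
    rintro ⟨k, j, h, s, a, b⟩
    refine (hX.measure_le_count_le h s a j.2 k.2.le _ _).trans (le_of_eq ?_)
    rw [Real.exp_neg, Real.exp_log (by positivity), inv_div]
  have hcard : Fintype.card I * (δ / (2 * D)) ≤ δ := by
    have h1 : Fintype.card I ≤ 2 * D := by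
      have hg := card_good_le B
      simp only [I, Fintype.card_prod, Fintype.card_fin, Fintype.card_bool]
      calc K * (Fintype.card {j // j ∉ B} * (H * (Fintype.card S * (Fintype.card A * 2))))
          ≤ K * (m * (H * (Fintype.card S * (Fintype.card A * 2)))) := by gcongr
        _ = 2 * D := by rw [hD, gridSize]; ring
    have h2 : (Fintype.card I : ℝ) ≤ 2 * D := by exact_mod_cast h1
    calc Fintype.card I * (δ / (2 * D)) ≤ 2 * D * (δ / (2 * D)) := by gcongr
      _ = δ := by field_simp
  refine le_trans (measure_mono fun ω hω => ?_)
    (measure_iUnion_le_ofReal E hE hcard)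
  by_contra hcon
  rw [Set.mem_iUnion, not_exists] at hcon
  refine hω fun k hk j hj h s a => ?_
  have h1 : Real.log (2 * D / δ) > 1 * (count (X ω) k j h s a : ℝ) -
      (Real.exp 1 - 1) * expectedCount M tie B K δ α (X ω) k h s a :=
    not_le.1 fun hle => hcon (⟨k, hk⟩, ⟨j, hj⟩, h, s, a, true) (by
      simp only [E, Set.mem_ofPred_eq, if_true]; exact hle)
  have h2 : Real.log (2 * D / δ) > -1 * (count (X ω) k j h s a : ℝ) -
      (Real.exp (-1) - 1) * expectedCount M tie B K δ α (X ω) k h s a :=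
    not_le.1 fun hle => hcon (⟨k, hk⟩, ⟨j, hj⟩, h, s, a, false) (by
      simp only [E, Set.mem_ofPred_eq, Bool.false_eq_true, if_false]; exact hle)
  have h0 : 0 ≤ expectedCount M tie B K δ α (X ω) k h s a := expectedCount_nonneg _ _ _ _ _
  -- `exp 1 - 1 ≤ 2` and `1 - exp (-1) ≥ 1/2` are the two factors in `CountBounded`.
  have e1 : Real.exp 1 ≤ 3 := by have := Real.exp_one_lt_d9; linarith
  have e2 : Real.exp (-1) ≤ 1 / 2 := by
    rw [Real.exp_neg, one_div]
    have := Real.exp_one_gt_d9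
    exact inv_anti₀ (by norm_num) (by linarith)
  constructor
  · nlinarith
  · nlinarith

end Probability

/-! ### Optimism of the value estimates -/

section Optimism

variable {S A : Type*} {H m : ℕ} [Fintype S] [DecidableEq S] [Fintype A] [DecidableEq A]
  {M : MDP S A H} {tie : TieBreak A m} {B : Finset (Fin m)} {K : ℕ} {δ α : ℝ}
  {X : Transcript S A H m}

/-- The error bound `Γ_h(s, a)` computed in a synchronization at the start of episode `k`. -/
noncomputable def bonus (tie : TieBreak A m) (B : Finset (Fin m)) (K : ℕ) (δ α : ℝ)
    (X : Transcript S A H m) (k : ℕ) (h : Fin H) (s : S) (a : A) : ℝ :=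
  (pwc tie (sentMean B X k h (vHat tie B K δ α X k h.succ) s a) (sentCount B X k h s a)
    ((H : ℝ) - h) α (epsParam S A H m K) (deltaParam S A H m K δ)).2

theorem cast_sub_nonneg (h : Fin H) : (0 : ℝ) ≤ (H : ℝ) - h := by
  have := cast_sub_one_sub_nonneg h
  linarith

theorem qHat_mem_Icc (k : ℕ) (h : Fin H) (V : S → ℝ) (s : S) (a : A) :
    qHat tie B K δ α X k h V s a ∈ Set.Icc (0 : ℝ) ((H : ℝ) - h) :=
  ⟨le_max_right _ _, max_le (min_le_right _ _) (cast_sub_nonneg h)⟩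

theorem qHat_le_vHat (k : ℕ) (h : Fin H) (s : S) (a : A) :
    qHat tie B K δ α X k h (vHat tie B K δ α X k h.succ) s a ≤ vHat tie B K δ α X k h.castSucc s := by
  rw [vHat_castSucc]
  exact le_ciSup (f := fun a => qHat tie B K δ α X k h (vHat tie B K δ α X k h.succ) s a)
    (Set.finite_range _).bddAbove a

theorem vHat_mem_Icc [Nonempty A] (k : ℕ) (i : Fin (H + 1)) (s : S) :
    vHat tie B K δ α X k i s ∈ Set.Icc (0 : ℝ) ((H : ℝ) - i) := by
  induction i using Fin.lastCases with
  | last => simp [vHat_last]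
  | cast h =>
    refine ⟨(qHat_mem_Icc k h _ s (Classical.arbitrary A)).1.trans
      (qHat_le_vHat k h s (Classical.arbitrary A)), ?_⟩
    rw [vHat_castSucc]
    exact ciSup_le fun a => (qHat_mem_Icc k h _ s a).2

theorem vHat_succ_mem_Icc [Nonempty A] (k : ℕ) (h : Fin H) (s : S) :
    vHat tie B K δ α X k h.succ s ∈ Set.Icc (0 : ℝ) ((H : ℝ) - 1 - h) := by
  have := vHat_mem_Icc (tie := tie) (B := B) (K := K) (δ := δ) (α := α) (X := X) k h.succ s
  rw [Fin.val_succ] at this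
  push_cast at this
  rwa [show (H : ℝ) - 1 - h = H - (h + 1) by ring]

theorem vHat_eq_qHat_greedy [Nonempty A] (k : ℕ) (h : Fin H) (s : S) :
    vHat tie B K δ α X k h.castSucc s = qHat tie B K δ α X k h (vHat tie B K δ α X k h.succ) s
      (greedy tie B K δ α X k h s) := by
  classical
  refine le_antisymm ?_ (qHat_le_vHat k h s _)
  rw [vHat_castSucc]
  obtain ⟨a₀, ha₀⟩ := Finite.exists_max
    fun a => qHat tie B K δ α X k h (vHat tie B K δ α X k h.succ) s a
  have hmem := tie.action_mem (Finset.univ.filter fun a => ∀ a',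
    qHat tie B K δ α X k h (vHat tie B K δ α X k h.succ) s a' ≤
      qHat tie B K δ α X k h (vHat tie B K δ α X k h.succ) s a)
    ⟨a₀, Finset.mem_filter.2 ⟨Finset.mem_univ _, ha₀⟩⟩
  refine ciSup_le fun a => ?_
  have := (Finset.mem_filter.1 hmem).2 a
  unfold greedy
  convert this

end Optimism

section Episode

variable {S A : Type*} {H m : ℕ} [Fintype S] [DecidableEq S] [MeasurableSpace S]
  [DiscreteMeasurableSpace S] [Fintype A] [DecidableEq A] [MeasurableSpace A]
  [DiscreteMeasurableSpace A] [Nonempty A]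
  {M : MDP S A H} {tie : TieBreak A m} {B : Finset (Fin m)} {K : ℕ} {δ α : ℝ}
  {X : Transcript S A H m}

/-- Truncation is harmless because the backup of the next `V̂` lies in `[0, H - h]` itself. The
error bound counts twice, once for the estimate and once for the added bonus. -/
theorem qMean_le_qHat_le (hX : NoiseBounded M B K δ X) (hm : 1 ≤ m) (hB : (B.card : ℝ) = α * m)
    (hα : α ≤ 1 / 3 * (1 - 1 / (m : ℝ))) (hD : 0 < gridSize S A H m K) {k : ℕ} (hk : k < K)
    (h : Fin H) (s : S) (a : A) :
    M.qMean h s a (vHat tie B K δ α X k h.succ) ≤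
        qHat tie B K δ α X k h (vHat tie B K δ α X k h.succ) s a ∧
      qHat tie B K δ α X k h (vHat tie B K δ α X k h.succ) s a
        - M.qMean h s a (vHat tie B K δ α X k h.succ) ≤
        min (2 * bonus tie B K δ α X k h s a) ((H : ℝ) - h) := by
  have hV : ∀ s, vHat tie B K δ α X k h.succ s ∈ Set.Icc (0 : ℝ) ((H : ℝ) - 1 - h) :=
    vHat_succ_mem_Icc k h
  have hq := qMean_mem_Icc M h s a _ hV
  rw [← one_add_eq] at hq
  have hQ := qHat_mem_Icc (tie := tie) (B := B) (K := K) (δ := δ) (α := α) (X := X) k h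
    (vHat tie B K δ α X k h.succ) s a
  have hσ := cast_sub_nonneg h
  by_cases hcut : 0 < nCut α (sentCount B X k h s a)
  · have he := abs_le.1 (abs_estimate_sub_le hX tie hm hB hα hD hk h s a _ hV hcut)
    have hb : bonus tie B K δ α X k h s a = (pwc tie (sentMean B X k h
      (vHat tie B K δ α X k h.succ) s a) (sentCount B X k h s a) ((H : ℝ) - h) α
      (epsParam S A H m K) (deltaParam S A H m K δ)).2 := rfl
    constructor
    · refine le_max_of_le_left (le_min ?_ hq.2)
      linarith [he.1]
    · refine le_min ?_ (by linarith [hQ.2, hq.1])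
      rw [sub_le_iff_le_add, hb]
      refine max_le ((min_le_left _ _).trans ?_) ?_
      · linarith [he.2]
      · linarith [he.1, he.2, hq.1]
  -- If `n^cut = 0`, the estimate `0` with error `σ` makes `Q̂ = σ`, the largest possible value, so
  -- optimism is automatic.
  · have hb : bonus tie B K δ α X k h s a = (H : ℝ) - h := by
      rw [bonus, pwc, if_neg hcut]
    have hqe : qHat tie B K δ α X k h (vHat tie B K δ α X k h.succ) s a = (H : ℝ) - h := by
      rw [qHat, pwc, if_neg hcut]
      simp [hσ]
    rw [hqe, hb]
    refine ⟨hq.2, le_min ?_ ?_⟩ <;> linarith [hq.1]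

theorem optValue_sub_value_greedy_le (hX : NoiseBounded M B K δ X) (hm : 1 ≤ m)
    (hB : (B.card : ℝ) = α * m) (hα : α ≤ 1 / 3 * (1 - 1 / (m : ℝ)))
    (hD : 0 < gridSize S A H m K) {k : ℕ} (hk : k < K) :
    optValue M - value M (greedy tie B K δ α X k) ≤
      ∑ h, ∑ s, ∑ a, occupancy M (greedy tie B K δ α X k) h s a *
        min (2 * bonus tie B K δ α X k h s a) ((H : ℝ) - h) := by
  have hV : ∀ i s, vHat tie B K δ α X k i s ∈ Set.Icc (0 : ℝ) H := fun i s => by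
    have := vHat_mem_Icc (tie := tie) (B := B) (K := K) (δ := δ) (α := α) (X := X) k i s
    have h0 : (0 : ℝ) ≤ (i : ℕ) := Nat.cast_nonneg _
    exact ⟨this.1, by linarith [this.2]⟩
  have hlast := vHat_last tie B K δ α X k
  have hopt : optValue M ≤ vHat tie B K δ α X k 0 M.s₁ :=
    ciSup_le fun π => value_le_of_optimistic M π _ hV hlast fun h s a =>
      (qMean_le_qHat_le hX hm hB hα hD hk h s a).1.trans (qHat_le_vHat k h s a)
  have := sub_value_le_sum_occupancy M (greedy tie B K δ α X k) _ hV hlast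
    (fun h s a => min (2 * bonus tie B K δ α X k h s a) ((H : ℝ) - h)) fun h s => by
      rw [vHat_eq_qHat_greedy]
      exact (qMean_le_qHat_le hX hm hB hα hD hk h s _).2
  linarith

end Episode

/-! ### Synchronizations and the request cap -/

section Sync

variable {S A : Type*} {H m : ℕ} [Fintype S] [DecidableEq S] [Fintype A] [DecidableEq A]
  {tie : TieBreak A m} {B : Finset (Fin m)} {K : ℕ} {δ α : ℝ} {X : Transcript S A H m}

theorem size_lt_size_of_two_mul_le {a b : ℕ} (hb : 0 < b) (hab : 2 * a ≤ b) :
    a.size < b.size := by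
  rw [Nat.lt_size]
  rcases Nat.eq_zero_or_pos a with rfl | ha
  · simp only [Nat.size_zero, pow_zero]
    omega
  · obtain ⟨t, ht⟩ := Nat.exists_eq_succ_of_ne_zero (Nat.size_pos.2 ha).ne'
    have : 2 ^ t ≤ a := Nat.lt_size.1 (by omega)
    rw [ht, pow_succ]
    omega

/-- For `n > 0`, `2 ^ n.size ≤ 2 n`, and `log (2 n) = log K + log (2 n / K)` is linearized. The
linear term can be summed over `(s, a)` because the counts at a step add up to the number of
episodes. -/
theorem size_mul_log_two_le {n K : ℕ} (hK : 3 ≤ K) :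
    (n.size : ℝ) * Real.log 2 ≤ Real.log K + (2 * n / K - 1) := by
  have hKR : (3 : ℝ) ≤ K := by exact_mod_cast hK
  rcases Nat.eq_zero_or_pos n with rfl | hn
  · have : 1 ≤ Real.log K := by
      rw [Real.le_log_iff_exp_le (by linarith)]
      have := Real.exp_one_lt_d9
      linarith
    simpa using this
  · obtain ⟨t, ht⟩ := Nat.exists_eq_succ_of_ne_zero (Nat.size_pos.2 hn).ne'
    have h1 : 2 ^ (t + 1) ≤ 2 * n := by
      have : 2 ^ t ≤ n := Nat.lt_size.1 (by omega)
      rw [pow_succ]; omega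
    have h1' : (2 : ℝ) ^ (t + 1) ≤ 2 * n := by exact_mod_cast h1
    have hnR : (0 : ℝ) < n := by exact_mod_cast hn
    have h2 := Real.log_le_log (by positivity) h1'
    rw [Real.log_pow] at h2
    have h3 : Real.log (2 * n) = Real.log K + Real.log (2 * n / K) := by
      rw [← Real.log_mul (by linarith) (by positivity)]
      congr 1
      field_simp
    have h4 := Real.log_le_sub_one_of_pos (show (0 : ℝ) < 2 * n / K by positivity)
    rw [ht]
    linarith

theorem sum_count_eq (X : Transcript S A H m) (k : ℕ) (j : Fin m) (h : Fin H) :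
    ∑ s, ∑ a, count X k j h s a = k := by
  simp_rw [count_eq_sum]
  have e : ∀ s : S, ∑ a : A, ∑ t ∈ Finset.range k, (if Hit h s a (X.traj t j) then 1 else 0) =
      ∑ t ∈ Finset.range k, ∑ a : A, if Hit h s a (X.traj t j) then 1 else 0 :=
    fun s => Finset.sum_comm
  simp_rw [e]
  rw [Finset.sum_comm]
  have e2 : ∀ t, ∑ s : S, ∑ a : A, (if Hit h s a (X.traj t j) then 1 else 0) = 1 := fun t => by
    rw [Finset.sum_eq_single ((X.traj t j).1 h.castSucc), Finset.sum_eq_single ((X.traj t j).2.1 h)]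
    · simp [Hit]
    · intro a _ ha
      simp [Hit, ha.symm]
    · simp
    · intro s _ hs
      exact Finset.sum_eq_zero fun a _ => by simp [Hit, hs.symm]
    · simp
  simp_rw [e2]
  simp

/-- At each step the linear terms of `size_mul_log_two_le` add up to at most `2`, which is absorbed
by the `-1` of each of the at least two pairs. For `K ≤ 2` the binary length is bounded by the
count. -/
theorem sum_size_count_le (hSA : 2 ≤ Fintype.card S * Fintype.card A) {k : ℕ} (hk : k < K)
    (j : Fin m) : ((∑ h, ∑ s, ∑ a, (count X k j h s a).size : ℕ) : ℝ) ≤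
      (Fintype.card S : ℝ) * Fintype.card A * H * Real.logb 2 K := by
  have hSAR : (2 : ℝ) ≤ (Fintype.card S : ℝ) * Fintype.card A := by exact_mod_cast hSA
  have hl2 : 0 < Real.log 2 := Real.log_pos (by norm_num)
  have hper : ∀ h : Fin H, ((∑ s, ∑ a, (count X k j h s a).size : ℕ) : ℝ) ≤
      (Fintype.card S : ℝ) * Fintype.card A * Real.logb 2 K := by
    intro h
    rcases lt_or_ge K 3 with hK | hK
    · have h1 : ∑ s, ∑ a, (count X k j h s a).size ≤ k := by
        calc ∑ s, ∑ a, (count X k j h s a).size ≤ ∑ s, ∑ a, count X k j h s a := by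
              gcongr with s _ a _
              exact Nat.size_le.2 Nat.lt_two_pow_self
          _ = k := sum_count_eq X k j h
      have h2 : (k : ℝ) ≤ Real.logb 2 K := by
        have : K = 1 ∨ K = 2 := by omega
        rcases this with rfl | rfl
        · have : k = 0 := by omega
          simp [this]
        · have : k ≤ 1 := by omega
          have : (k : ℝ) ≤ 1 := by exact_mod_cast this
          simpa using this
      have h3 : (0 : ℝ) ≤ k := Nat.cast_nonneg _
      calc ((∑ s, ∑ a, (count X k j h s a).size : ℕ) : ℝ) ≤ k := by exact_mod_cast h1
        _ ≤ 1 * Real.logb 2 K := by linarith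
        _ ≤ _ := by
          have : 0 ≤ Real.logb 2 K := h3.trans h2
          gcongr
          linarith
    · have hKR : (0 : ℝ) < K := by exact_mod_cast (by omega)
      have h1 : ∑ s : S, ∑ a : A, ((count X k j h s a).size : ℝ) * Real.log 2 ≤
          ∑ s : S, ∑ a : A, (Real.log K + (2 * (count X k j h s a : ℝ) / K - 1)) :=
        Finset.sum_le_sum fun s _ => Finset.sum_le_sum fun a _ => size_mul_log_two_le hK
      have h2 : ∑ s : S, ∑ a : A, (Real.log K + (2 * (count X k j h s a : ℝ) / K - 1)) =
          (Fintype.card S : ℝ) * Fintype.card A * (Real.log K - 1) + 2 * k / K := by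
        have h3 : (∑ s, ∑ a, (count X k j h s a : ℝ)) = k := by
          exact_mod_cast sum_count_eq X k j h
        have e : ∀ s a, Real.log K + (2 * (count X k j h s a : ℝ) / K - 1) =
            (Real.log K - 1) + 2 / K * count X k j h s a := fun s a => by ring
        simp_rw [e, Finset.sum_add_distrib, ← Finset.mul_sum]
        rw [h3]
        simp
        ring
      have h4 : 2 * (k : ℝ) / K ≤ 2 := by
        rw [div_le_iff₀ hKR]
        have : (k : ℝ) ≤ K := by exact_mod_cast hk.le
        linarith
      rw [Real.logb, ← mul_div_assoc, le_div_iff₀ hl2]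
      push_cast
      rw [Finset.sum_mul]
      simp_rw [Finset.sum_mul]
      rw [h2] at h1
      nlinarith
  calc ((∑ h, ∑ s, ∑ a, (count X k j h s a).size : ℕ) : ℝ)
      = ∑ h, ((∑ s, ∑ a, (count X k j h s a).size : ℕ) : ℝ) := by push_cast; rfl
    _ ≤ ∑ _h : Fin H, (Fintype.card S : ℝ) * Fintype.card A * Real.logb 2 K :=
        Finset.sum_le_sum fun h _ => hper h
    _ = _ := by simp; ring

theorem sum_size_lt_sum_size {n n' : Fin H → S → A → ℕ} (hle : ∀ h s a, n h s a ≤ n' h s a)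
    (hex : ∃ h s a, 0 < n' h s a ∧ 2 * n h s a ≤ n' h s a) :
    ∑ h, ∑ s, ∑ a, (n h s a).size < ∑ h, ∑ s, ∑ a, (n' h s a).size := by
  obtain ⟨h, s, a, h0, h2⟩ := hex
  have hm : ∀ h s a, (n h s a).size ≤ (n' h s a).size := fun h s a => Nat.size_le_size (hle h s a)
  refine Finset.sum_lt_sum (fun h _ => Finset.sum_le_sum fun s _ => Finset.sum_le_sum fun a _ =>
    hm h s a) ⟨h, Finset.mem_univ _, ?_⟩
  refine Finset.sum_lt_sum (fun s _ => Finset.sum_le_sum fun a _ => hm h s a)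
    ⟨s, Finset.mem_univ _, ?_⟩
  exact Finset.sum_lt_sum (fun a _ => hm h s a)
    ⟨a, Finset.mem_univ _, size_lt_size_of_two_mul_le h0 h2⟩

/-- `i` is the last synchronization. A request of a good agent means that a count has doubled, so
the total binary length of its counts has grown. Its `SyncCount` therefore stays at most that
length, which never exceeds the cap, and its requests are always accepted. Byzantine requests can
only add synchronizations. -/
theorem exists_sync_episode (tie : TieBreak A m) (B : Finset (Fin m)) (δ α : ℝ)
    (X : Transcript S A H m) (hm : 1 ≤ m)
    (hSA : 2 ≤ Fintype.card S * Fintype.card A) (k : ℕ) (hk : k < K) :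
    ∃ i ≤ k, playedPolicy tie B K δ α X k = greedy tie B K δ α X i ∧
      (∀ j, (stateBefore tie B K δ α X (k + 1)).nOld j = count X i j) ∧
      ∀ j ∉ B, (∀ h s a, count X k j h s a ≤ 2 * count X i j h s a) ∧
        (stateBefore tie B K δ α X (k + 1)).syncCount j ≤
          (∑ h, ∑ s, ∑ a, (count X i j h s a).size : ℕ) := by
  classical
  induction k with
  | zero =>
    have hcap : (-1 : ℝ) ≤ (Fintype.card S : ℝ) * Fintype.card A * H * Real.logb 2 K := by
      have : 0 ≤ Real.logb 2 K := Real.logb_nonneg (by norm_num) (by exact_mod_cast hk)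
      have : 0 ≤ (Fintype.card S : ℝ) * Fintype.card A * H * Real.logb 2 K := by positivity
      linarith
    have hacc : ∀ j, accepted B K X 0 (stateBefore tie B K δ α X 0) j := fun j =>
      ⟨by simp [syncFlag], by simpa [stateBefore] using hcap⟩
    have hex : ∃ j, accepted B K X 0 (stateBefore tie B K δ α X 0) j := ⟨⟨0, hm⟩, hacc _⟩
    refine ⟨0, le_rfl, ?_, fun j => ?_, fun j _ => ⟨fun h s a => by omega, ?_⟩⟩
    · rw [playedPolicy, stateBefore, syncPhase]
      simp only [if_pos hex]
    · rw [stateBefore, syncPhase]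
      simp only [if_pos hex]
    · rw [stateBefore, syncPhase]
      simp only [if_pos (hacc j)]
      -- The initial value `-1` makes the forced first request free: the counter is `0` afterwards.
      simp only [stateBefore, Int.reduceNeg, neg_add_cancel]
      exact Int.natCast_nonneg _
  | succ k ih =>
    obtain ⟨i, hik, hpol, hold, hgood⟩ := ih (by omega)
    set st := stateBefore tie B K δ α X (k + 1) with hst
    have hstep : stateBefore tie B K δ α X (k + 1 + 1) = syncPhase tie B K δ α X (k + 1) st := rfl
    have hmono : ∀ j h s a, count X i j h s a ≤ count X (k + 1) j h s a := fun j h s a =>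
      count_mono X j h s a (by omega)
    have hflag : ∀ j ∉ B, syncFlag B X (k + 1) st j →
        ∃ h s a, 0 < count X (k + 1) j h s a ∧ 2 * count X i j h s a ≤ count X (k + 1) j h s a := by
      intro j hj hf
      rw [syncFlag, if_neg (by omega), if_neg hj] at hf
      simpa only [hold] using hf
    by_cases hex : ∃ j, accepted B K X (k + 1) st j
    · refine ⟨k + 1, le_rfl, ?_, fun j => ?_, fun j hj => ⟨fun h s a => by omega, ?_⟩⟩
      · rw [playedPolicy, hstep, syncPhase]
        simp only [if_pos hex]
      · rw [hstep, syncPhase]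
        simp only [if_pos hex]
      · rw [hstep, syncPhase]
        simp only
        have h1 := (hgood j hj).2
        split_ifs with hacc
        · have h2 := sum_size_lt_sum_size (hmono j) (hflag j hj hacc.1)
          omega
        · refine h1.trans ?_
          exact_mod_cast Finset.sum_le_sum fun h _ => Finset.sum_le_sum fun s _ =>
            Finset.sum_le_sum fun a _ => Nat.size_le_size (hmono j h s a)
    · have hpol' : playedPolicy tie B K δ α X (k + 1) = playedPolicy tie B K δ α X k := by
        rw [playedPolicy, hstep, syncPhase]
        simp only [if_neg hex]
        rfl
      refine ⟨i, by omega, hpol'.trans hpol, fun j => ?_, fun j hj => ⟨?_, ?_⟩⟩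
      · rw [hstep, syncPhase]
        simp only [if_neg hex]
        exact hold j
      -- A pending request would be accepted, since the counter is below the total length of the
      -- current counts and hence below the cap.
      · have hnf : ¬ syncFlag B X (k + 1) st j := by
          intro hf
          refine hex ⟨j, hf, ?_⟩
          have h1 := (hgood j hj).2
          have h2 := sum_size_lt_sum_size (hmono j) (hflag j hj hf)
          have h3 := sum_size_count_le (X := X) hSA hk j
          have h4 : st.syncCount j ≤
              ((∑ h, ∑ s, ∑ a, (count X (k + 1) j h s a).size : ℕ) : ℤ) := by omega
          have h5 : (st.syncCount j : ℝ) ≤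
              ((∑ h, ∑ s, ∑ a, (count X (k + 1) j h s a).size : ℕ) : ℝ) := by exact_mod_cast h4
          exact h5.trans h3
        intro h s a
        by_contra hcon
        refine hnf ?_
        rw [syncFlag, if_neg (by omega), if_neg hj]
        refine ⟨h, s, a, by omega, ?_⟩
        rw [hold]
        omega
      · rw [hstep, syncPhase]
        simp only
        rw [if_neg fun hacc => hex ⟨j, hacc⟩]
        exact (hgood j hj).2

end Sync

/-! ### Summation over the episodes -/

section Sums

/-- `√(x + p) - √x = p / (√(x + p) + √x)`, and `p ≤ 1 ≤ x` gives `√(x + p) ≤ 2 √x`. -/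
theorem div_sqrt_le_three_mul_sqrt_sub {x p : ℝ} (hx : 1 ≤ x) (hp : 0 ≤ p) (hp1 : p ≤ 1) :
    p / √x ≤ 3 * (√(x + p) - √x) := by
  have hx0 : 0 < √x := Real.sqrt_pos.2 (by linarith)
  have h1 : √(x + p) ≤ 2 * √x := by
    rw [Real.sqrt_le_left (by positivity), mul_pow, Real.sq_sqrt (by linarith)]
    linarith
  have h2 : √x ≤ √(x + p) := Real.sqrt_le_sqrt (by linarith)
  have h3 : √x * √x = x := Real.mul_self_sqrt (by linarith)
  have h4 : √(x + p) * √(x + p) = x + p := Real.mul_self_sqrt (by linarith)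
  rw [div_le_iff₀ hx0]
  nlinarith

/-- The sum of a bound that is a constant until the cumulative weight reaches a threshold and
decays like the inverse square root of the cumulative weight afterwards. -/
theorem sum_mul_threshold_le (p : ℕ → ℝ) (hp : ∀ t, 0 ≤ p t) (hp1 : ∀ t, p t ≤ 1) {y c G e : ℝ}
    (hy : 1 ≤ y) (hc : 0 ≤ c) (hG : 0 ≤ G) (he : 0 ≤ e) (n : ℕ) :
    ∑ t ∈ Finset.range n, p t * (if ∑ i ∈ Finset.range t, p i < y then c
      else G / √(∑ i ∈ Finset.range t, p i) + e) ≤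
    c * min (∑ i ∈ Finset.range n, p i) (y + 1) + 3 * G * √(∑ i ∈ Finset.range n, p i)
      + e * ∑ i ∈ Finset.range n, p i := by
  induction n with
  | zero =>
    simp only [Finset.range_zero, Finset.sum_empty, Real.sqrt_zero, mul_zero, add_zero]
    rw [min_eq_left (by linarith), mul_zero]
  | succ n ih =>
    rw [Finset.sum_range_succ, Finset.sum_range_succ p]
    set x := ∑ i ∈ Finset.range n, p i with hx
    have hx0 : 0 ≤ x := Finset.sum_nonneg fun i _ => hp i
    have h0 := hp n
    have h1 := hp1 n
    have hsq : √x ≤ √(x + p n) := Real.sqrt_le_sqrt (by linarith)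
    split_ifs with hlt
    -- The last step below the threshold overshoots it by at most one; hence `y + 1`.
    · rw [min_eq_left (by linarith)] at ih ⊢
      have := mul_le_mul_of_nonneg_left hsq (by positivity : 0 ≤ 3 * G)
      have := mul_nonneg he h0
      linarith
    · have h2 := mul_le_mul_of_nonneg_left
        (div_sqrt_le_three_mul_sqrt_sub (hy.trans (not_lt.1 hlt)) h0 h1) hG
      have h3 : min x (y + 1) ≤ min (x + p n) (y + 1) := min_le_min (by linarith) le_rfl
      have h4 := mul_le_mul_of_nonneg_left h3 hc
      have h5 : p n * (G / √x + e) = G * (p n / √x) + e * p n := by ring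
      rw [h5]
      linarith

theorem sum_sqrt_le_sqrt_card_mul_sum {ι : Type*} [Fintype ι] (f : ι → ℝ) (hf : ∀ i, 0 ≤ f i) :
    ∑ i, √(f i) ≤ √(Fintype.card ι * ∑ i, f i) := by
  refine Real.le_sqrt_of_sq_le ?_
  have := sq_sum_le_card_mul_sum_sq (s := Finset.univ) (f := fun i => √(f i))
  simpa [Real.sq_sqrt (hf _)] using this

end Sums

/-! ### Size of the logarithmic parameters -/

section Parameters

variable {S A : Type*} [Fintype S] [Fintype A] {H m K : ℕ} {δ : ℝ}

theorem Regular.log_two_mul_two_le (hR : Regular S A H m K δ) :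
    2 * Real.log 2 ≤ Real.log (gridSize S A H m K / δ) := by
  have hδ := hR.δ_pos
  have hδ' := hR.δ_lt
  have hD : (1 : ℝ) ≤ gridSize S A H m K := by exact_mod_cast hR.gridSize_pos
  have : 2 * Real.log 2 = Real.log 4 := by
    rw [show (4 : ℝ) = 2 ^ 2 by norm_num, Real.log_pow]; norm_num
  rw [this]
  refine Real.log_le_log (by norm_num) ?_
  rw [le_div_iff₀ hδ]
  linarith

theorem Regular.one_le_log (hR : Regular S A H m K δ) :
    1 ≤ Real.log (gridSize S A H m K / δ) := by
  have := hR.log_two_mul_two_le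
  have := Real.log_two_gt_d9
  linarith

theorem Regular.log_two_mul_div_eq (hR : Regular S A H m K δ) :
    Real.log (2 * gridSize S A H m K / δ) =
      Real.log 2 + Real.log (gridSize S A H m K / δ) := by
  have hδ := hR.δ_pos
  have hD : (0 : ℝ) < gridSize S A H m K := by exact_mod_cast hR.gridSize_pos
  rw [mul_div_assoc, Real.log_mul (by norm_num) (by positivity)]

/-- The power `3S` in `δ'` costs the factor `S`, hence a factor `√S` in the error bounds; `m` and
`2` are absorbed by `m ≤ SAHKm` and `δ < 1/4`. -/
theorem Regular.log_two_mul_div_deltaParam_le (hR : Regular S A H m K δ) :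
    2 * Real.log (2 * m / deltaParam S A H m K δ) ≤
      10 * (Fintype.card S * Real.log (gridSize S A H m K / δ)) := by
  have hδ := hR.δ_pos
  have hδ' := hR.δ_lt
  have hD1 : (1 : ℝ) ≤ gridSize S A H m K := by exact_mod_cast hR.gridSize_pos
  have hm : (1 : ℝ) ≤ m := by exact_mod_cast hR.m_pos
  have hS : (1 : ℝ) ≤ Fintype.card S := by exact_mod_cast hR.card_S
  have hmD : (m : ℝ) ≤ gridSize S A H m K := by
    have h1 := hR.card_S
    have h2 : 1 ≤ Fintype.card A := le_trans (by norm_num) hR.card_A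
    have h3 := hR.H_pos
    have h5 := hR.K_pos
    have : m ≤ gridSize S A H m K := by
      rw [gridSize]
      exact Nat.le_mul_of_pos_left m (by positivity)
    exact_mod_cast this
  have hlog := hR.log_two_mul_two_le
  set D : ℝ := (gridSize S A H m K : ℝ) with hD
  have hD0 : 0 < D := by linarith
  rw [Regular.deltaParam_eq, ← hD, show 2 * (m : ℝ) / (δ / D ^ (3 * Fintype.card S)) =
    2 * m * D ^ (3 * Fintype.card S) / δ by field_simp, Real.log_div (by positivity) hδ.ne',
    Real.log_mul (by positivity) (by positivity), Real.log_mul (by norm_num) (by positivity),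
    Real.log_pow]
  rw [Real.log_div hD0.ne' hδ.ne'] at hlog ⊢
  have hlD : 0 ≤ Real.log D := Real.log_nonneg hD1
  have hlδ : Real.log δ ≤ 0 := Real.log_nonpos hδ.le (by linarith)
  have hlm : Real.log m ≤ Real.log D := Real.log_le_log (by linarith) hmD
  push_cast
  nlinarith [mul_nonneg (sub_nonneg.2 hS) hlD, mul_nonneg (sub_nonneg.2 hS) (neg_nonneg.2 hlδ)]

end Parameters

/-! ### The regret bound -/

section Regret

variable {S A : Type*} {H m : ℕ} [Fintype S] [DecidableEq S] [MeasurableSpace S]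
  [DiscreteMeasurableSpace S] [Fintype A] [DecidableEq A] [MeasurableSpace A]
  [DiscreteMeasurableSpace A] [Nonempty A]
  {M : MDP S A H} {tie : TieBreak A m} {B : Finset (Fin m)} {K : ℕ} {δ α : ℝ}
  {X : Transcript S A H m}

/-- The error bound of a synchronization in which all good agents report about `Λ` data. -/
theorem bonus_le (hR : Regular S A H m K δ) (hB : (B.card : ℝ) = α * m)
    (hα : α ≤ 1 / 3 * (1 - 1 / (m : ℝ))) {i : ℕ} {h : Fin H} {s : S} {a : A} {Λ : ℝ} (hΛ : 0 < Λ)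
    (hlow : ∀ j ∉ B, Λ / 8 ≤ count X i j h s a) (hup : ∀ j ∉ B, (count X i j h s a : ℝ) ≤ 3 * Λ) :
    bonus tie B K δ α X i h s a ≤ 167 * (1 + α * √m) * H *
      √(10 * (Fintype.card S * Real.log (gridSize S A H m K / δ))) / √m / √Λ
      + 6 * epsParam S A H m K := by
  have hn : ∀ j ∉ B, sentCount B X i h s a j = count X i j h s a := fun j hj => by
    simp [sentCount, hj]
  have hmR : (0 : ℝ) < m := by exact_mod_cast hR.m_pos
  have hα0 : 0 ≤ α := by
    have : (0 : ℝ) ≤ α * m := by rw [← hB]; positivity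
    exact nonneg_of_mul_nonneg_left this hmR
  set n := sentCount B X i h s a with hndef
  set c := nCut α n with hc
  have hclow : Λ / 8 ≤ c := by
    have : ⌈Λ / 8⌉₊ ≤ c := le_nCut_of_le_good hR.m_pos hB hα n fun j hj => by
      rw [hn j hj]
      exact Nat.ceil_le.2 (hlow j hj)
    exact Nat.ceil_le.1 this
  have hcup : (c : ℝ) ≤ 3 * Λ := by
    have : c ≤ ⌊3 * Λ⌋₊ := nCut_le_of_good_le hR.m_pos hB hα n fun j hj => by
      rw [hn j hj]
      exact Nat.le_floor (hup j hj)
    exact (Nat.le_floor_iff (by positivity)).1 this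
  have hcut : 0 < c := by
    have : (0 : ℝ) < c := by linarith
    exact_mod_cast this
  set W := ∑ j, (nTilde α n j : ℝ) with hW
  -- At least two thirds of the agents are good, each with clipped size at least `Λ / 8`.
  have hWge : m * Λ / 12 ≤ W := by
    have h3 := three_mul_card_lt hR.m_pos hB hα
    have h1 : (2 * m : ℝ) ≤ 3 * Bᶜ.card := by
      have : 2 * m ≤ 3 * Bᶜ.card := by
        rw [Finset.card_compl, Fintype.card_fin]; omega
      exact_mod_cast this
    calc m * Λ / 12 = 2 * m * (Λ / 8) / 3 := by ring
      _ ≤ 3 * Bᶜ.card * (Λ / 8) / 3 := by gcongr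
      _ = ∑ j ∈ Bᶜ, Λ / 8 := by rw [Finset.sum_const, nsmul_eq_mul]; ring
      _ ≤ ∑ j ∈ Bᶜ, (nTilde α n j : ℝ) := by
          refine Finset.sum_le_sum fun j hj => ?_
          rw [nTilde, Nat.cast_min]
          refine le_min ?_ hclow
          rw [hn j (Finset.mem_compl.1 hj)]
          exact hlow j (Finset.mem_compl.1 hj)
      _ ≤ W := Finset.sum_le_sum_of_subset_of_nonneg (Finset.subset_univ _)
          fun j _ _ => Nat.cast_nonneg _
  have hWpos : 0 < W := lt_of_lt_of_le (by positivity) hWge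
  set g := √(10 * (Fintype.card S * Real.log (gridSize S A H m K / δ))) with hg
  have hw : √(2 * Real.log (2 * m / deltaParam S A H m K δ)) ≤ g :=
    Real.sqrt_le_sqrt hR.log_two_mul_div_deltaParam_le
  have hu : √(2 * Real.log (2 / deltaParam S A H m K δ)) ≤ g := by
    refine le_trans (Real.sqrt_le_sqrt ?_) hw
    have hd := hR.deltaParam_pos
    have hm1 : (1 : ℝ) ≤ m := by exact_mod_cast hR.m_pos
    gcongr
    linarith
  have hσ0 := cast_sub_nonneg h
  have hσH : (H : ℝ) - h ≤ H := by
    have : (0 : ℝ) ≤ (h : ℕ) := Nat.cast_nonneg _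
    linarith
  have hsΛ : 0 < √Λ := Real.sqrt_pos.2 hΛ
  have hsm : 0 < √(m : ℝ) := Real.sqrt_pos.2 hmR
  have hg0 : 0 ≤ g := Real.sqrt_nonneg _
  have ha : 2 / √W ≤ 7 / √m / √Λ := by
    have h1 : √m * √Λ / √12 ≤ √W := by
      rw [← Real.sqrt_mul hmR.le, ← Real.sqrt_div (by positivity)]
      exact Real.sqrt_le_sqrt hWge
    have h12 : √12 ≤ 7 / 2 := by
      rw [Real.sqrt_le_left (by norm_num)]; norm_num
    have h12' : 0 < √12 := by positivity
    calc 2 / √W ≤ 2 / (√m * √Λ / √12) := by gcongr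
      _ = 2 * √12 / √m / √Λ := by field_simp
      _ ≤ 2 * (7 / 2) / √m / √Λ := by gcongr
      _ = _ := by norm_num
  -- `c ≤ 3 Λ` and `hWge` give `8 · 12 · √3 = 96 √3 ≤ 167`.
  have hb : 8 * α * m * √c / W ≤ 167 * (α * √m) / √m / √Λ := by
    have h3 : √3 ≤ 167 / 96 := by
      rw [Real.sqrt_le_left (by norm_num)]; norm_num
    have e : Λ = √Λ * √Λ := (Real.mul_self_sqrt hΛ.le).symm
    calc 8 * α * m * √c / W ≤ 8 * α * m * √(3 * Λ) / (m * Λ / 12) := by gcongr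
      _ = 96 * α * √3 * (√Λ / Λ) := by
          rw [Real.sqrt_mul (by norm_num)]
          field_simp
          ring
      _ = 96 * α * √3 / √Λ := by rw [Real.sqrt_div_self']; ring
      _ ≤ 96 * α * (167 / 96) / √Λ := by gcongr
      _ = _ := by field_simp
  have hbon : bonus tie B K δ α X i h s a = 2 / √W * ((H : ℝ) - h) *
      √(2 * Real.log (2 / deltaParam S A H m K δ))
      + 8 * α * m * √c / W * ((H : ℝ) - h) * √(2 * Real.log (2 * m / deltaParam S A H m K δ))
      + 5 * epsParam S A H m K + epsParam S A H m K := by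
    rw [bonus, pwc, if_pos hcut]
  rw [hbon]
  have t1 : 2 / √W * ((H : ℝ) - h) * √(2 * Real.log (2 / deltaParam S A H m K δ)) ≤
      7 / √m / √Λ * H * g := by gcongr
  have t2 : 8 * α * m * √c / W * ((H : ℝ) - h) *
      √(2 * Real.log (2 * m / deltaParam S A H m K δ)) ≤
      167 * (α * √m) / √m / √Λ * H * g := by gcongr
  have t3 : 167 * (1 + α * √m) * H * g / √m / √Λ =
      7 / √m / √Λ * H * g + 167 * (α * √m) / √m / √Λ * H * g + 160 / √m / √Λ * H * g := by ring
  have t4 : 0 ≤ 160 / √m / √Λ * H * g := by positivity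
  linarith

/-- Above the threshold the additive logarithm in `CountBounded` is at most `Λ / 4`, and the counts
at the last synchronization are at least half the current ones; this yields `Λ / 8` and `3 Λ`. Below
it only the truncation is used. -/
theorem min_bonus_le (hR : Regular S A H m K δ) (hB : (B.card : ℝ) = α * m)
    (hα : α ≤ 1 / 3 * (1 - 1 / (m : ℝ))) (hC : CountBounded M tie B K δ α X) {k i : ℕ} (hk : k < K)
    (hik : i ≤ k) (hi : ∀ j ∉ B, ∀ h s a, count X k j h s a ≤ 2 * count X i j h s a)
    (h : Fin H) (s : S) (a : A) :
    min (2 * bonus tie B K δ α X i h s a) ((H : ℝ) - h) ≤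
      if expectedCount M tie B K δ α X k h s a < 4 * Real.log (2 * gridSize S A H m K / δ) then
        (H : ℝ)
      else 334 * (1 + α * √m) * H * √(10 * (Fintype.card S *
        Real.log (gridSize S A H m K / δ))) / √m / √(expectedCount M tie B K δ α X k h s a)
        + 12 * epsParam S A H m K := by
  split_ifs with hlt
  · refine (min_le_right _ _).trans ?_
    have : (0 : ℝ) ≤ (h : ℕ) := Nat.cast_nonneg _
    linarith
  · set Λ := expectedCount M tie B K δ α X k h s a with hΛ
    have hl : 1 ≤ Real.log (2 * gridSize S A H m K / δ) := by
      rw [hR.log_two_mul_div_eq]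
      have := hR.one_le_log
      have := Real.log_nonneg (show (1 : ℝ) ≤ 2 by norm_num)
      linarith
    have hge := not_lt.1 hlt
    have := bonus_le (tie := tie) (X := X) hR hB hα (i := i) (h := h) (s := s) (a := a) (Λ := Λ)
      (by linarith) (fun j hj => ?_) (fun j hj => ?_)
    · refine (min_le_left _ _).trans ((mul_le_mul_of_nonneg_left this (by norm_num)).trans
        (le_of_eq ?_))
      ring
    · have h1 := (hC k hk j hj h s a).2
      have h2 : (count X k j h s a : ℝ) ≤ 2 * count X i j h s a := by exact_mod_cast hi j hj h s a
      linarith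
    · have h1 := (hC k hk j hj h s a).1
      have h2 : (count X i j h s a : ℝ) ≤ count X k j h s a := by
        exact_mod_cast count_mono X j h s a hik
      linarith

theorem sum_expectedCount (X : Transcript S A H m) :
    ∑ q : Fin H × S × A, expectedCount M tie B K δ α X K q.1 q.2.1 q.2.2 = H * K := by
  simp only [Fintype.sum_prod_type, expectedCount]
  have e : ∀ h : Fin H, ∑ s, ∑ a, ∑ t ∈ Finset.range K,
      occupancy M (playedPolicy tie B K δ α X t) h s a = K := by
    intro h
    have e1 : ∀ s, ∑ a, ∑ t ∈ Finset.range K, occupancy M (playedPolicy tie B K δ α X t) h s a =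
        ∑ t ∈ Finset.range K, ∑ a, occupancy M (playedPolicy tie B K δ α X t) h s a :=
      fun s => Finset.sum_comm
    simp_rw [e1]
    rw [Finset.sum_comm]
    simp_rw [sum_occupancy_eq_one]
    simp
  simp_rw [e]
  simp

theorem sum_occupancy_mul_min_le (hR : Regular S A H m K δ) (hB : (B.card : ℝ) = α * m)
    (hα : α ≤ 1 / 3 * (1 - 1 / (m : ℝ))) (hN : NoiseBounded M B K δ X)
    (hC : CountBounded M tie B K δ α X) :
    ∑ k ∈ Finset.range K, (optValue M - value M (playedPolicy tie B K δ α X k)) ≤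
      H * (4 * Real.log (2 * gridSize S A H m K / δ) + 1) *
          (Fintype.card S * Fintype.card A * H)
        + 3 * (334 * (1 + α * √m) * H * √(10 * (Fintype.card S *
            Real.log (gridSize S A H m K / δ))) / √m) *
          √(H * Fintype.card S * Fintype.card A * (H * K))
        + 12 * epsParam S A H m K * (H * K) := by
  have hmR : (0 : ℝ) < m := by exact_mod_cast hR.m_pos
  have hα0 : 0 ≤ α := by
    have : (0 : ℝ) ≤ α * m := by rw [← hB]; positivity
    exact nonneg_of_mul_nonneg_left this hmR
  set l := Real.log (2 * gridSize S A H m K / δ) with hl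
  have hl1 : 1 ≤ l := by
    rw [hl, hR.log_two_mul_div_eq]
    have := hR.one_le_log
    have := Real.log_nonneg (show (1 : ℝ) ≤ 2 by norm_num)
    linarith
  set G := 334 * (1 + α * √m) * H * √(10 * (Fintype.card S *
            Real.log (gridSize S A H m K / δ))) / √m with hG
  have hG0 : 0 ≤ G := by positivity
  have hε := epsParam_nonneg S A H m K
  set Λ : ℕ → Fin H × S × A → ℝ := fun k q =>
    expectedCount M tie B K δ α X k q.1 q.2.1 q.2.2 with hΛ
  have hΛ0 : ∀ k q, 0 ≤ Λ k q := fun k q => expectedCount_nonneg X k _ _ _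
  set p : ℕ → Fin H × S × A → ℝ := fun k q =>
    occupancy M (playedPolicy tie B K δ α X k) q.1 q.2.1 q.2.2 with hp
  have hSA : 2 ≤ Fintype.card S * Fintype.card A := by
    have h1 := hR.card_S
    have h2 := hR.card_A
    nlinarith
  have hep : ∀ k ∈ Finset.range K, optValue M - value M (playedPolicy tie B K δ α X k) ≤
      ∑ q, p k q * (if Λ k q < 4 * l then (H : ℝ) else G / √(Λ k q) + 12 * epsParam S A H m K) := by
    intro k hk
    rw [Finset.mem_range] at hk
    obtain ⟨i, hik, hpol, -, hgood⟩ := exists_sync_episode tie B δ α X hR.m_pos hSA k hk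
    have h1 := optValue_sub_value_greedy_le (tie := tie) hN hR.m_pos hB hα hR.gridSize_pos
      (hik.trans_lt hk)
    rw [← hpol] at h1
    refine h1.trans ?_
    simp only [Fintype.sum_prod_type]
    refine Finset.sum_le_sum fun h _ => Finset.sum_le_sum fun s _ => Finset.sum_le_sum fun a _ => ?_
    exact mul_le_mul_of_nonneg_left
      (min_bonus_le hR hB hα hC hk hik (fun j hj => (hgood j hj).1) h s a)
      (occupancy_nonneg _ _ _ _ _)
  refine (Finset.sum_le_sum hep).trans ?_
  -- Each triple is summed over the episodes on its own; Cauchy–Schwarz then combines the roots, the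
  -- final expected counts having sum `H K`.
  rw [Finset.sum_comm]
  have hq : ∀ q, ∑ k ∈ Finset.range K, p k q *
      (if Λ k q < 4 * l then (H : ℝ) else G / √(Λ k q) + 12 * epsParam S A H m K) ≤
      H * (4 * l + 1) + 3 * G * √(Λ K q) + 12 * epsParam S A H m K * Λ K q := by
    intro q
    have := sum_mul_threshold_le (fun k => p k q) (fun k => occupancy_nonneg _ _ _ _ _)
      (fun k => occupancy_le_one _ _ _ _ _) (y := 4 * l) (c := H) (G := G)
      (e := 12 * epsParam S A H m K) (by linarith) (by positivity) hG0 (by positivity) K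
    refine this.trans ?_
    change H * min (Λ K q) (4 * l + 1) + _ + _ ≤ _
    have h2 : (H : ℝ) * min (Λ K q) (4 * l + 1) ≤ H * (4 * l + 1) := by
      gcongr
      exact min_le_right _ _
    exact add_le_add (add_le_add h2 le_rfl) le_rfl
  refine (Finset.sum_le_sum fun q _ => hq q).trans ?_
  have hsum : ∑ q, Λ K q = H * K := sum_expectedCount X
  rw [Finset.sum_add_distrib, Finset.sum_add_distrib, Finset.sum_const, nsmul_eq_mul,
    ← Finset.mul_sum, ← Finset.mul_sum, hsum]
  have hcard : ((Finset.univ : Finset (Fin H × S × A)).card : ℝ) =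
      H * Fintype.card S * Fintype.card A := by
    rw [Finset.card_univ]
    simp
    ring
  have hsq := sum_sqrt_le_sqrt_card_mul_sum (Λ K) (hΛ0 K)
  rw [hsum, ← Finset.card_univ, hcard] at hsq
  rw [hcard]
  have h3 := mul_le_mul_of_nonneg_left hsq (by positivity : 0 ≤ 3 * G)
  linarith

theorem regret_le (hR : Regular S A H m K δ) (hB : (B.card : ℝ) = α * m)
    (hα : α ≤ 1 / 3 * (1 - 1 / (m : ℝ))) (hN : NoiseBounded M B K δ X)
    (hC : CountBounded M tie B K δ α X) :
    regret M tie B K δ α X ≤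
      5000 * ((1 + α * √m) * (H : ℝ) ^ 2 * Fintype.card S
        * √((Fintype.card A : ℝ) * m * K * Real.log (gridSize S A H m K / δ))
        + (Fintype.card S : ℝ) * Fintype.card A * (H : ℝ) ^ 2 * m
          * Real.log (gridSize S A H m K / δ)) := by
  have hmR : (0 : ℝ) < m := by exact_mod_cast hR.m_pos
  have hα0 : 0 ≤ α := by
    have : (0 : ℝ) ≤ α * m := by rw [← hB]; positivity
    exact nonneg_of_mul_nonneg_left this hmR
  have hS : (1 : ℝ) ≤ Fintype.card S := by exact_mod_cast hR.card_S
  have hA : (1 : ℝ) ≤ Fintype.card A := by exact_mod_cast (show 1 ≤ 2 by norm_num).trans hR.card_A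
  have hH : (1 : ℝ) ≤ H := by exact_mod_cast hR.H_pos
  have hK : (1 : ℝ) ≤ K := by exact_mod_cast hR.K_pos
  have hm1 : (1 : ℝ) ≤ m := by exact_mod_cast hR.m_pos
  have hL := hR.one_le_log
  have hl2 := hR.log_two_mul_two_le
  have hmain := sum_occupancy_mul_min_le hR hB hα hN hC
  rw [hR.log_two_mul_div_eq] at hmain
  have hε : epsParam S A H m K = 1 / (Fintype.card S * Fintype.card A * H * K * m) := rfl
  set L := Real.log (gridSize S A H m K / δ) with hLdef
  set s : ℝ := (Fintype.card S : ℝ) with hs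
  set a : ℝ := (Fintype.card A : ℝ) with ha
  have hreg : regret M tie B K δ α X =
      Bᶜ.card * ∑ k ∈ Finset.range K, (optValue M - value M (playedPolicy tie B K δ α X k)) := by
    rw [regret, Finset.mul_sum]
    exact Finset.sum_congr rfl fun k _ => by rw [Finset.sum_const, nsmul_eq_mul]
  have hl20 : 0 ≤ Real.log 2 := Real.log_nonneg (by norm_num)
  have hcard : (Bᶜ.card : ℝ) ≤ m := by
    have : Bᶜ.card ≤ m := (Finset.card_le_univ _).trans (by simp)
    exact_mod_cast this
  have hsm : 0 < √(m : ℝ) := Real.sqrt_pos.2 hmR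
  have ht1 : m * (H * (4 * (Real.log 2 + L) + 1) * (s * a * H)) ≤
      9 * (s * a * (H : ℝ) ^ 2 * m * L) := by
    have : 4 * (Real.log 2 + L) + 1 ≤ 9 * L := by linarith
    calc m * (H * (4 * (Real.log 2 + L) + 1) * (s * a * H))
        ≤ m * (H * (9 * L) * (s * a * H)) := by gcongr
      _ = _ := by ring
  -- `4008 = 3 · 334 · 4` with `√10 ≤ 4`. The sum over agents turns `1 / √m` into `√m`, and the
  -- factors `√S` from the union bound and from Cauchy–Schwarz combine to `S`.
  have ht2 : m * (3 * (334 * (1 + α * √m) * H * √(10 * (s * L)) / √m) * √(H * s * a * (H * K))) ≤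
      4008 * ((1 + α * √m) * (H : ℝ) ^ 2 * s * √(a * m * K * L)) := by
    have e1 : √(10 * (s * L)) ≤ 4 * √(s * L) := by
      rw [Real.sqrt_mul (by norm_num)]
      gcongr
      rw [Real.sqrt_le_left (by norm_num)]
      norm_num
    have e2 : √(H * s * a * (H * K)) = H * √(s * (a * K)) := by
      rw [show H * s * a * (H * K) = (H : ℝ) ^ 2 * (s * (a * K)) by ring,
        Real.sqrt_mul (by positivity), Real.sqrt_sq (by linarith)]
    have e3 : √(a * m * K * L) = √m * (√(a * K) * √L) := by
      rw [← Real.sqrt_mul (by positivity), ← Real.sqrt_mul (by positivity)]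
      congr 1; ring
    have e4 : √(s * L) * √(s * (a * K)) = s * (√(a * K) * √L) := by
      rw [Real.sqrt_mul (by linarith), Real.sqrt_mul (by linarith)]
      nth_rewrite 3 [← Real.mul_self_sqrt (show 0 ≤ s by linarith)]
      ring
    have e5 : (m : ℝ) / √m = √m := Real.div_sqrt
    calc m * (3 * (334 * (1 + α * √m) * H * √(10 * (s * L)) / √m) * √(H * s * a * (H * K)))
        ≤ m * (3 * (334 * (1 + α * √m) * H * (4 * √(s * L)) / √m) * (H * √(s * (a * K)))) := by
          rw [e2]; gcongr
      _ = 4008 * ((1 + α * √m) * (H : ℝ) ^ 2) * (m / √m) * (√(s * L) * √(s * (a * K))) := by ring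
      _ = _ := by rw [e3, e4, e5]; ring
  -- `ε = 1 / (SAHKm)` makes the total discretization error at most a constant.
  have ht3 : m * (12 * epsParam S A H m K * (H * K)) ≤ 12 * (s * a * (H : ℝ) ^ 2 * m * L) := by
    have e1 : m * (12 * epsParam S A H m K * (H * K)) = 12 / (s * a) := by
      rw [hε]; field_simp
    have h1 : (1 : ℝ) ≤ s * a := one_le_mul_of_one_le_of_one_le hS hA
    have h2 : (1 : ℝ) ≤ (H : ℝ) ^ 2 := one_le_pow₀ hH
    have h3 : (1 : ℝ) ≤ s * a * (H : ℝ) ^ 2 * m * L :=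
      one_le_mul_of_one_le_of_one_le (one_le_mul_of_one_le_of_one_le
        (one_le_mul_of_one_le_of_one_le h1 h2) hm1) hL
    rw [e1]
    calc 12 / (s * a) ≤ 12 := div_le_self (by norm_num) h1
      _ ≤ _ := by linarith
  have h0 : 0 ≤ H * (4 * (Real.log 2 + L) + 1) * (s * a * H)
        + 3 * (334 * (1 + α * √m) * H * √(10 * (s * L)) / √m) * √(H * s * a * (H * K))
        + 12 * epsParam S A H m K * (H * K) := by
    have := epsParam_nonneg S A H m K
    positivity
  have p1 : 0 ≤ (1 + α * √m) * (H : ℝ) ^ 2 * s * √(a * m * K * L) := by positivity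
  have p2 : 0 ≤ s * a * (H : ℝ) ^ 2 * m * L := by positivity
  have h5 := mul_le_mul_of_nonneg_left hmain (Nat.cast_nonneg (α := ℝ) Bᶜ.card)
  have h6 := mul_le_mul_of_nonneg_right hcard h0
  rw [hreg]
  refine h5.trans (h6.trans ?_)
  rw [mul_add, mul_add]
  linarith

/-- With one action all policies coincide. This case is separate because the request cap and the
grid count are estimated with at least two actions. -/
theorem regret_eq_zero_of_subsingleton [Subsingleton A] : regret M tie B K δ α X = 0 := by
  have : ∀ π, optValue M = value M π := fun π => by
    rw [optValue]
    refine le_antisymm (ciSup_le fun π' => by rw [Subsingleton.elim π' π]) ?_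
    exact le_ciSup (f := fun π => value M π) (Set.finite_range _).bddAbove π
  rw [regret]
  exact Finset.sum_eq_zero fun k _ => Finset.sum_eq_zero fun _ _ => sub_eq_zero.2 (this _)

theorem IsByzantineRun.le_measureReal_regret_le {Ω : Type*} {mΩ : MeasurableSpace Ω}
    {μ : Measure Ω} [IsProbabilityMeasure μ] {ℱ : Filtration ℕ mΩ} {X : Ω → Transcript S A H m}
    (hX : IsByzantineRun μ ℱ M tie B K δ α X) (hR : Regular S A H m K δ)
    (hB : (B.card : ℝ) = α * m) (hα : α ≤ 1 / 3 * (1 - 1 / (m : ℝ))) :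
    1 - 3 * δ ≤ μ.real {ω | regret M tie B K δ α (X ω) ≤
      5000 * ((1 + α * √m) * (H : ℝ) ^ 2 * Fintype.card S
        * √((Fintype.card A : ℝ) * m * K * Real.log (gridSize S A H m K / δ))
        + (Fintype.card S : ℝ) * Fintype.card A * (H : ℝ) ^ 2 * m
          * Real.log (gridSize S A H m K / δ))} := by
  set E : Set Ω := {ω | regret M tie B K δ α (X ω) ≤
      5000 * ((1 + α * √m) * (H : ℝ) ^ 2 * Fintype.card S
        * √((Fintype.card A : ℝ) * m * K * Real.log (gridSize S A H m K / δ))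
        + (Fintype.card S : ℝ) * Fintype.card A * (H : ℝ) ^ 2 * m
          * Real.log (gridSize S A H m K / δ))} with hE
  -- Covering the whole space needs only subadditivity, so neither the regret event nor the good
  -- events have to be measurable.
  have hcover : (Set.univ : Set Ω) ⊆ E ∪ ({ω | ¬ NoiseBounded M B K δ (X ω)} ∪
      {ω | ¬ CountBounded M tie B K δ α (X ω)}) := by
    intro ω _
    by_cases h1 : NoiseBounded M B K δ (X ω)
    · by_cases h2 : CountBounded M tie B K δ α (X ω)
      · exact Or.inl (regret_le hR hB hα h1 h2)
      · exact Or.inr (Or.inr h2)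
    · exact Or.inr (Or.inl h1)
  have h1 := measureReal_mono (μ := μ) hcover
  have h2 := measureReal_union_le (μ := μ) E ({ω | ¬ NoiseBounded M B K δ (X ω)} ∪
      {ω | ¬ CountBounded M tie B K δ α (X ω)})
  have h3 := measureReal_union_le (μ := μ) {ω | ¬ NoiseBounded M B K δ (X ω)}
      {ω | ¬ CountBounded M tie B K δ α (X ω)}
  have hδ := hR.δ_pos
  have h4 : μ.real {ω | ¬ NoiseBounded M B K δ (X ω)} ≤ 2 * δ :=
    ENNReal.toReal_le_of_le_ofReal (by linarith) (hX.measure_not_noiseBounded_le hR)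
  have h5 : μ.real {ω | ¬ CountBounded M tie B K δ α (X ω)} ≤ δ :=
    ENNReal.toReal_le_of_le_ofReal hδ.le (hX.measure_not_countBounded_le hR)
  rw [probReal_univ] at h1
  linarith

end Regret

end ByzRL

open ByzRL
theorem theorem2 :
    ∃ C : ℝ, 0 < C ∧
      ∀ (S A : Type*) [Fintype S] [DecidableEq S] [MeasurableSpace S] [DiscreteMeasurableSpace S]
        [Fintype A] [DecidableEq A] [Nonempty A] [MeasurableSpace A] [DiscreteMeasurableSpace A]
        (H m K : ℕ) (_ : 1 ≤ H) (_ : 1 ≤ m) (_ : 1 ≤ K)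
        (M : MDP S A H) (tie : TieBreak A m)
        (α : ℝ) (B : Finset (Fin m)) (_ : (B.card : ℝ) = α * m) (_ : α ≤ 1 / 3 * (1 - 1 / (m : ℝ)))
        (δ : ℝ) (_ : 0 < δ) (_ : δ < 1 / 4)
        (Ω : Type*) [mΩ : MeasurableSpace Ω] (μ : Measure Ω) [IsProbabilityMeasure μ]
        (ℱ : Filtration ℕ mΩ) (X : Ω → Transcript S A H m)
        (_ : IsByzantineRun μ ℱ M tie B K δ α X),
        1 - 3 * δ ≤ μ.real {ω | regret M tie B K δ α (X ω) ≤
          C * ((1 + α * √m) * (H : ℝ) ^ 2 * Fintype.card S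
                * √((Fintype.card A : ℝ) * m * K
                    * Real.log ((Fintype.card S : ℝ) * Fintype.card A * H * K * m / δ))
              + (Fintype.card S : ℝ) * Fintype.card A * (H : ℝ) ^ 2 * m
                * Real.log ((Fintype.card S : ℝ) * Fintype.card A * H * K * m / δ))} := by
  refine ⟨5000, by norm_num, ?_⟩
  intro S A _ _ _ _ _ _ _ _ _ H m K hH hm hK M tie α B hB hα δ hδ hδ' Ω _ μ _ ℱ X hX
  have hS : 1 ≤ Fintype.card S := Fintype.card_pos_iff.2 ⟨M.s₁⟩
  have hgrid : (Fintype.card S : ℝ) * Fintype.card A * H * K * m = gridSize S A H m K := by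
    simp [gridSize]
  rw [hgrid]
  by_cases hA : 2 ≤ Fintype.card A
  · exact hX.le_measureReal_regret_le ⟨hS, hA, hH, hm, hK, hδ, hδ'⟩ hB hα
  · have : Subsingleton A := Fintype.card_le_one_iff_subsingleton.1 (by omega)
    have hA1 : 1 ≤ Fintype.card A := Fintype.card_pos
    have hmR : (0 : ℝ) < m := by exact_mod_cast hm
    have hα0 : 0 ≤ α := by
      have : (0 : ℝ) ≤ α * m := by rw [← hB]; positivity
      exact nonneg_of_mul_nonneg_left this hmR
    have hlog : 0 ≤ Real.log (gridSize S A H m K / δ) := by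
      refine Real.log_nonneg ?_
      rw [le_div_iff₀ hδ]
      have : 1 ≤ gridSize S A H m K := Nat.succ_le_of_lt (by unfold gridSize; positivity)
      have : (1 : ℝ) ≤ gridSize S A H m K := by exact_mod_cast this
      linarith
    have huniv : {ω | regret M tie B K δ α (X ω) ≤
        5000 * ((1 + α * √m) * (H : ℝ) ^ 2 * Fintype.card S
          * √((Fintype.card A : ℝ) * m * K * Real.log (gridSize S A H m K / δ))
          + (Fintype.card S : ℝ) * Fintype.card A * (H : ℝ) ^ 2 * m
            * Real.log (gridSize S A H m K / δ))} = Set.univ := by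
      refine Set.eq_univ_of_forall fun ω => ?_
      rw [Set.mem_ofPred_eq, regret_eq_zero_of_subsingleton]
      positivity
    rw [huniv, probReal_univ]
    linarith
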